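/- Let $\lambda>0$ and $\beta\in(0,1)$. Let $\alpha$ be a random variable with values in $(0,1)$ whose law has a probability density of the form $\psi(x)(1-x)^\beta$, $x\in(0,1)$, where $\psi\ge 0$ and $\lim_{x\uparrow1}\psi(x)=\psi_1\in(0,\infty)$. Let $X_0$, $\varepsilon_k$, $\xi_{k,l}$ ($k,l\ge1$) be random variables that are conditionally independent given $\alpha$, where, given $\alpha$, $X_0$ is Poisson with mean $\lambda/(1-\alpha)$, each $\varepsilon_k$ is Poisson with mean $\lambda$, and each $\xi_{k,l}$ is Bernoulli with $\mathbb P(\xi_{k,l}=1\mid\alpha)=\alpha$. Define the randomized INAR(1) process $$X_k=\sum_{l=1}^{X_{k-1}}\xi_{k,l}+\varepsilon_k,\qquad k\ge1 .$$ Let $X^{(j)}=(X^{(j)}_k)_{k\ge0}$, $j=1,2,\dots$, be independent copies of the process $(X_k)_{k\ge0}$. Then every $X^{(j)}_k$ is integrable; put $$S^{(N,n)}_t=\sum_{j=1}^N\sum_{k=1}^{\lfloor nt\rfloor}\bigl(X^{(j)}_k-\mathbb E X^{(j)}_k\bigr),\qquad t\ge0 .$$ Write $\mathcal D_f\text{-}\lim$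 for the limit in the sense of weak convergence of all finite-dimensional distributions; in an iterated limit the inner limit exists, as a process, for each fixed value $\ge 1$ of the other index. Then $$\mathcal D_f\text{-}\lim_{n\to\infty}\,\mathcal D_f\text{-}\lim_{N\to\infty}\,n^{-1}N^{-\frac1{1+\beta}}S^{(N,n)} =\mathcal D_f\text{-}\lim_{N\to\infty}\,\mathcal D_f\text{-}\lim_{n\to\infty}\,n^{-1}N^{-\frac1{1+\beta}}S^{(N,n)} =(Z_{1+\beta}\,t)_{t\ge0},$$ where $Z_{1+\beta}$ is a $(1+\beta)$-stable random variable, totally skewed to the right, with characteristic function $$\mathbb E\bigl(e^{i\theta Z_{1+\beta}}\bigr)=e^{-|\theta|^{1+\beta}\omega_\beta(\theta)},\qquad \omega_\beta(\theta)=\frac{\psi_1\,\Gamma(1-\beta)\,\lambda^{1+\beta}}{-\beta(1+\beta)}\,e^{-i\pi\,\mathrm{sign}(\theta)(1+\beta)/2},\qquad\theta\in\mathbb R .$$ -/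

import Mathlib

open MeasureTheory ProbabilityTheory Filter
open scoped NNReal ENNReal Topology

namespace RandomizedINAR

noncomputable section

/-- Poisson weight `r ^ m / m! * exp (-r)`. -/
def poissonWeight (r : ℝ) (m : ℕ) : ℝ := r ^ m / (Nat.factorial m : ℝ) * Real.exp (-r)

/-- Bernoulli weight: mass `a` at `1` and mass `1 - a` at `0`. -/
def bernoulliWeight (a : ℝ) (m : ℕ) : ℝ := if m = 1 then a else if m = 0 then 1 - a else 0

/-- Joint conditional probability, given the thinning parameter `a`, of the event
`X₀ = x₀`, `ε k = e k`, `ξ k l = x k l` for `k, l < n`, when all these variables are independent,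
`X₀` is Poisson with mean `lam / (1 - a)`, the `ε k` are Poisson with mean `lam`, and the
`ξ k l` are Bernoulli with success probability `a`. -/
def jointWeight (lam a : ℝ) (n : ℕ) (x₀ : ℕ) (e : ℕ → ℕ) (x : ℕ → ℕ → ℕ) : ℝ :=
  poissonWeight (lam / (1 - a)) x₀ *
    (∏ k ∈ Finset.range n, poissonWeight lam (e k)) *
    ∏ k ∈ Finset.range n, ∏ l ∈ Finset.range n, bernoulliWeight a (x k l)

/-- The random mechanism driving a randomized INAR(1) process with Poisson innovations of mean
`lam`: given the random thinning parameter `α`, the variables `X₀`, `ε k`, `ξ k l` are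
conditionally independent, `X₀` is Poisson with mean `lam / (1 - α)`, the `ε k` are Poisson with
mean `lam`, and the `ξ k l` are Bernoulli with parameter `α`. The joint law is given on its
finite-dimensional cylinders. Here `ε k` and `ξ k l` are the immigration into generation `k + 1`
and the offspring number of the individual `l + 1` of generation `k`. -/
structure IsDriving {Ω : Type*} [MeasurableSpace Ω] (P : Measure Ω) (lam : ℝ)
    (α : Ω → ℝ) (X₀ : Ω → ℕ) (ε : ℕ → Ω → ℕ) (ξ : ℕ → ℕ → Ω → ℕ) : Prop where
  measurable_param : Measurable α
  measurable_init : Measurable X₀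
  measurable_immigration : ∀ k, Measurable (ε k)
  measurable_offspring : ∀ k l, Measurable (ξ k l)
  joint_law : ∀ (n : ℕ) (B : Set ℝ), MeasurableSet B →
    ∀ (x₀ : ℕ) (e : ℕ → ℕ) (x : ℕ → ℕ → ℕ),
      P {ω | α ω ∈ B ∧ X₀ ω = x₀ ∧ (∀ k < n, ε k ω = e k) ∧
          ∀ k < n, ∀ l < n, ξ k l ω = x k l}
        = ∫⁻ a in B, ENNReal.ofReal (jointWeight lam a n x₀ e x) ∂(P.map α)

/-- The process `X_0 = X₀`, `X_{k+1} = ∑_{l < X_k} ξ k l + ε k`. -/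
def inar {Ω : Type*} (X₀ : Ω → ℕ) (ε : ℕ → Ω → ℕ) (ξ : ℕ → ℕ → Ω → ℕ) : ℕ → Ω → ℕ
  | 0, ω => X₀ ω
  | k + 1, ω => (∑ l ∈ Finset.range (inar X₀ ε ξ k ω), ξ k l ω) + ε k ω

/-- The law on `ℝ` with Lebesgue density `ψ x * (1 - x) ^ β` on `(0, 1)`. -/
def mixingLaw (ψ : ℝ → ℝ) (β : ℝ) : Measure ℝ :=
  (volume.restrict (Set.Ioo (0 : ℝ) 1)).withDensity
    (fun x => ENNReal.ofReal (ψ x * (1 - x) ^ β))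

/-- The aggregated process, centred by the unconditional expectation: the sum over the first `N`
copies and over `1 ≤ k ≤ ⌊n t⌋` of `X j k - 𝔼 (X j k)`. -/
def aggregate {Ω : Type*} [MeasurableSpace Ω] (P : Measure Ω) (X : ℕ → ℕ → Ω → ℕ)
    (N n : ℕ) (t : ℝ≥0) (ω : Ω) : ℝ :=
  ∑ j ∈ Finset.range N, ∑ k ∈ Finset.Icc 1 ⌊(n : ℝ) * (t : ℝ)⌋₊,
    ((X j k ω : ℝ) - ∫ ω', (X j k ω' : ℝ) ∂P)

/-- Weak convergence, as the index tends to infinity, of all finite-dimensional distributions of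
the processes `Y n` (defined under `P n`) to those of `Z` (defined under `Q`). -/
def FddTendsto {Ω : ℕ → Type*} {Ω' : Type*} [∀ n, MeasurableSpace (Ω n)] [MeasurableSpace Ω']
    (Y : (n : ℕ) → ℝ≥0 → Ω n → ℝ) (P : (n : ℕ) → Measure (Ω n))
    [∀ n, IsProbabilityMeasure (P n)]
    (Z : ℝ≥0 → Ω' → ℝ) (Q : Measure Ω') [IsProbabilityMeasure Q] : Prop :=
  ∀ I : Finset ℝ≥0,
    TendstoInDistribution (fun n ω (t : I) => Y n t ω) atTop (fun ω (t : I) => Z t ω) P Q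

/-- Iterated limit of finite-dimensional distributions, first in the second index `q` of
`Y p q` and then in the first index `p`: for every `p ≥ 1` the processes `Y p q` converge as
`q → ∞` to some process (the coordinate process under a probability measure `L p` on `ℝ^[0,∞)`),
and these limit processes converge to `Z` as `p → ∞`. -/
def IteratedFddLimit {Ω Ω' : Type*} [MeasurableSpace Ω] [MeasurableSpace Ω']
    (Y : ℕ → ℕ → ℝ≥0 → Ω → ℝ) (P : Measure Ω) [IsProbabilityMeasure P]
    (Z : ℝ≥0 → Ω' → ℝ) (Q : Measure Ω') [IsProbabilityMeasure Q] : Prop :=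
  ∃ L : ℕ → ProbabilityMeasure (ℝ≥0 → ℝ),
    (∀ p, 1 ≤ p → FddTendsto (fun q => Y p q) (fun _ => P)
      (fun t f => f t) (L p : Measure (ℝ≥0 → ℝ))) ∧
    FddTendsto (fun _ t f => f t) (fun p => (L p : Measure (ℝ≥0 → ℝ))) Z Q

/-- `ω_β(θ) = ψ₁ Γ(1-β) lam^{1+β} / (-β(1+β)) * exp (-i π sign(θ) (1+β) / 2)`. -/
def omegaBeta (lam β ψ₁ θ : ℝ) : ℂ :=
  ((ψ₁ * Real.Gamma (1 - β) * lam ^ (1 + β) / (-β * (1 + β)) : ℝ) : ℂ) *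
    Complex.exp (-Complex.I * ((Real.pi * Real.sign θ * (1 + β) / 2 : ℝ) : ℂ))

/-- A non-degenerate law `ν` on `ℝ` is `a`-stable: if `Z₁, Z₂, Z` have law `ν` and `Z₁, Z₂` are
independent then, for all `A, B > 0`, the variable `A Z₁ + B Z₂` has the law of
`(A^a + B^a)^{1/a} Z + D` for some real `D`. -/
def IsStableLaw (a : ℝ) (ν : Measure ℝ) : Prop :=
  (∀ x : ℝ, ν ≠ Measure.dirac x) ∧
  ∀ A B : ℝ, 0 < A → 0 < B → ∃ D : ℝ,
    Measure.conv (ν.map (fun z => A * z)) (ν.map (fun z => B * z))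
      = ν.map (fun z => (A ^ a + B ^ a) ^ (1 / a) * z + D)

/-- A law is stable with index `a ≠ 1` and totally skewed to the right: in the usual
parametrization of characteristic functions of stable laws, the skewness parameter is `1`. -/
def IsTotallySkewedRight (a : ℝ) (ν : Measure ℝ) : Prop :=
  ∃ σ m : ℝ, 0 < σ ∧ ∀ θ : ℝ, charFun ν θ =
    Complex.exp (-((σ ^ a * |θ| ^ a : ℝ) : ℂ) *
        (1 - Complex.I * ((Real.sign θ * Real.tan (Real.pi * a / 2) : ℝ) : ℂ))
      + Complex.I * ((m * θ : ℝ) : ℂ))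

end

end RandomizedINAR

/-! Given `α`, the chain is stationary with Poisson marginals of mean `W = lam / (1 - α)`. Hence
`X_k - 𝔼 X_k = dev_k + (W - 𝔼 W)`, where `dev_k = X_k - W` is conditionally centred and `W - 𝔼 W`
does not depend on `k`. Summed over `k ≤ ⌊n t⌋`, the second term is `⌊n t⌋ (W - 𝔼 W)`, and it alone
produces the limit, a line with random slope.

The slope is stable because `W` is heavy-tailed: the density of `α` behaves like `ψ₁ (1 - a) ^ β` at
`1`, so `P(W > x) ~ ψ₁ (lam / x) ^ (1 + β) / (1 + β)`, with index in `(1, 2)`. In Fourier terms, put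
`s = N ^ (-1 / (1 + β))`, so that `s ^ (-(1 + β)) = N`. The substitution `1 - a = s z` turns `N`
times the integral of `e^{iθsW} - 1 - iθsW` into `∫ z ^ β ψ(1 - s z) expTail(iθ lam / z) dz`, which
converges to `ψ₁ Γ(1 - β) / (β (1 + β)) (-iθ lam) ^ (1 + β) = -|θ| ^ (1 + β) ω_β(θ)`. This is
`tendsto_expTail_integral`; the constant comes from `integral_expTail_I_mul_rpow`, and Lévy's
continuity theorem provides the limit law.

The deviations are negligible for a different reason in each order of limits. With `n` fixed,
`dev_k` has conditional variance `W`, which is integrable since `β > 0`; so it alters one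
characteristic function by `O(s ^ 2)`, and `N s ^ 2 → 0` since `β < 1`
(`CondCentred.norm_integral_cexp_sub_le`). With `N` fixed, the conditional covariance `α ^ |j - k|
W` is geometric, so the sum of `n` deviations, weighted by `1 - α`, has second moment `O(n)`, and
its time average vanishes in probability (`integral_sq_mul_sum_dev_le`,
`tendsto_integral_cexp_sub_of_weighted_sq`).

The conditional moments are derived from the cylinder probabilities alone: a monotone class argument
allows one driving variable at a time to be integrated out (`lintegral_integrate_out`), which yields
the Markov property `lintegral_succ`. -/

namespace RandomizedINAR
noncomputable section

/-! ### Integrals of Gamma type -/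

theorem integrableOn_Ioi_zero_of_norm_le {f : ℝ → ℂ} {C p q : ℝ} (hp : -1 < p) (hq : q < -1)
    (hf : AEStronglyMeasurable f (volume.restrict (Set.Ioi 0)))
    (h₀ : ∀ x, 0 < x → ‖f x‖ ≤ C * x ^ p) (h₁ : ∀ x, 0 < x → ‖f x‖ ≤ C * x ^ q) :
    IntegrableOn f (Set.Ioi 0) := by
  rw [← Set.Ioc_union_Ioi_eq_Ioi zero_le_one]
  refine IntegrableOn.union ?_ ?_
  · have h : IntegrableOn (fun x : ℝ => C * x ^ p) (Set.Ioc 0 1) := by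
      refine Integrable.const_mul ?_ C
      have := (intervalIntegral.intervalIntegrable_rpow' (a := 0) (b := 1) hp)
      rwa [intervalIntegrable_iff_integrableOn_Ioc_of_le zero_le_one] at this
    refine Integrable.mono' h (hf.mono_set Set.Ioc_subset_Ioi_self) ?_
    filter_upwards [ae_restrict_mem measurableSet_Ioc] with x hx using h₀ x hx.1
  · have h : IntegrableOn (fun x : ℝ => C * x ^ q) (Set.Ioi 1) :=
      (integrableOn_Ioi_rpow_of_lt hq zero_lt_one).const_mul C
    refine Integrable.mono' h (hf.mono_set (Set.Ioi_subset_Ioi zero_le_one)) ?_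
    filter_upwards [ae_restrict_mem measurableSet_Ioi] with x hx
    exact h₁ x (zero_lt_one.trans hx)

/-- The measure `x ^ (a - 1) dx` on `(0, ∞)`. -/
def powMeasure (a : ℝ) : Measure ℝ :=
  (volume.restrict (Set.Ioi 0)).withDensity fun x => ENNReal.ofReal (x ^ (a - 1))

theorem integral_powMeasure (a : ℝ) (f : ℝ → ℂ) :
    ∫ x, f x ∂powMeasure a = ∫ x in Set.Ioi 0, ((x ^ (a - 1) : ℝ) : ℂ) * f x := by
  rw [powMeasure, integral_withDensity_eq_integral_toReal_smul (by fun_prop) (by simp)]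
  refine setIntegral_congr_fun measurableSet_Ioi fun x hx => ?_
  rw [ENNReal.toReal_ofReal (Real.rpow_nonneg (le_of_lt hx) _), Complex.real_smul]

theorem Iio_subset_integrableExpSet_powMeasure {a : ℝ} (ha : 0 < a) :
    Set.Iio 0 ⊆ integrableExpSet id (powMeasure a) := by
  intro t ht
  have ht' : 0 < -t := by simpa using ht
  rw [integrableExpSet, Set.mem_ofPred_eq, powMeasure,
    integrable_withDensity_iff (by fun_prop) (by simp)]
  have := integrableOn_rpow_mul_exp_neg_mul_rpow (p := 1) (s := a - 1) (b := -t) (by linarith)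
    zero_lt_one ht'
  refine this.congr_fun (fun x hx => ?_) measurableSet_Ioi
  simp only [id]
  rw [ENNReal.toReal_ofReal (Real.rpow_nonneg (le_of_lt hx) _)]
  simp [mul_comm]

/-- As functions of `z = -r`, both sides are analytic on `z.re < 0`, the left one being the complex
moment generating function of `powMeasure a`. They agree on the negative reals by Euler's integral,
so the identity theorem applies. -/
theorem integral_rpow_mul_cexp_neg_mul_Ioi {a : ℝ} (ha : 0 < a) {r : ℂ} (hr : 0 < r.re) :
    ∫ x in Set.Ioi (0 : ℝ), ((x ^ (a - 1) : ℝ) : ℂ) * Complex.exp (-r * x)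
      = r ^ (-a : ℂ) * Real.Gamma a := by
  have hsub : Set.Iio (0 : ℝ) ⊆ interior (integrableExpSet id (powMeasure a)) :=
    interior_maximal (Iio_subset_integrableExpSet_powMeasure ha) isOpen_Iio
  have hl : AnalyticOnNhd ℂ (complexMGF id (powMeasure a)) {z | z.re < 0} := fun z hz =>
    analyticAt_complexMGF (hsub hz)
  have hr' : AnalyticOnNhd ℂ (fun z : ℂ => (-z) ^ (-a : ℂ) * (Real.Gamma a : ℂ)) {z | z.re < 0} := by
    intro z hz
    refine AnalyticAt.mul (AnalyticAt.cpow (by fun_prop) (by fun_prop) ?_) (by fun_prop)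
    left; simpa using hz
  have hpre : IsPreconnected {z : ℂ | z.re < 0} :=
    (convex_halfSpace_re_lt 0).isPreconnected
  have key := AnalyticOnNhd.eqOn_of_preconnected_of_frequently_eq hl hr' hpre
    (z₀ := ((-1 : ℝ) : ℂ)) (by simp) ?_
  · have := key (x := -r) (by simpa using hr)
    simp only [complexMGF, neg_neg] at this
    rw [integral_powMeasure] at this
    exact this
  · have h : ∃ᶠ x : ℝ in 𝓝[≠] (-1), complexMGF id (powMeasure a) x
        = (-(x : ℂ)) ^ (-a : ℂ) * (Real.Gamma a : ℂ) := by
      refine Eventually.frequently ?_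
      filter_upwards [nhdsWithin_le_nhds (Iio_mem_nhds (show (-1 : ℝ) < 0 by norm_num))] with x hx
      have hx' : 0 < -x := by simpa using hx
      rw [complexMGF, integral_powMeasure]
      have := Complex.integral_cpow_mul_exp_neg_mul_Ioi (a := a) (r := -x) (by simpa) hx'
      rw [Complex.Gamma_ofReal, one_div, Complex.inv_cpow, ← Complex.cpow_neg] at this
      · rw [Complex.ofReal_neg] at this
        rw [← this]
        refine setIntegral_congr_fun measurableSet_Ioi fun y hy => ?_
        simp only [id]
        rw [Complex.ofReal_cpow (le_of_lt hy)]
        push_cast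
        congr 2
        ring
      · rw [Complex.arg_ofReal_of_nonneg hx'.le]; exact Real.pi_ne_zero.symm
    have hmap : Tendsto (fun x : ℝ => (x : ℂ)) (𝓝[≠] (-1)) (𝓝[≠] ((-1 : ℝ) : ℂ)) := by
      refine tendsto_nhdsWithin_iff.2 ⟨(Complex.continuous_ofReal.tendsto _).mono_left
        nhdsWithin_le_nhds, ?_⟩
      filter_upwards [self_mem_nhdsWithin] with x hx
      simpa only [Set.mem_compl_iff, Set.mem_singleton_iff, Complex.ofReal_inj] using hx
    exact hmap.frequently h

/-- Integration by parts against the primitive `-x ^ (-b) / b`. Two applications lower the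
singularity `x ^ (-β - 2)` to `x ^ (-β)`, where Euler's integral converges. -/
theorem integral_mul_rpow_eq_of_hasDerivAt {b : ℝ} (hb : 0 < b) {F F' : ℝ → ℂ}
    (hF : ∀ x, 0 < x → HasDerivAt F (F' x) x)
    (h : IntegrableOn (fun x => F x * ((x ^ (-b - 1) : ℝ) : ℂ)) (Set.Ioi 0))
    (h' : IntegrableOn (fun x => F' x * ((x ^ (-b) : ℝ) : ℂ)) (Set.Ioi 0))
    (h_zero : Tendsto (fun x => F x * ((x ^ (-b) : ℝ) : ℂ)) (𝓝[>] 0) (𝓝 0))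
    (h_top : Tendsto (fun x => F x * ((x ^ (-b) : ℝ) : ℂ)) atTop (𝓝 0)) :
    ∫ x in Set.Ioi (0 : ℝ), F x * ((x ^ (-b - 1) : ℝ) : ℂ)
      = (b : ℂ)⁻¹ * ∫ x in Set.Ioi (0 : ℝ), F' x * ((x ^ (-b) : ℝ) : ℂ) := by
  have hb' : (b : ℂ) ≠ 0 := by exact_mod_cast hb.ne'
  have := integral_Ioi_mul_deriv_eq_deriv_mul (a := 0) (u := F) (u' := F')
    (v := fun x => ((x ^ (-b) : ℝ) : ℂ)) (v' := fun x => ((-b * x ^ (-b - 1) : ℝ) : ℂ))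
    (a' := 0) (b' := 0) hF
    (fun x hx => (Real.hasDerivAt_rpow_const (Or.inl (ne_of_gt hx))).ofReal_comp)
    ?_ h' h_zero h_top
  · have e : ∀ x : ℝ, F x * ((-b * x ^ (-b - 1) : ℝ) : ℂ)
        = (-b : ℂ) * (F x * ((x ^ (-b - 1) : ℝ) : ℂ)) := by
      intro x; push_cast; ring
    simp only [e, integral_const_mul] at this
    rw [eq_inv_mul_iff_mul_eq₀ hb']
    linear_combination -this
  · refine (h.const_mul (-b : ℂ)).congr (ae_of_all _ fun x => ?_)
    simp only [Pi.mul_apply]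
    push_cast; ring

theorem norm_exp_sub_one_le_two {w : ℂ} (hw : w.re ≤ 0) : ‖Complex.exp w - 1‖ ≤ 2 := by
  have : ‖Complex.exp w‖ ≤ 1 := by rw [Complex.norm_exp]; exact Real.exp_le_one_iff.2 hw
  calc _ ≤ ‖Complex.exp w‖ + ‖(1 : ℂ)‖ := norm_sub_le _ _
    _ ≤ 2 := by rw [norm_one]; linarith

theorem norm_exp_sub_one_le {w : ℂ} (hw : w.re ≤ 0) : ‖Complex.exp w - 1‖ ≤ 2 * ‖w‖ := by
  rcases le_or_gt ‖w‖ 1 with h | h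
  · exact Complex.norm_exp_sub_one_le h
  · linarith [norm_exp_sub_one_le_two hw]

/-- The remainder `exp w - 1 - w`. -/
def expTail (w : ℂ) : ℂ := Complex.exp w - 1 - w

@[fun_prop]
theorem continuous_expTail : Continuous expTail := by unfold expTail; fun_prop

@[fun_prop]
theorem measurable_expTail : Measurable expTail := continuous_expTail.measurable

theorem norm_expTail_le {w : ℂ} (hw : w.re ≤ 0) : ‖expTail w‖ ≤ 3 * ‖w‖ := by
  calc _ ≤ ‖Complex.exp w - 1‖ + ‖w‖ := norm_sub_le _ _
    _ ≤ 3 * ‖w‖ := by linarith [norm_exp_sub_one_le hw]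

/-- Taylor's estimate covers `‖w‖ ≤ 1`; beyond that the linear bound is already smaller than the
quadratic one. The quadratic bound gives integrability at `0`, the linear one at infinity. -/
theorem norm_expTail_le_sq {w : ℂ} (hw : w.re ≤ 0) : ‖expTail w‖ ≤ 3 * ‖w‖ ^ 2 := by
  rcases le_or_gt ‖w‖ 1 with h | h
  · have := Complex.norm_exp_sub_one_sub_id_le h
    rw [expTail]
    nlinarith [norm_nonneg w]
  · nlinarith [norm_expTail_le hw]

theorem tendsto_zero_of_norm_le_rpow {f : ℝ → ℂ} {C p q : ℝ} (hp : 0 < p) (hq : q < 0)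
    (h₀ : ∀ x, 0 < x → ‖f x‖ ≤ C * x ^ p) (h₁ : ∀ x, 0 < x → ‖f x‖ ≤ C * x ^ q) :
    Tendsto f (𝓝[>] 0) (𝓝 0) ∧ Tendsto f atTop (𝓝 0) := by
  constructor
  · refine squeeze_zero_norm' (a := fun x => C * x ^ p) ?_ ?_
    · filter_upwards [self_mem_nhdsWithin] with x hx using h₀ x hx
    · have : Tendsto (fun x : ℝ => C * x ^ p) (𝓝 0) (𝓝 (C * 0 ^ p)) :=
        ((Real.continuousAt_rpow_const 0 p (Or.inr hp.le)).tendsto).const_mul C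
      rw [Real.zero_rpow hp.ne', mul_zero] at this
      exact this.mono_left nhdsWithin_le_nhds
  · refine squeeze_zero_norm' (a := fun x => C * x ^ q) ?_ ?_
    · filter_upwards [eventually_gt_atTop 0] with x hx using h₁ x hx
    · have := (tendsto_rpow_neg_atTop (y := -q) (by linarith)).const_mul C
      simpa using this

/-- Two integrations by parts contribute the factors `1 / (1 + β)` and `1 / β` and leave `r ^ 2`
times Euler's integral with parameter `1 - β`. All boundary terms vanish because `0 < β < 1`. -/
theorem integral_expTail_mul_rpow {β : ℝ} (hβ₀ : 0 < β) (hβ₁ : β < 1) {r : ℂ} (hr : 0 < r.re) :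
    ∫ x in Set.Ioi (0 : ℝ), expTail (-r * x) * ((x ^ (-β - 2) : ℝ) : ℂ)
      = (Real.Gamma (1 - β) / (β * (1 + β)) : ℝ) * r ^ ((1 + β : ℝ) : ℂ) := by
  have hr0 : r ≠ 0 := by rintro rfl; simp at hr
  have hre : ∀ x : ℝ, 0 < x → (-r * x).re ≤ 0 := by
    intro x hx
    simp only [Complex.mul_re, Complex.neg_re, Complex.ofReal_re, Complex.ofReal_im]
    nlinarith
  have hn : ∀ x : ℝ, 0 < x → ‖-r * x‖ = ‖r‖ * x := by
    intro x hx
    rw [norm_mul, norm_neg, Complex.norm_real, Real.norm_of_nonneg hx.le]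
  have hmul : ∀ (z : ℂ) (x s : ℝ), 0 < x → ‖z * ((x ^ s : ℝ) : ℂ)‖ = ‖z‖ * x ^ s := by
    intro z x s hx
    rw [norm_mul, Complex.norm_real, Real.norm_of_nonneg (Real.rpow_nonneg hx.le _)]
  -- The sum of the four coefficients occurring below, so that one constant serves every bound.
  set C : ℝ := 3 * ‖r‖ ^ 2 + 3 * ‖r‖ + 2 + 2 * ‖r‖ with hC
  have nr := norm_nonneg r
  -- bounds for the two functions that are differentiated
  have b2 : ∀ (x s : ℝ), 0 < x → ‖expTail (-r * x) * ((x ^ s : ℝ) : ℂ)‖ ≤ C * x ^ (s + 2) := by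
    intro x s hx
    rw [hmul _ _ _ hx, Real.rpow_add hx, Real.rpow_two]
    have h := norm_expTail_le_sq (hre x hx)
    rw [hn x hx] at h
    have hs := Real.rpow_pos_of_pos hx s
    calc _ ≤ (3 * (‖r‖ * x) ^ 2) * x ^ s := by gcongr
      _ = (3 * ‖r‖ ^ 2) * (x ^ s * x ^ 2) := by ring
      _ ≤ C * (x ^ s * x ^ 2) := by gcongr; rw [hC]; nlinarith
  have b1 : ∀ (x s : ℝ), 0 < x → ‖expTail (-r * x) * ((x ^ s : ℝ) : ℂ)‖ ≤ C * x ^ (s + 1) := by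
    intro x s hx
    rw [hmul _ _ _ hx, Real.rpow_add hx, Real.rpow_one]
    have h := norm_expTail_le (hre x hx)
    rw [hn x hx] at h
    have hs := Real.rpow_pos_of_pos hx s
    calc _ ≤ (3 * (‖r‖ * x)) * x ^ s := by gcongr
      _ = (3 * ‖r‖) * (x ^ s * x) := by ring
      _ ≤ C * (x ^ s * x) := by gcongr; rw [hC]; nlinarith
  have c1 : ∀ (x s : ℝ), 0 < x →
      ‖(-r * (Complex.exp (-r * x) - 1)) * ((x ^ s : ℝ) : ℂ)‖ ≤ (‖r‖ * C) * x ^ (s + 1) := by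
    intro x s hx
    rw [hmul _ _ _ hx, Real.rpow_add hx, Real.rpow_one, norm_mul, norm_neg]
    have h := norm_exp_sub_one_le (hre x hx)
    rw [hn x hx] at h
    have hs := Real.rpow_pos_of_pos hx s
    calc _ ≤ ‖r‖ * (2 * (‖r‖ * x)) * x ^ s := by gcongr
      _ = (‖r‖ * (2 * ‖r‖)) * (x ^ s * x) := by ring
      _ ≤ (‖r‖ * C) * (x ^ s * x) := by gcongr; rw [hC]; nlinarith
  have c0 : ∀ (x s : ℝ), 0 < x →
      ‖(-r * (Complex.exp (-r * x) - 1)) * ((x ^ s : ℝ) : ℂ)‖ ≤ (‖r‖ * C) * x ^ s := by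
    intro x s hx
    rw [hmul _ _ _ hx, norm_mul, norm_neg]
    have h := norm_exp_sub_one_le_two (hre x hx)
    have hs := Real.rpow_pos_of_pos hx s
    calc _ ≤ ‖r‖ * 2 * x ^ s := by gcongr
      _ ≤ (‖r‖ * C) * x ^ s := by gcongr; rw [hC]; nlinarith
  have mz : ∀ s : ℝ, Measurable fun x : ℝ => ((x ^ s : ℝ) : ℂ) := by intro s; fun_prop
  have I2 : IntegrableOn (fun x : ℝ => expTail (-r * x) * ((x ^ (-(1 + β) - 1) : ℝ) : ℂ))
      (Set.Ioi 0) :=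
    integrableOn_Ioi_zero_of_norm_le (p := -(1 + β) - 1 + 2) (q := -(1 + β) - 1 + 1)
      (by linarith) (by linarith)
      (((measurable_expTail.comp (by fun_prop)).mul (mz _)).aestronglyMeasurable)
      (fun x hx => b2 x _ hx) (fun x hx => b1 x _ hx)
  -- The exponent is a variable because the same fact is needed in the forms `-(1 + β)` and `-β -
  -- 1`.
  have I1 : ∀ s, s = -(1 + β) → IntegrableOn
      (fun x : ℝ => (-r * (Complex.exp (-r * x) - 1)) * ((x ^ s : ℝ) : ℂ)) (Set.Ioi 0) := by
    rintro s rfl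
    exact integrableOn_Ioi_zero_of_norm_le (p := -(1 + β) + 1) (q := -(1 + β))
      (by linarith) (by linarith) (Measurable.mul (by fun_prop) (mz _)).aestronglyMeasurable
      (fun x hx => c1 x _ hx) (fun x hx => c0 x _ hx)
  have I0 : IntegrableOn (fun x : ℝ => (-r * (-r * Complex.exp (-r * x))) * ((x ^ (-β) : ℝ) : ℂ))
      (Set.Ioi 0) := by
    have := integrableOn_rpow_mul_exp_neg_mul_rpow (p := 1) (s := -β) (b := r.re) (by linarith)
      zero_lt_one hr
    refine Integrable.mono' (this.const_mul (‖r‖ ^ 2))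
      (Measurable.mul (by fun_prop) (mz _)).aestronglyMeasurable ?_
    filter_upwards [ae_restrict_mem measurableSet_Ioi] with x hx
    rw [hmul _ _ _ hx]
    simp [Complex.norm_exp]
    apply le_of_eq; ring
  have T2 := tendsto_zero_of_norm_le_rpow (p := -(1 + β) + 2) (q := -(1 + β) + 1)
    (by linarith) (by linarith)
    (fun x hx => b2 x (-(1 + β)) hx) (fun x hx => b1 x (-(1 + β)) hx)
  have T1 := tendsto_zero_of_norm_le_rpow (p := -β + 1) (q := -β)
    (by linarith) (by linarith)
    (fun x hx => c1 x (-β) hx) (fun x hx => c0 x (-β) hx)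
  have hexp : ∀ x : ℝ, HasDerivAt (fun x : ℝ => Complex.exp (-r * x))
      (-r * Complex.exp (-r * x)) x := by
    intro x
    have h1 : HasDerivAt (fun x : ℝ => -r * (x : ℂ)) (-r) x := by
      simpa using (Complex.ofRealCLM.hasDerivAt (x := x)).const_mul (-r)
    simpa [mul_comm] using h1.cexp
  have D2 : ∀ x : ℝ, 0 < x → HasDerivAt (fun x : ℝ => expTail (-r * x))
      (-r * (Complex.exp (-r * x) - 1)) x := by
    intro x _
    have h1 : HasDerivAt (fun x : ℝ => -r * (x : ℂ)) (-r) x := by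
      simpa using (Complex.ofRealCLM.hasDerivAt (x := x)).const_mul (-r)
    refine (((hexp x).sub_const 1).sub h1).congr_deriv ?_
    ring
  have D1 : ∀ x : ℝ, 0 < x → HasDerivAt (fun x : ℝ => -r * (Complex.exp (-r * x) - 1))
      (-r * (-r * Complex.exp (-r * x))) x := fun x _ => ((hexp x).sub_const 1).const_mul (-r)
  have E2 := integral_mul_rpow_eq_of_hasDerivAt (b := 1 + β) (by linarith) D2 I2 (I1 _ rfl) T2.1 T2.2
  have E1 := integral_mul_rpow_eq_of_hasDerivAt (b := β) hβ₀ D1 (I1 _ (by ring)) I0 T1.1 T1.2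
  rw [show -β - 2 = -(1 + β) - 1 by ring, E2, show -(1 + β) = -β - 1 by ring, E1]
  have G := integral_rpow_mul_cexp_neg_mul_Ioi (a := 1 - β) (by linarith) hr
  have e : ∀ x : ℝ, (-r * (-r * Complex.exp (-r * x))) * ((x ^ (-β) : ℝ) : ℂ)
      = r ^ 2 * (((x ^ (1 - β - 1) : ℝ) : ℂ) * Complex.exp (-r * x)) := by
    intro x; rw [show 1 - β - 1 = -β by ring]; ring
  simp only [e, integral_const_mul, G]
  have hpow : r ^ ((1 + β : ℝ) : ℂ) = r ^ 2 * r ^ (-(1 - β : ℝ) : ℂ) := by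
    rw [← Complex.cpow_two, ← Complex.cpow_add _ _ hr0]
    congr 1; push_cast; ring
  rw [hpow]
  push_cast
  have : (β : ℂ) ≠ 0 := by exact_mod_cast hβ₀.ne'
  have : (1 + β : ℂ) ≠ 0 := by exact_mod_cast (by linarith : (1 + β : ℝ) ≠ 0)
  field_simp

theorem continuousAt_neg_I_mul_cpow {s θ : ℝ} (hθ : θ ≠ 0) :
    ContinuousAt (fun z : ℂ => z ^ (s : ℂ)) (-(Complex.I * θ)) := by
  refine continuousAt_cpow_const ?_
  right
  simpa using hθ

/-- For `θ ≠ 0` the principal argument of `-iθ` is `-π sign(θ) / 2`; this is the origin of the sign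
in `ω_β`. -/
theorem neg_I_mul_cpow {s θ : ℝ} (hs : s ≠ 0) :
    (-(Complex.I * θ)) ^ (s : ℂ) = ((|θ| ^ s : ℝ) : ℂ) *
      Complex.exp (-Complex.I * ((Real.pi * Real.sign θ * s / 2 : ℝ) : ℂ)) := by
  have key : ∀ {t : ℝ} {w : ℂ}, 0 < t → w ≠ 0 →
      ((t : ℂ) * w) ^ (s : ℂ) = ((t ^ s : ℝ) : ℂ) * Complex.exp (Complex.log w * s) := by
    intro t w ht hw
    rw [Complex.cpow_def_of_ne_zero (mul_ne_zero (by exact_mod_cast ht.ne') hw),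
      Complex.log_ofReal_mul ht hw, add_mul, Complex.exp_add, Real.rpow_def_of_pos ht]
    push_cast; rfl
  rcases lt_trichotomy θ 0 with h | rfl | h
  · have : -(Complex.I * θ) = ((-θ : ℝ) : ℂ) * Complex.I := by push_cast; ring
    rw [abs_of_neg h, Real.sign_of_neg h, this, key (by linarith) Complex.I_ne_zero, Complex.log_I]
    congr 2
    push_cast; ring
  · simp [hs, Real.zero_rpow hs]
  · have : -(Complex.I * θ) = (θ : ℂ) * (-Complex.I) := by ring
    rw [abs_of_pos h, Real.sign_of_pos h, this, key h (neg_ne_zero.2 Complex.I_ne_zero),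
      Complex.log_neg_I]
    congr 2
    push_cast; ring

/-- A bound uniform in `r` up to the imaginary axis, needed to pass to the limit `r → -iθ` under the
integral. -/
theorem norm_expTail_mul_rpow_le {r : ℂ} {K x s : ℝ} (hr : 0 ≤ r.re) (hK : ‖r‖ ≤ K) (hx : 0 < x) :
    ‖expTail (-r * x) * ((x ^ s : ℝ) : ℂ)‖
      ≤ 3 * (K ^ 2 + K) * min (x ^ (s + 2)) (x ^ (s + 1)) := by
  have nr := norm_nonneg r
  have hre : (-r * x).re ≤ 0 := by
    simp only [Complex.mul_re, Complex.neg_re, Complex.ofReal_re, Complex.ofReal_im]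
    nlinarith
  have hn : ‖-r * x‖ = ‖r‖ * x := by
    rw [norm_mul, norm_neg, Complex.norm_real, Real.norm_of_nonneg hx.le]
  have hs := Real.rpow_pos_of_pos hx s
  rw [norm_mul, Complex.norm_real, Real.norm_of_nonneg hs.le,
    mul_min_of_nonneg _ _ (by nlinarith)]
  refine le_min ?_ ?_
  · rw [Real.rpow_add hx, Real.rpow_two]
    have h := norm_expTail_le_sq hre
    rw [hn] at h
    calc _ ≤ (3 * (K * x) ^ 2) * x ^ s := by gcongr; exact h.trans (by gcongr)
      _ = (3 * K ^ 2) * (x ^ s * x ^ 2) := by ring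
      _ ≤ 3 * (K ^ 2 + K) * (x ^ s * x ^ 2) := by gcongr; nlinarith
  · rw [Real.rpow_add hx, Real.rpow_one]
    have h := norm_expTail_le hre
    rw [hn] at h
    calc _ ≤ (3 * (K * x)) * x ^ s := by gcongr; exact h.trans (by gcongr)
      _ = (3 * K) * (x ^ s * x) := by ring
      _ ≤ 3 * (K ^ 2 + K) * (x ^ s * x) := by gcongr; nlinarith

theorem integrableOn_min_rpow {p q : ℝ} (hp : -1 < p) (hq : q < -1) (C : ℝ) :
    IntegrableOn (fun x : ℝ => C * min (x ^ p) (x ^ q)) (Set.Ioi 0) := by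
  have h : ∀ x : ℝ, 0 < x → ‖((min (x ^ p) (x ^ q) : ℝ) : ℂ)‖ = min (x ^ p) (x ^ q) := by
    intro x hx
    rw [Complex.norm_real, Real.norm_of_nonneg
      (le_min (Real.rpow_nonneg hx.le _) (Real.rpow_nonneg hx.le _))]
  have := integrableOn_Ioi_zero_of_norm_le (f := fun x : ℝ => ((min (x ^ p) (x ^ q) : ℝ) : ℂ))
    (C := 1) hp hq (Measurable.aestronglyMeasurable (by fun_prop))
    (fun x hx => by rw [h x hx, one_mul]; exact min_le_left _ _)
    (fun x hx => by rw [h x hx, one_mul]; exact min_le_right _ _)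
  exact this.re.const_mul C

/-- Boundary case of `integral_expTail_mul_rpow`: let `r = e - iθ` with `e ↓ 0`. The power is
continuous at `-iθ`, off the branch cut when `θ ≠ 0`, and the integrals are dominated by a multiple
of `min (x ^ (-β)) (x ^ (-β - 1))`. -/
theorem integral_expTail_I_mul_rpow {β : ℝ} (hβ₀ : 0 < β) (hβ₁ : β < 1) (θ : ℝ) :
    ∫ x in Set.Ioi (0 : ℝ), expTail (Complex.I * θ * x) * ((x ^ (-β - 2) : ℝ) : ℂ)
      = (Real.Gamma (1 - β) / (β * (1 + β)) : ℝ) * (((|θ| ^ (1 + β) : ℝ) : ℂ) *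
        Complex.exp (-Complex.I * ((Real.pi * Real.sign θ * (1 + β) / 2 : ℝ) : ℂ))) := by
  rw [← neg_I_mul_cpow (by linarith)]
  rcases eq_or_ne θ 0 with rfl | hθ
  · have : (1 + β : ℂ) ≠ 0 := by exact_mod_cast (by linarith : (1 + β : ℝ) ≠ 0)
    simp [expTail, Complex.zero_cpow this]
  have hr : Tendsto (fun e : ℝ => (e : ℂ) + -(Complex.I * θ)) (𝓝[>] 0)
      (𝓝 (-(Complex.I * θ))) := by
    have : Tendsto (fun e : ℝ => (e : ℂ) + -(Complex.I * θ)) (𝓝 0)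
      (𝓝 (((0 : ℝ) : ℂ) + -(Complex.I * θ))) := by
      refine Continuous.tendsto ?_ _; fun_prop
    rw [Complex.ofReal_zero, zero_add] at this
    exact this.mono_left nhdsWithin_le_nhds
  have hright : Tendsto (fun e : ℝ => ((Real.Gamma (1 - β) / (β * (1 + β)) : ℝ) : ℂ)
      * ((e : ℂ) + -(Complex.I * θ)) ^ ((1 + β : ℝ) : ℂ)) (𝓝[>] 0)
      (𝓝 ((Real.Gamma (1 - β) / (β * (1 + β)) : ℝ)
        * (-(Complex.I * θ)) ^ ((1 + β : ℝ) : ℂ))) :=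
    ((continuousAt_neg_I_mul_cpow (s := 1 + β) hθ).tendsto.comp hr).const_mul _
  have hleft : Tendsto (fun e : ℝ => ∫ x in Set.Ioi (0 : ℝ),
      expTail (-((e : ℂ) + -(Complex.I * θ)) * x) * ((x ^ (-β - 2) : ℝ) : ℂ)) (𝓝[>] 0)
      (𝓝 (∫ x in Set.Ioi (0 : ℝ), expTail (Complex.I * θ * x) * ((x ^ (-β - 2) : ℝ) : ℂ))) := by
    refine tendsto_integral_filter_of_dominated_convergence
      (fun x : ℝ => 3 * ((1 + |θ|) ^ 2 + (1 + |θ|)) * min (x ^ (-β - 2 + 2)) (x ^ (-β - 2 + 1)))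
      ?_ ?_ (integrableOn_min_rpow (by linarith) (by linarith) _) ?_
    · refine Eventually.of_forall fun e => Measurable.aestronglyMeasurable ?_
      exact (measurable_expTail.comp (by fun_prop)).mul (by fun_prop)
    · filter_upwards [Ioo_mem_nhdsGT (zero_lt_one' ℝ)] with e he
      filter_upwards [ae_restrict_mem measurableSet_Ioi] with x hx
      refine norm_expTail_mul_rpow_le (by simpa using he.1.le) ?_ hx
      refine (norm_add_le _ _).trans ?_
      simp only [Complex.norm_real, norm_neg, norm_mul, Complex.norm_I, one_mul, Real.norm_eq_abs]
      rw [abs_of_pos he.1]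
      linarith [he.2]
    · filter_upwards with x
      refine Tendsto.mul_const _ ((continuous_expTail.tendsto _).comp ?_)
      have := (hr.neg).mul_const (x : ℂ)
      rwa [neg_neg] at this
  refine tendsto_nhds_unique hleft (hright.congr' ?_)
  filter_upwards [self_mem_nhdsWithin] with e he
  exact (integral_expTail_mul_rpow hβ₀ hβ₁ (by simpa using he)).symm

end

noncomputable section

/-! ### The mixing law and its stable limit -/

theorem norm_expTail_I_mul_le (t : ℝ) : ‖expTail (Complex.I * t)‖ ≤ 3 * |t| := by
  simpa using norm_expTail_le (w := Complex.I * t) (by simp)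

theorem norm_expTail_I_mul_le_sq (t : ℝ) : ‖expTail (Complex.I * t)‖ ≤ 3 * t ^ 2 := by
  simpa using norm_expTail_le_sq (w := Complex.I * t) (by simp)

section Mixing

variable {ψ : ℝ → ℝ} {β ψ₁ lam : ℝ}

theorem integrable_mixingLaw_iff
    (hψ_meas : AEMeasurable ψ (volume.restrict (Set.Ioo (0 : ℝ) 1)))
    (hψ_nonneg : ∀ x ∈ Set.Ioo (0 : ℝ) 1, 0 ≤ ψ x) {f : ℝ → ℂ} :
    Integrable f (mixingLaw ψ β) ↔
      IntegrableOn (fun x => ((ψ x * (1 - x) ^ β : ℝ) : ℂ) * f x) (Set.Ioo 0 1) := by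
  rw [mixingLaw, integrable_withDensity_iff_integrable_smul₀'
    (f := fun x => ENNReal.ofReal (ψ x * (1 - x) ^ β))
    (AEMeasurable.ennreal_ofReal (hψ_meas.mul (by fun_prop))) (by simp)]
  refine integrable_congr ?_
  filter_upwards [ae_restrict_mem measurableSet_Ioo] with x hx
  rw [ENNReal.toReal_ofReal (mul_nonneg (hψ_nonneg x hx)
    (Real.rpow_nonneg (by linarith [hx.2]) _)), Complex.real_smul]

theorem setIntegral_mixingLaw
    (hψ_meas : AEMeasurable ψ (volume.restrict (Set.Ioo (0 : ℝ) 1)))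
    (hψ_nonneg : ∀ x ∈ Set.Ioo (0 : ℝ) 1, 0 ≤ ψ x) (f : ℝ → ℂ) {B : Set ℝ} (hB : MeasurableSet B) :
    ∫ x in B, f x ∂mixingLaw ψ β
      = ∫ x in B ∩ Set.Ioo 0 1, ((ψ x * (1 - x) ^ β : ℝ) : ℂ) * f x := by
  have hm : AEMeasurable (fun x => ENNReal.ofReal (ψ x * (1 - x) ^ β))
      (volume.restrict (Set.Ioo (0 : ℝ) 1)) := AEMeasurable.ennreal_ofReal (hψ_meas.mul (by fun_prop))
  rw [mixingLaw, restrict_withDensity hB, Measure.restrict_restrict hB,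
    integral_withDensity_eq_integral_toReal_smul₀ _ (by simp)]
  · refine setIntegral_congr_fun (hB.inter measurableSet_Ioo) fun x hx => ?_
    rw [ENNReal.toReal_ofReal (mul_nonneg (hψ_nonneg x hx.2)
      (Real.rpow_nonneg (by linarith [hx.2.2]) _)), Complex.real_smul]
  · exact hm.mono_measure (Measure.restrict_mono Set.inter_subset_right le_rfl)

theorem ae_mem_Ioo_mixingLaw : ∀ᵐ x ∂mixingLaw ψ β, x ∈ Set.Ioo (0 : ℝ) 1 :=
  (withDensity_absolutelyContinuous _ _).ae_le (ae_restrict_mem measurableSet_Ioo)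

/-- `ψ` is controlled only near `1` and may be unbounded elsewhere, so the estimates below split at
`1 - δ`. -/
theorem exists_forall_le_of_tendsto (hψ_lim : Tendsto ψ (𝓝[<] (1 : ℝ)) (𝓝 ψ₁)) :
    ∃ δ : ℝ, 0 < δ ∧ δ < 1 ∧ ∀ x ∈ Set.Ioo (1 - δ) 1, ψ x ≤ ψ₁ + 1 := by
  have h := hψ_lim.eventually (Iio_mem_nhds (show ψ₁ < ψ₁ + 1 by linarith))
  obtain ⟨l, hl, hl'⟩ := (mem_nhdsLT_iff_exists_Ioo_subset).1 h
  have hl1 : l < 1 := hl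
  refine ⟨min (1 - l) (1 / 2), lt_min (by linarith) (by norm_num),
    (min_le_right _ _).trans_lt (by norm_num), fun x hx => ?_⟩
  have : x ∈ Set.Ioo l 1 := ⟨by linarith [hx.1, min_le_left (1 - l) (1 / 2)], hx.2⟩
  exact le_of_lt (hl' this)

/-- On `a ≤ 1 - δ` the function is bounded and the law finite. Near `1` the integrand is at most a
multiple of `(1 - a) ^ (β - 1)`, integrable because `β > 0`. -/
theorem integrable_inv_one_sub [IsFiniteMeasure (mixingLaw ψ β)] (hβ₀ : 0 < β)
    (hψ_meas : AEMeasurable ψ (volume.restrict (Set.Ioo (0 : ℝ) 1)))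
    (hψ_nonneg : ∀ x ∈ Set.Ioo (0 : ℝ) 1, 0 ≤ ψ x)
    (hψ_lim : Tendsto ψ (𝓝[<] (1 : ℝ)) (𝓝 ψ₁)) :
    Integrable (fun a => lam / (1 - a)) (mixingLaw ψ β) := by
  obtain ⟨δ, hδ₀, hδ₁, hδ⟩ := exists_forall_le_of_tendsto hψ_lim
  have h₁ : IntegrableOn (fun a => lam / (1 - a)) (Set.Iic (1 - δ)) (mixingLaw ψ β) := by
    refine Integrable.mono' (integrable_const (|lam| / δ))
      (Measurable.aestronglyMeasurable (by fun_prop)) ?_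
    filter_upwards [ae_restrict_mem measurableSet_Iic] with a ha
    have ha' : δ ≤ 1 - a := by linarith [Set.mem_Iic.1 ha]
    rw [norm_div, Real.norm_eq_abs, Real.norm_eq_abs, abs_of_pos (hδ₀.trans_le ha')]
    gcongr
  have h₂ : IntegrableOn (fun a => lam / (1 - a)) (Set.Ioi (1 - δ)) (mixingLaw ψ β) := by
    rw [← integrable_indicator_iff measurableSet_Ioi]
    have : Integrable (fun a => (((Set.Ioi (1 - δ)).indicator (fun a => lam / (1 - a)) a : ℝ) : ℂ))
        (mixingLaw ψ β) := by
      rw [integrable_mixingLaw_iff hψ_meas hψ_nonneg]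
      have hb : IntegrableOn (fun x : ℝ => (ψ₁ + 1) * |lam| * (1 - x) ^ (β - 1)) (Set.Ioo 0 1) := by
        refine Integrable.const_mul ?_ _
        have h := (intervalIntegral.intervalIntegrable_rpow' (a := 0) (b := 1) (r := β - 1)
          (by linarith)).comp_sub_left 1
        simp only [sub_zero, sub_self] at h
        exact ((intervalIntegrable_iff_integrableOn_Ioo_of_le zero_le_one).1 h.symm)
      refine Integrable.mono' hb ?_ ?_
      · refine AEStronglyMeasurable.mul ?_ ?_
        · exact (Complex.measurable_ofReal.comp_aemeasurable
            (hψ_meas.mul (by fun_prop))).aestronglyMeasurable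
        · refine Measurable.aestronglyMeasurable ?_
          exact Complex.measurable_ofReal.comp (Measurable.indicator (by fun_prop) measurableSet_Ioi)
      · filter_upwards [ae_restrict_mem measurableSet_Ioo] with x hx
        have hx1 : 0 < 1 - x := by linarith [hx.2]
        have hp := Real.rpow_pos_of_pos hx1 (β - 1)
        have h0 := hψ_nonneg x hx
        by_cases hxδ : x ∈ Set.Ioi (1 - δ)
        · rw [Set.indicator_of_mem hxδ, norm_mul, Complex.norm_real, Complex.norm_real,
            Real.norm_of_nonneg (mul_nonneg h0 (Real.rpow_nonneg hx1.le _)), norm_div,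
            Real.norm_eq_abs, Real.norm_eq_abs, abs_of_pos hx1]
          rw [show (1 - x) ^ β = (1 - x) ^ (β - 1) * (1 - x) by
            rw [Real.rpow_sub_one hx1.ne']; field_simp]
          have := hδ x ⟨hxδ, hx.2⟩
          calc _ = ψ x * |lam| * (1 - x) ^ (β - 1) := by field_simp
            _ ≤ _ := by gcongr
        · rw [Set.indicator_of_notMem hxδ]
          simp only [Complex.ofReal_zero, mul_zero, norm_zero]
          have : 0 ≤ ψ₁ + 1 := by
            have := hδ (1 - δ / 2) ⟨by linarith, by linarith⟩
            exact (hψ_nonneg (1 - δ / 2) ⟨by linarith, by linarith⟩).trans this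
          positivity
    simpa using this.re
  have := h₁.union h₂
  rwa [Set.Iic_union_Ioi, integrableOn_univ] at this

/-- Away from `1` the argument is `O(s)` and the tail `O(s ^ 2)`, which beats `s ^ (-(1 + β))`
because `β < 1`. Only parameters near `1` contribute to the limit. -/
theorem tendsto_expTail_setIntegral_Iic [IsFiniteMeasure (mixingLaw ψ β)] (hβ₁ : β < 1)
    {δ : ℝ} (hδ₀ : 0 < δ) (θ : ℝ) :
    Tendsto (fun s : ℝ => ((s ^ (-(1 + β)) : ℝ) : ℂ) *
      ∫ a in Set.Iic (1 - δ), expTail (Complex.I * (θ * s * (lam / (1 - a)) : ℝ)) ∂mixingLaw ψ β)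
      (𝓝[>] 0) (𝓝 0) := by
  set C : ℝ := 3 * (|θ| * (|lam| / δ)) ^ 2 * (mixingLaw ψ β).real Set.univ with hC
  refine squeeze_zero_norm' (a := fun s : ℝ => C * s ^ (1 - β)) ?_ ?_
  · filter_upwards [self_mem_nhdsWithin] with s hs
    have hs : 0 < s := hs
    have hsp := Real.rpow_pos_of_pos hs (-(1 + β))
    have hb : ‖∫ a in Set.Iic (1 - δ), expTail (Complex.I * (θ * s * (lam / (1 - a)) : ℝ))
        ∂mixingLaw ψ β‖ ≤ (3 * (|θ| * s * (|lam| / δ)) ^ 2) * (mixingLaw ψ β).real (Set.Iic (1 - δ)) := by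
      refine norm_setIntegral_le_of_norm_le_const (measure_lt_top _ _) fun a ha => ?_
      have ha' : δ ≤ 1 - a := by linarith [Set.mem_Iic.1 ha]
      refine (norm_expTail_I_mul_le_sq _).trans ?_
      rw [← sq_abs, abs_mul, abs_mul, abs_div, abs_of_pos hs, abs_of_pos (hδ₀.trans_le ha')]
      have h1 : |lam| / (1 - a) ≤ |lam| / δ := by gcongr
      have h2 : 0 ≤ |lam| / (1 - a) := div_nonneg (abs_nonneg _) (hδ₀.trans_le ha').le
      gcongr
    rw [norm_mul, Complex.norm_real, Real.norm_of_nonneg hsp.le]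
    have e : s ^ (1 - β) = s ^ (-(1 + β)) * s ^ 2 := by
      rw [← Real.rpow_two, ← Real.rpow_add hs]; congr 1; ring
    calc _ ≤ s ^ (-(1 + β)) * ((3 * (|θ| * s * (|lam| / δ)) ^ 2) * (mixingLaw ψ β).real Set.univ) := by
          gcongr
          refine hb.trans ?_
          gcongr
          · exact measure_ne_top _ _
          · exact Set.subset_univ _
      _ = C * s ^ (1 - β) := by rw [e, hC]; ring
  · have : Tendsto (fun s : ℝ => C * s ^ (1 - β)) (𝓝 0) (𝓝 (C * 0 ^ (1 - β))) :=
      ((Real.continuousAt_rpow_const 0 _ (Or.inr (by linarith))).tendsto).const_mul C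
    rw [Real.zero_rpow (by linarith), mul_zero] at this
    exact this.mono_left nhdsWithin_le_nhds

/-- The inversion `x = 1 / z` reduces this to `integral_expTail_I_mul_rpow`. -/
theorem integral_rpow_mul_expTail_inv (hβ₀ : 0 < β) (hβ₁ : β < 1) (θ : ℝ) :
    ∫ z in Set.Ioi (0 : ℝ), ((z ^ β : ℝ) : ℂ) * expTail (Complex.I * (θ * z⁻¹ : ℝ))
      = (Real.Gamma (1 - β) / (β * (1 + β)) : ℝ) * (((|θ| ^ (1 + β) : ℝ) : ℂ) *
        Complex.exp (-Complex.I * ((Real.pi * Real.sign θ * (1 + β) / 2 : ℝ) : ℂ))) := by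
  rw [← integral_expTail_I_mul_rpow hβ₀ hβ₁ θ, ← integral_comp_rpow_Ioi _ (neg_ne_zero.2 one_ne_zero)]
  refine setIntegral_congr_fun measurableSet_Ioi fun x hx => ?_
  have hx : 0 < x := hx
  simp only [abs_neg, abs_one, one_mul, Real.rpow_neg_one, inv_inv]
  rw [Complex.real_smul, ← mul_assoc, ← Complex.ofReal_mul, Real.inv_rpow hx.le,
    ← Real.rpow_neg hx.le, ← Real.rpow_add hx,
    show -(1 : ℝ) - 1 + -β = -β - 2 by ring, mul_comm, Complex.ofReal_mul, mul_assoc]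

theorem norm_rpow_mul_expTail_inv_le (θ : ℝ) {z : ℝ} (hz : 0 < z) :
    z ^ β * ‖expTail (Complex.I * (θ * z⁻¹ : ℝ))‖
      ≤ 3 * (|θ| ^ 2 + |θ|) * min (z ^ (β - 1)) (z ^ (β - 2)) := by
  have hp := Real.rpow_pos_of_pos hz β
  have ha := abs_nonneg θ
  rw [mul_min_of_nonneg _ _ (by positivity)]
  refine le_min ?_ ?_
  · have h := norm_expTail_I_mul_le (θ * z⁻¹)
    rw [abs_mul, abs_of_pos (inv_pos.2 hz)] at h
    rw [Real.rpow_sub hz, Real.rpow_one]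
    calc _ ≤ z ^ β * (3 * (|θ| * z⁻¹)) := by gcongr
      _ = 3 * |θ| * (z ^ β / z) := by field_simp
      _ ≤ _ := by gcongr; nlinarith
  · have h := norm_expTail_I_mul_le_sq (θ * z⁻¹)
    rw [← sq_abs, abs_mul, abs_of_pos (inv_pos.2 hz)] at h
    rw [Real.rpow_sub hz, Real.rpow_two]
    calc _ ≤ z ^ β * (3 * (|θ| * z⁻¹) ^ 2) := by gcongr
      _ = 3 * |θ| ^ 2 * (z ^ β / z ^ 2) := by field_simp
      _ ≤ _ := by gcongr; nlinarith

/-- Under `a = 1 - s z` the density factor `(s z) ^ β` and the Jacobian `s` absorb `s ^ (-(1 + β))`,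
while `s lam / (1 - a)` becomes `lam / z`. Dominated convergence then replaces `ψ (1 - s z)` by
`ψ₁`. -/
theorem tendsto_expTail_setIntegral_Ioi [IsFiniteMeasure (mixingLaw ψ β)]
    (hβ₀ : 0 < β) (hβ₁ : β < 1)
    (hψ_meas : AEMeasurable ψ (volume.restrict (Set.Ioo (0 : ℝ) 1)))
    (hψ_nonneg : ∀ x ∈ Set.Ioo (0 : ℝ) 1, 0 ≤ ψ x)
    (hψ_lim : Tendsto ψ (𝓝[<] (1 : ℝ)) (𝓝 ψ₁))
    {δ : ℝ} (hδ₀ : 0 < δ) (hδ₁ : δ < 1) (hδ : ∀ x ∈ Set.Ioo (1 - δ) 1, ψ x ≤ ψ₁ + 1) (θ : ℝ) :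
    Tendsto (fun s : ℝ => ((s ^ (-(1 + β)) : ℝ) : ℂ) *
      ∫ a in Set.Ioi (1 - δ), expTail (Complex.I * (θ * s * (lam / (1 - a)) : ℝ)) ∂mixingLaw ψ β)
      (𝓝[>] 0) (𝓝 (ψ₁ * ∫ z in Set.Ioi (0 : ℝ),
        ((z ^ β : ℝ) : ℂ) * expTail (Complex.I * (θ * lam * z⁻¹ : ℝ)))) := by
  have hsub : Set.Ioo (1 - δ) 1 ⊆ Set.Ioo (0 : ℝ) 1 := Set.Ioo_subset_Ioo_left (by linarith)
  have hM : 0 ≤ ψ₁ + 1 :=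
    (hψ_nonneg (1 - δ / 2) ⟨by linarith, by linarith⟩).trans
      (hδ (1 - δ / 2) ⟨by linarith, by linarith⟩)
  -- the integrand with respect to Lebesgue measure
  let h : ℝ → ℝ → ℂ := fun s => (Set.Ioo (1 - δ) 1).indicator fun x =>
    ((ψ x * (1 - x) ^ β : ℝ) : ℂ) * expTail (Complex.I * (θ * s * (lam / (1 - x)) : ℝ))
  have hint : ∀ s, Integrable (h s) := by
    intro s
    rw [integrable_indicator_iff measurableSet_Ioo]
    refine IntegrableOn.mono_set ?_ hsub
    rw [← integrable_mixingLaw_iff hψ_meas hψ_nonneg]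
    refine Integrable.mono' (((integrable_inv_one_sub (lam := lam) hβ₀ hψ_meas hψ_nonneg
      hψ_lim).norm).const_mul (3 * |θ * s|)) ?_ (ae_of_all _ fun x => ?_)
    · exact (measurable_expTail.comp (by fun_prop)).aestronglyMeasurable
    · refine (norm_expTail_I_mul_le _).trans (le_of_eq ?_)
      rw [abs_mul, Real.norm_eq_abs, mul_assoc]
  have hrew : ∀ s : ℝ, 0 < s → ((s ^ (-(1 + β)) : ℝ) : ℂ) *
      ∫ a in Set.Ioi (1 - δ), expTail (Complex.I * (θ * s * (lam / (1 - a)) : ℝ)) ∂mixingLaw ψ β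
      = ∫ z, ((s ^ (-β) : ℝ) : ℂ) * h s (1 - s * z) := by
    intro s hs
    have hset : Set.Ioi (1 - δ) ∩ Set.Ioo (0 : ℝ) 1 = Set.Ioo (1 - δ) 1 := by
      ext x; simp only [Set.mem_inter_iff, Set.mem_Ioi, Set.mem_Ioo]
      constructor
      · rintro ⟨h1, h2, h3⟩; exact ⟨h1, h3⟩
      · rintro ⟨h1, h3⟩; exact ⟨h1, by linarith, h3⟩
    rw [setIntegral_mixingLaw hψ_meas hψ_nonneg _ measurableSet_Ioi, hset,
      ← integral_indicator measurableSet_Ioo, integral_const_mul,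
      Measure.integral_comp_mul_left (fun y => h s (1 - y)) s,
      integral_sub_left_eq_self (h s) volume 1, Complex.real_smul, ← mul_assoc, ← Complex.ofReal_mul,
      abs_of_pos (inv_pos.2 hs)]
    congr 3
    rw [← Real.rpow_neg_one, ← Real.rpow_add hs]; congr 1; ring
  rw [← integral_const_mul, ← integral_indicator measurableSet_Ioi]
  -- After cancellation, `s` survives only in `ψ (1 - s z)` and in the cutoff `z < δ / s`.
  have hval : ∀ s z : ℝ, 0 < s → ((s ^ (-β) : ℝ) : ℂ) * h s (1 - s * z)
      = (Set.Ioo 0 (δ / s)).indicator (fun z => (ψ (1 - s * z) : ℂ) *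
        (((z ^ β : ℝ) : ℂ) * expTail (Complex.I * (θ * lam * z⁻¹ : ℝ)))) z := by
    intro s z hs
    have hiff : 1 - s * z ∈ Set.Ioo (1 - δ) 1 ↔ z ∈ Set.Ioo 0 (δ / s) := by
      simp only [Set.mem_Ioo, lt_div_iff₀ hs]
      constructor
      · rintro ⟨h1, h2⟩
        exact ⟨by by_contra hz; nlinarith [not_lt.1 hz], by linarith⟩
      · rintro ⟨h1, h2⟩
        exact ⟨by linarith, by nlinarith⟩
    by_cases hz : z ∈ Set.Ioo 0 (δ / s)
    · have hz0 : 0 < z := hz.1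
      simp only [h]
      rw [Set.indicator_of_mem (hiff.2 hz), Set.indicator_of_mem hz]
      have e1 : 1 - (1 - s * z) = s * z := by ring
      rw [e1, Real.mul_rpow hs.le hz0.le]
      have e2 : θ * s * (lam / (s * z)) = θ * lam * z⁻¹ := by field_simp
      rw [e2, Real.rpow_neg hs.le]
      have := (Real.rpow_pos_of_pos hs β).ne'
      have : ((s ^ β : ℝ) : ℂ) ≠ 0 := by exact_mod_cast this
      push_cast
      field_simp
    · simp only [h]
      rw [Set.indicator_of_notMem (hiff.not.2 hz), Set.indicator_of_notMem hz, mul_zero]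
  refine Tendsto.congr' (f₁ := fun s : ℝ => ∫ z, ((s ^ (-β) : ℝ) : ℂ) * h s (1 - s * z)) ?_ ?_
  · filter_upwards [self_mem_nhdsWithin] with s hs using (hrew s hs).symm
  refine tendsto_integral_filter_of_dominated_convergence
    ((Set.Ioi 0).indicator fun z => (ψ₁ + 1) *
      (3 * (|θ * lam| ^ 2 + |θ * lam|) * min (z ^ (β - 1)) (z ^ (β - 2)))) ?_ ?_ ?_ ?_
  · filter_upwards [self_mem_nhdsWithin] with s hs
    have hs : s ≠ 0 := ne_of_gt hs
    exact ((((hint s).comp_sub_left 1).comp_mul_left' hs).const_mul _).aestronglyMeasurable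
  · filter_upwards [self_mem_nhdsWithin] with s hs
    have hs : 0 < s := hs
    refine ae_of_all _ fun z => ?_
    rw [hval s z hs]
    by_cases hz : z ∈ Set.Ioo 0 (δ / s)
    · have hz0 : 0 < z := hz.1
      have hsz : s * z < δ := by have := (lt_div_iff₀ hs).1 hz.2; linarith
      have hmem : 1 - s * z ∈ Set.Ioo (1 - δ) 1 := ⟨by linarith, by nlinarith⟩
      rw [Set.indicator_of_mem hz, Set.indicator_of_mem (Set.mem_Ioi.2 hz0), norm_mul, norm_mul,
        Complex.norm_real, Complex.norm_real, Real.norm_of_nonneg (hψ_nonneg _ (hsub hmem)),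
        Real.norm_of_nonneg (Real.rpow_nonneg hz0.le _)]
      exact mul_le_mul (hδ _ hmem) (norm_rpow_mul_expTail_inv_le _ hz0) (by positivity) hM
    · rw [Set.indicator_of_notMem hz, norm_zero]
      refine Set.indicator_nonneg (fun z hz => ?_) z
      have hz : 0 < z := hz
      positivity
  · rw [integrable_indicator_iff measurableSet_Ioi]
    exact (integrableOn_min_rpow (by linarith) (by linarith) _).const_mul _
  · refine ae_of_all _ fun z => ?_
    rcases le_or_gt z 0 with hz | hz
    · refine Tendsto.congr' (f₁ := fun _ => (0 : ℂ)) ?_ ?_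
      · filter_upwards [self_mem_nhdsWithin] with s hs
        rw [hval s z hs, Set.indicator_of_notMem]
        exact fun h => not_lt.2 hz h.1
      · rw [Set.indicator_of_notMem (by simpa using hz)]
        exact tendsto_const_nhds
    · rw [Set.indicator_of_mem (Set.mem_Ioi.2 hz)]
      have ht : Tendsto (fun s : ℝ => 1 - s * z) (𝓝[>] 0) (𝓝[<] 1) := by
        refine tendsto_nhdsWithin_iff.2 ⟨?_, ?_⟩
        · have : Tendsto (fun s : ℝ => 1 - s * z) (𝓝 0) (𝓝 (1 - 0 * z)) :=
            Continuous.tendsto (by fun_prop) _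
          rw [zero_mul, sub_zero] at this
          exact this.mono_left nhdsWithin_le_nhds
        · filter_upwards [self_mem_nhdsWithin] with s hs
          have hs : 0 < s := hs
          simp only [Set.mem_Iio]; nlinarith
      refine Tendsto.congr' (f₁ := fun s : ℝ => (ψ (1 - s * z) : ℂ) *
        (((z ^ β : ℝ) : ℂ) * expTail (Complex.I * (θ * lam * z⁻¹ : ℝ)))) ?_ ?_
      · filter_upwards [Ioo_mem_nhdsGT (div_pos hδ₀ hz)] with s hs
        rw [hval s z hs.1, Set.indicator_of_mem]
        refine ⟨hz, ?_⟩
        rw [lt_div_iff₀ hs.1]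
        have := (lt_div_iff₀ hz).1 hs.2
        linarith
      · exact ((Complex.continuous_ofReal.tendsto _).comp (hψ_lim.comp ht)).mul_const _

theorem neg_abs_rpow_mul_omegaBeta (hβ₀ : 0 < β) (hlam : 0 < lam) (θ : ℝ) :
    -((|θ| ^ (1 + β) : ℝ) : ℂ) * omegaBeta lam β ψ₁ θ =
      ψ₁ * ((Real.Gamma (1 - β) / (β * (1 + β)) : ℝ) * (((|θ * lam| ^ (1 + β) : ℝ) : ℂ) *
        Complex.exp (-Complex.I * ((Real.pi * Real.sign (θ * lam) * (1 + β) / 2 : ℝ) : ℂ)))) := by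
  have hsign : Real.sign (θ * lam) = Real.sign θ := by
    rcases lt_trichotomy θ 0 with h | rfl | h
    · rw [Real.sign_of_neg h, Real.sign_of_neg (mul_neg_of_neg_of_pos h hlam)]
    · simp
    · rw [Real.sign_of_pos h, Real.sign_of_pos (mul_pos h hlam)]
  rw [hsign, abs_mul, abs_of_pos hlam, Real.mul_rpow (abs_nonneg _) hlam.le, omegaBeta]
  have h1 : (β : ℂ) ≠ 0 := by exact_mod_cast hβ₀.ne'
  have h2 : (1 + β : ℂ) ≠ 0 := by exact_mod_cast (by linarith : (1 + β : ℝ) ≠ 0)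
  push_cast
  field_simp

theorem tendsto_expTail_integral [IsFiniteMeasure (mixingLaw ψ β)]
    (hlam : 0 < lam) (hβ₀ : 0 < β) (hβ₁ : β < 1)
    (hψ_meas : AEMeasurable ψ (volume.restrict (Set.Ioo (0 : ℝ) 1)))
    (hψ_nonneg : ∀ x ∈ Set.Ioo (0 : ℝ) 1, 0 ≤ ψ x)
    (hψ_lim : Tendsto ψ (𝓝[<] (1 : ℝ)) (𝓝 ψ₁)) (θ : ℝ) :
    Tendsto (fun s : ℝ => ((s ^ (-(1 + β)) : ℝ) : ℂ) *
      ∫ a, expTail (Complex.I * (θ * s * (lam / (1 - a)) : ℝ)) ∂mixingLaw ψ β)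
      (𝓝[>] 0) (𝓝 (-((|θ| ^ (1 + β) : ℝ) : ℂ) * omegaBeta lam β ψ₁ θ)) := by
  obtain ⟨δ, hδ₀, hδ₁, hδ⟩ := exists_forall_le_of_tendsto hψ_lim
  have h := (tendsto_expTail_setIntegral_Iic (ψ := ψ) (lam := lam) hβ₁ hδ₀ θ).add
    (tendsto_expTail_setIntegral_Ioi (lam := lam) hβ₀ hβ₁ hψ_meas hψ_nonneg hψ_lim hδ₀ hδ₁ hδ θ)
  rw [integral_rpow_mul_expTail_inv hβ₀ hβ₁, zero_add, ← neg_abs_rpow_mul_omegaBeta hβ₀ hlam] at h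
  refine h.congr fun s => ?_
  rw [← mul_add, ← setIntegral_union (Set.Iic_disjoint_Ioi le_rfl) measurableSet_Ioi,
    Set.Iic_union_Ioi, setIntegral_univ]
  all_goals
    refine Integrable.integrableOn (Integrable.mono' (((integrable_inv_one_sub (lam := lam) hβ₀
      hψ_meas hψ_nonneg hψ_lim).norm).const_mul (3 * |θ * s|)) ?_ (ae_of_all _ fun x => ?_))
    · exact (measurable_expTail.comp (by fun_prop)).aestronglyMeasurable
    · refine (norm_expTail_I_mul_le _).trans (le_of_eq ?_)
      rw [abs_mul, Real.norm_eq_abs, mul_assoc]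

/-- With `m` the mean, `w = -ium` and `T` the integral of the tail, the integral of `e^{iu(W-m)}` is
`e^w (1 - w + T)`. The remainder `e^w (1 - w) - 1` is of second order in `u m`. -/
theorem integral_cexp_sub_mean_sub_one {Ω : Type*} [MeasurableSpace Ω] {P : Measure Ω}
    [IsProbabilityMeasure P] {W : Ω → ℝ} (hW : Integrable W P) (u : ℝ) :
    ∃ R : ℂ, ‖R‖ ≤ 5 * (u * ∫ ω, W ω ∂P) ^ 2 ∧
      ∫ ω, Complex.exp (Complex.I * (u * (W ω - ∫ ω', W ω' ∂P) : ℝ)) ∂P - 1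
        = Complex.exp (-(Complex.I * (u * ∫ ω, W ω ∂P : ℝ)))
          * ∫ ω, expTail (Complex.I * (u * W ω : ℝ)) ∂P + R := by
  set m : ℝ := ∫ ω, W ω ∂P with hm
  set w : ℂ := Complex.I * (-(u * m) : ℝ) with hw
  have hexp : Integrable (fun ω => Complex.exp (Complex.I * (u * W ω : ℝ))) P := by
    refine Integrable.of_bound (C := 1) ?_ (ae_of_all _ fun ω => ?_)
    · have := hW.aestronglyMeasurable.aemeasurable
      exact AEMeasurable.aestronglyMeasurable (by fun_prop)
    · rw [mul_comm, Complex.norm_exp_ofReal_mul_I]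
  have hWc : Integrable (fun ω => Complex.I * ((u * W ω : ℝ) : ℂ)) P :=
    (hW.const_mul u).ofReal.const_mul _
  -- This is `e^w (1 - w) - 1`; the bounds `3 |w| ^ 2` and `2 |w| ^ 2` on the two terms give the
  -- constant `5`.
  refine ⟨expTail w - w * (Complex.exp w - 1), ?_, ?_⟩
  · have h1 := norm_expTail_I_mul_le_sq (-(u * m))
    have h2 := norm_exp_sub_one_le (w := w) (by simp [hw])
    have h3 : ‖w‖ = |u * m| := by rw [hw]; simp
    calc _ ≤ ‖expTail w‖ + ‖w‖ * ‖Complex.exp w - 1‖ := (norm_sub_le _ _).trans (by rw [norm_mul])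
      _ ≤ 3 * (-(u * m)) ^ 2 + |u * m| * (2 * |u * m|) := by
          rw [h3] at h2 ⊢
          gcongr
      _ = 5 * (u * m) ^ 2 := by nlinarith [sq_abs (u * m)]
  · have e : ∀ ω, Complex.exp (Complex.I * (u * (W ω - m) : ℝ))
        = Complex.exp w * Complex.exp (Complex.I * (u * W ω : ℝ)) := by
      intro ω; rw [← Complex.exp_add, hw]; congr 1; push_cast; ring
    have hneg : -(Complex.I * (u * m : ℝ)) = w := by rw [hw]; push_cast; ring
    simp only [e, expTail, integral_const_mul, hneg]
    have hI : ∫ ω, (Complex.exp (Complex.I * (u * W ω : ℝ)) - 1 - Complex.I * (u * W ω : ℝ)) ∂P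
        = ∫ ω, Complex.exp (Complex.I * (u * W ω : ℝ)) ∂P - 1 - Complex.I * (u * m : ℝ) := by
      have h1 := integral_sub (hexp.sub (integrable_const (1 : ℂ))) hWc
      have h2 := integral_sub hexp (integrable_const (μ := P) (1 : ℂ))
      simp only [Pi.sub_apply] at h1
      rw [h1, h2, integral_const_mul, integral_complex_ofReal, integral_const_mul, ← hm]
      simp
    rw [hI, hw]
    push_cast
    ring

/-- Centring is harmless: the phase `e^{-iθsm}` tends to `1`, and the remainder `O(s ^ 2)` is killed
by `β < 1`. -/
theorem tendsto_rpow_mul_charFun_sub_one [IsProbabilityMeasure (mixingLaw ψ β)]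
    (hlam : 0 < lam) (hβ₀ : 0 < β) (hβ₁ : β < 1)
    (hψ_meas : AEMeasurable ψ (volume.restrict (Set.Ioo (0 : ℝ) 1)))
    (hψ_nonneg : ∀ x ∈ Set.Ioo (0 : ℝ) 1, 0 ≤ ψ x)
    (hψ_lim : Tendsto ψ (𝓝[<] (1 : ℝ)) (𝓝 ψ₁)) (θ : ℝ) :
    Tendsto (fun s : ℝ => ((s ^ (-(1 + β)) : ℝ) : ℂ) *
      (∫ a, Complex.exp (Complex.I * (θ * s * (lam / (1 - a)
        - ∫ a', lam / (1 - a') ∂mixingLaw ψ β) : ℝ)) ∂mixingLaw ψ β - 1))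
      (𝓝[>] 0) (𝓝 (-((|θ| ^ (1 + β) : ℝ) : ℂ) * omegaBeta lam β ψ₁ θ)) := by
  set m := ∫ a', lam / (1 - a') ∂mixingLaw ψ β with hm
  have hW := integrable_inv_one_sub (lam := lam) hβ₀ hψ_meas hψ_nonneg hψ_lim
  choose R hR hRe using fun s : ℝ => integral_cexp_sub_mean_sub_one hW (θ * s)
  rw [← hm] at hR hRe
  simp only [hRe, mul_add]
  rw [← add_zero (-((|θ| ^ (1 + β) : ℝ) : ℂ) * omegaBeta lam β ψ₁ θ)]
  refine Tendsto.add ?_ ?_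
  · have h1 : Tendsto (fun s : ℝ => Complex.exp (-(Complex.I * (θ * s * m : ℝ)))) (𝓝[>] 0) (𝓝 1) := by
      have : Tendsto (fun s : ℝ => Complex.exp (-(Complex.I * (θ * s * m : ℝ)))) (𝓝 0)
          (𝓝 (Complex.exp (-(Complex.I * (θ * 0 * m : ℝ))))) :=
        Continuous.tendsto (by fun_prop) _
      simp only [mul_zero, zero_mul, Complex.ofReal_zero, neg_zero, Complex.exp_zero] at this
      exact this.mono_left nhdsWithin_le_nhds
    have := h1.mul (tendsto_expTail_integral hlam hβ₀ hβ₁ hψ_meas hψ_nonneg hψ_lim θ)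
    rw [one_mul] at this
    refine this.congr fun s => by ring
  · refine squeeze_zero_norm' (a := fun s : ℝ => 5 * (θ * m) ^ 2 * s ^ (1 - β)) ?_ ?_
    · filter_upwards [self_mem_nhdsWithin] with s hs
      have hs : 0 < s := hs
      have hsp := Real.rpow_pos_of_pos hs (-(1 + β))
      rw [norm_mul, Complex.norm_real, Real.norm_of_nonneg hsp.le]
      have e : s ^ (1 - β) = s ^ (-(1 + β)) * s ^ 2 := by
        rw [← Real.rpow_two, ← Real.rpow_add hs]; congr 1; ring
      calc _ ≤ s ^ (-(1 + β)) * (5 * (θ * s * m) ^ 2) := by gcongr; exact hR s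
        _ = _ := by rw [e]; ring
    · have : Tendsto (fun s : ℝ => 5 * (θ * m) ^ 2 * s ^ (1 - β)) (𝓝 0)
          (𝓝 (5 * (θ * m) ^ 2 * 0 ^ (1 - β))) :=
        ((Real.continuousAt_rpow_const 0 _ (Or.inr (by linarith))).tendsto).const_mul _
      rw [Real.zero_rpow (by linarith), mul_zero] at this
      exact this.mono_left nhdsWithin_le_nhds

end Mixing

theorem tendsto_scale {β : ℝ} (hβ₀ : 0 < β) :
    Tendsto (fun N : ℕ => (N : ℝ) ^ (-(1 / (1 + β)))) atTop (𝓝[>] 0) := by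
  refine tendsto_nhdsWithin_iff.2 ⟨?_, ?_⟩
  · exact (tendsto_rpow_neg_atTop (by positivity)).comp tendsto_natCast_atTop_atTop
  · filter_upwards [eventually_gt_atTop 0] with N hN
    exact Real.rpow_pos_of_pos (by exact_mod_cast hN) _

theorem scale_rpow {β : ℝ} (hβ₀ : 0 < β) (N : ℕ) :
    ((N : ℝ) ^ (-(1 / (1 + β)))) ^ (-(1 + β)) = N := by
  rw [← Real.rpow_mul (Nat.cast_nonneg N)]
  have : -(1 / (1 + β)) * -(1 + β) = 1 := by field_simp
  rw [this, Real.rpow_one]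

end

noncomputable section

/-! ### The driving variables: conditional independence given the thinning parameter -/

/-- Index set of the driving variables. -/
inductive Idx
  | init : Idx
  | imm : ℕ → Idx
  | off : ℕ → ℕ → Idx

/-- The driving variables as one family. -/
def drive {Ω : Type*} (X₀ : Ω → ℕ) (ε : ℕ → Ω → ℕ) (ξ : ℕ → ℕ → Ω → ℕ) : Idx → Ω → ℕ
  | .init => X₀
  | .imm k => ε k
  | .off k l => ξ k l

/-- The conditional weights of the driving variables. -/
def weight (lam a : ℝ) : Idx → ℕ → ℝ
  | .init => poissonWeight (lam / (1 - a))
  | .imm _ => poissonWeight lam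
  | .off _ _ => bernoulliWeight a

/-- The conditional laws of the driving variables. -/
def condLaw (lam a : ℝ) (i : Idx) : Measure ℕ :=
  Measure.sum fun v => ENNReal.ofReal (weight lam a i v) • Measure.dirac v

theorem condLaw_singleton (lam a : ℝ) (i : Idx) (v : ℕ) :
    condLaw lam a i {v} = ENNReal.ofReal (weight lam a i v) := by
  rw [condLaw, Measure.sum_smul_dirac_singleton]

open Classical in
theorem condLaw_apply (lam a : ℝ) (i : Idx) (D : Set ℕ) :
    condLaw lam a i D = ∑' v, if v ∈ D then ENNReal.ofReal (weight lam a i v) else 0 := by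
  rw [condLaw, Measure.sum_apply _ (MeasurableSet.of_discrete)]
  refine tsum_congr fun v => ?_
  simp [Set.indicator_apply]

theorem poissonWeight_nonneg {r : ℝ} (hr : 0 ≤ r) (m : ℕ) : 0 ≤ poissonWeight r m := by
  unfold poissonWeight; positivity

theorem hasSum_poissonWeight (r : ℝ) : HasSum (poissonWeight r) 1 := by
  have := (NormedSpace.expSeries_div_hasSum_exp r).mul_right (Real.exp (-r))
  rw [← Real.exp_eq_exp_ℝ, ← Real.exp_add, add_neg_cancel, Real.exp_zero] at this
  exact this

theorem bernoulliWeight_nonneg {a : ℝ} (ha : a ∈ Set.Ioo (0 : ℝ) 1) (m : ℕ) :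
    0 ≤ bernoulliWeight a m := by
  unfold bernoulliWeight
  split_ifs
  · exact ha.1.le
  · linarith [ha.2]
  · exact le_rfl

theorem weight_nonneg {lam a : ℝ} (hlam : 0 < lam) (ha : a ∈ Set.Ioo (0 : ℝ) 1) (i : Idx) (v : ℕ) :
    0 ≤ weight lam a i v := by
  cases i with
  | init => exact poissonWeight_nonneg (div_nonneg hlam.le (by linarith [ha.2])) v
  | imm k => exact poissonWeight_nonneg hlam.le v
  | off k l => exact bernoulliWeight_nonneg ha v

theorem tsum_ofReal_bernoulliWeight_mul (a : ℝ) (f : ℕ → ℝ≥0∞) :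
    ∑' v, ENNReal.ofReal (bernoulliWeight a v) * f v
      = ENNReal.ofReal (1 - a) * f 0 + ENNReal.ofReal a * f 1 := by
  rw [tsum_eq_sum (s := {0, 1})]
  · simp [bernoulliWeight]
  · intro v hv
    simp only [Finset.mem_insert, Finset.mem_singleton, not_or] at hv
    simp [bernoulliWeight, hv.1, hv.2]

theorem condLaw_univ {lam a : ℝ} (hlam : 0 < lam) (ha : a ∈ Set.Ioo (0 : ℝ) 1) (i : Idx) :
    condLaw lam a i Set.univ = 1 := by
  have hp : ∀ r : ℝ, 0 ≤ r → ∑' v, ENNReal.ofReal (poissonWeight r v) = 1 := by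
    intro r hr
    rw [← ENNReal.ofReal_tsum_of_nonneg (poissonWeight_nonneg hr) (hasSum_poissonWeight r).summable,
      (hasSum_poissonWeight r).tsum_eq, ENNReal.ofReal_one]
  rw [condLaw_apply]
  simp only [Set.mem_univ, if_true]
  cases i with
  | init => exact hp _ (div_nonneg hlam.le (by linarith [ha.2]))
  | imm k => exact hp _ hlam.le
  | off k l =>
    have := tsum_ofReal_bernoulliWeight_mul a 1
    simp only [Pi.one_apply, mul_one] at this
    simp only [weight]
    rw [this, ← ENNReal.ofReal_add (by linarith [ha.2]) ha.1.le]
    simp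

@[fun_prop]
theorem measurable_poissonWeight (m : ℕ) : Measurable fun r => poissonWeight r m := by
  unfold poissonWeight; fun_prop

theorem measurable_weight (lam : ℝ) (i : Idx) (v : ℕ) : Measurable fun a => weight lam a i v := by
  cases i with
  | init => exact (measurable_poissonWeight v).comp (by fun_prop)
  | imm k => exact measurable_const
  | off k l => simp only [weight, bernoulliWeight]; split_ifs <;> fun_prop

theorem measurable_condLaw (lam : ℝ) (i : Idx) (D : Set ℕ) :
    Measurable fun a => condLaw lam a i D := by
  classical
  simp only [condLaw_apply]
  refine Measurable.tsum fun v => ?_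
  split_ifs
  · exact (measurable_weight lam i v).ennreal_ofReal
  · exact measurable_const

open Classical in
/-- The finite set of driving variables of generations below `n` and individuals below `n`. -/
def box (n : ℕ) : Finset Idx :=
  insert Idx.init ((Finset.range n).image Idx.imm ∪
    (Finset.range n ×ˢ Finset.range n).image fun p => Idx.off p.1 p.2)

theorem mem_box_init (n : ℕ) : Idx.init ∈ box n := by simp [box]

theorem mem_box_imm {n k : ℕ} : Idx.imm k ∈ box n ↔ k < n := by simp [box]

theorem mem_box_off {n k l : ℕ} : Idx.off k l ∈ box n ↔ k < n ∧ l < n := by simp [box]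

theorem prod_box {M : Type*} [CommMonoid M] (n : ℕ) (f : Idx → M) :
    ∏ i ∈ box n, f i = f .init * (∏ k ∈ Finset.range n, f (.imm k)) *
      ∏ k ∈ Finset.range n, ∏ l ∈ Finset.range n, f (.off k l) := by
  classical
  rw [box, Finset.prod_insert (by simp), Finset.prod_union, Finset.prod_image, Finset.prod_image,
    Finset.prod_product, mul_assoc]
  · rintro ⟨a, b⟩ _ ⟨c, d⟩ _ h
    simpa using h
  · intro a _ b _ h
    simpa using h
  · rw [Finset.disjoint_left]
    simp

theorem box_mono {m n : ℕ} (h : m ≤ n) : box m ⊆ box n := by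
  intro i hi
  cases i with
  | init => exact mem_box_init n
  | imm k => rw [mem_box_imm] at hi ⊢; omega
  | off k l => rw [mem_box_off] at hi ⊢; omega

theorem exists_mem_box (i : Idx) : ∃ n, i ∈ box n := by
  cases i with
  | init => exact ⟨0, mem_box_init 0⟩
  | imm k => exact ⟨k + 1, mem_box_imm.2 (by omega)⟩
  | off k l => exact ⟨k + l + 1, mem_box_off.2 (by omega)⟩

theorem exists_subset_box (t : Finset Idx) : ∃ n, t ⊆ box n := by
  classical
  induction t using Finset.induction_on with
  | empty => exact ⟨0, by simp⟩
  | insert i t _ ih =>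
    obtain ⟨n, hn⟩ := ih
    obtain ⟨m, hm⟩ := exists_mem_box i
    refine ⟨max m n, Finset.insert_subset (box_mono (le_max_left _ _) hm)
      (hn.trans (box_mono (le_max_right _ _)))⟩

section Sigma

variable {Ω : Type*} {α : Ω → ℝ}

/-- The σ-algebras generated by the parameter and by the single driving variables. -/
@[reducible]
def coordSigma (α : Ω → ℝ) (V : Idx → Ω → ℕ) : Option Idx → MeasurableSpace Ω
  | none => MeasurableSpace.comap α inferInstance
  | some i => MeasurableSpace.comap (V i) ⊤

/-- The σ-algebra generated by the variables with index in `S`. -/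
@[reducible]
def sigmaOn (α : Ω → ℝ) (V : Idx → Ω → ℕ) (S : Set (Option Idx)) : MeasurableSpace Ω :=
  ⨆ j ∈ S, coordSigma α V j

theorem coordSigma_le_sigmaOn {V : Idx → Ω → ℕ} {S : Set (Option Idx)} {j : Option Idx}
    (hj : j ∈ S) : coordSigma α V j ≤ sigmaOn α V S :=
  le_iSup₂ (f := fun j _ => coordSigma α V j) j hj

theorem sigmaOn_mono {V : Idx → Ω → ℕ} {S T : Set (Option Idx)} (h : S ⊆ T) :
    sigmaOn α V S ≤ sigmaOn α V T :=
  iSup₂_le fun _ hj => coordSigma_le_sigmaOn (h hj)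

theorem measurable_param_sigmaOn {V : Idx → Ω → ℕ} {S : Set (Option Idx)} (h : none ∈ S) :
    Measurable[sigmaOn α V S] α :=
  (comap_measurable α).mono (coordSigma_le_sigmaOn (j := none) h) le_rfl

theorem measurable_coord_sigmaOn {V : Idx → Ω → ℕ} {S : Set (Option Idx)} {i : Idx}
    (h : some i ∈ S) : Measurable[sigmaOn α V S] (V i) :=
  (comap_measurable (V i)).mono (coordSigma_le_sigmaOn (j := some i) h) le_rfl

end Sigma

section Law

variable {Ω : Type*} [mΩ : MeasurableSpace Ω] {P : Measure Ω} {lam : ℝ} {α : Ω → ℝ} {X₀ : Ω → ℕ}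
  {ε : ℕ → Ω → ℕ} {ξ : ℕ → ℕ → Ω → ℕ}

theorem IsDriving.measurable_drive (h : IsDriving P lam α X₀ ε ξ) (i : Idx) :
    Measurable (drive X₀ ε ξ i) := by
  cases i with
  | init => exact h.measurable_init
  | imm k => exact h.measurable_immigration k
  | off k l => exact h.measurable_offspring k l

/-- The event that the parameter lies in `B` and the driving variables `i ∈ t` lie in `D i`. -/
def cyl (α : Ω → ℝ) (V : Idx → Ω → ℕ) (B : Set ℝ) (t : Finset Idx) (D : Idx → Set ℕ) : Set Ω :=
  {ω | α ω ∈ B ∧ ∀ i ∈ t, V i ω ∈ D i}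

theorem measurableSet_cyl (h : IsDriving P lam α X₀ ε ξ) {B : Set ℝ} (hB : MeasurableSet B)
    (t : Finset Idx) (D : Idx → Set ℕ) : MeasurableSet (cyl α (drive X₀ ε ξ) B t D) := by
  have : cyl α (drive X₀ ε ξ) B t D = α ⁻¹' B ∩ ⋂ i ∈ t, drive X₀ ε ξ i ⁻¹' D i := by
    ext ω; simp [cyl]
  rw [this]
  exact (h.measurable_param hB).inter (Finset.measurableSet_biInter _ fun i _ =>
    h.measurable_drive i (MeasurableSet.of_discrete))

theorem IsDriving.measure_cyl_box_singleton (h : IsDriving P lam α X₀ ε ξ) (hlam : 0 < lam)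
    (hα : ∀ᵐ a ∂P.map α, a ∈ Set.Ioo (0 : ℝ) 1) (n : ℕ) {B : Set ℝ} (hB : MeasurableSet B)
    (v : Idx → ℕ) :
    P (cyl α (drive X₀ ε ξ) B (box n) fun i => {v i})
      = ∫⁻ a in B, ∏ i ∈ box n, condLaw lam a i {v i} ∂(P.map α) := by
  have hj := h.joint_law n B hB (v .init) (fun k => v (.imm k)) (fun k l => v (.off k l))
  have hset : cyl α (drive X₀ ε ξ) B (box n) (fun i => {v i})
      = {ω | α ω ∈ B ∧ X₀ ω = v .init ∧ (∀ k < n, ε k ω = v (.imm k)) ∧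
          ∀ k < n, ∀ l < n, ξ k l ω = v (.off k l)} := by
    ext ω
    simp only [cyl, Set.mem_ofPred_eq, Set.mem_singleton_iff]
    refine and_congr_right fun _ => ⟨fun H => ⟨H _ (mem_box_init n),
      fun k hk => H _ (mem_box_imm.2 hk), fun k hk l hl => H _ (mem_box_off.2 ⟨hk, hl⟩)⟩, ?_⟩
    rintro ⟨h1, h2, h3⟩ i hi
    cases i with
    | init => exact h1
    | imm k => exact h2 k (mem_box_imm.1 hi)
    | off k l => exact h3 k (mem_box_off.1 hi).1 l (mem_box_off.1 hi).2
  rw [hset, hj]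
  refine lintegral_congr_ae ?_
  filter_upwards [ae_restrict_of_ae hα] with a ha
  have : jointWeight lam a n (v .init) (fun k => v (.imm k)) (fun k l => v (.off k l))
      = ∏ i ∈ box n, weight lam a i (v i) := (prod_box n fun i => weight lam a i (v i)).symm
  rw [this, ENNReal.ofReal_prod_of_nonneg fun i _ => weight_nonneg hlam ha i _]
  simp only [condLaw_singleton]

/-- Singletons are enlarged to arbitrary sets one coordinate at a time, by countable additivity of
`P` on one side and of `condLaw` in that coordinate on the other. -/
theorem IsDriving.measure_cyl_box (h : IsDriving P lam α X₀ ε ξ) (hlam : 0 < lam)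
    (hα : ∀ᵐ a ∂P.map α, a ∈ Set.Ioo (0 : ℝ) 1) (n : ℕ) {B : Set ℝ} (hB : MeasurableSet B)
    (D : Idx → Set ℕ) :
    P (cyl α (drive X₀ ε ξ) B (box n) D)
      = ∫⁻ a in B, ∏ i ∈ box n, condLaw lam a i (D i) ∂(P.map α) := by
  classical
  -- `K` collects the coordinates whose constraint need not be a singleton; the induction is on `K`.
  suffices H : ∀ K : Finset Idx, K ⊆ box n → ∀ D : Idx → Set ℕ,
      (∀ i, i ∉ K → ∃ v, D i = {v}) → P (cyl α (drive X₀ ε ξ) B (box n) D)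
        = ∫⁻ a in B, ∏ i ∈ box n, condLaw lam a i (D i) ∂(P.map α) by
    -- Constraints outside the box play no role; the value `{0}` merely makes them singletons.
    have key := H (box n) subset_rfl (fun i => if i ∈ box n then D i else {0})
      (fun i hi => ⟨0, if_neg hi⟩)
    have e1 : cyl α (drive X₀ ε ξ) B (box n) (fun i => if i ∈ box n then D i else {0})
        = cyl α (drive X₀ ε ξ) B (box n) D := by
      ext ω
      simp only [cyl, Set.mem_ofPred_eq]
      refine and_congr_right fun _ => forall₂_congr fun i hi => by rw [if_pos hi]
    rw [e1] at key
    rw [key]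
    refine lintegral_congr fun a => Finset.prod_congr rfl fun i hi => by rw [if_pos hi]
  intro K
  induction K using Finset.induction_on with
  | empty =>
    intro _ D hD
    choose v hv using fun i => hD i (by simp)
    have : D = fun i => {v i} := funext hv
    rw [this]
    exact h.measure_cyl_box_singleton hlam hα n hB v
  | insert i₀ K hi₀ ih =>
    intro hK D hD
    have hi₀n : i₀ ∈ box n := hK (Finset.mem_insert_self _ _)
    have hupd : ∀ v, P (cyl α (drive X₀ ε ξ) B (box n) (Function.update D i₀ {v}))
        = ∫⁻ a in B, ∏ i ∈ box n, condLaw lam a i (Function.update D i₀ {v} i) ∂(P.map α) := by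
      intro v
      refine ih ((Finset.subset_insert _ _).trans hK) _ fun i hi => ?_
      by_cases hii : i = i₀
      · subst hii; exact ⟨v, by simp⟩
      · rw [Function.update_of_ne hii]; exact hD i (by simp [hii, hi])
    have hprod : ∀ a (E : Set ℕ), ∏ i ∈ box n, condLaw lam a i (Function.update D i₀ E i)
        = condLaw lam a i₀ E * ∏ i ∈ (box n).erase i₀, condLaw lam a i (D i) := by
      intro a E
      rw [← Finset.mul_prod_erase _ _ hi₀n, Function.update_self]
      congr 1
      refine Finset.prod_congr rfl fun i hi => ?_
      rw [Function.update_of_ne (Finset.ne_of_mem_erase hi)]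
    have hsplit : cyl α (drive X₀ ε ξ) B (box n) D
        = ⋃ v : ℕ, if v ∈ D i₀ then cyl α (drive X₀ ε ξ) B (box n) (Function.update D i₀ {v})
          else ∅ := by
      ext ω
      simp only [Set.mem_iUnion]
      constructor
      · rintro ⟨h1, h2⟩
        refine ⟨drive X₀ ε ξ i₀ ω, ?_⟩
        rw [if_pos (h2 i₀ hi₀n)]
        refine ⟨h1, fun i hi => ?_⟩
        by_cases hii : i = i₀
        · subst hii; simp
        · rw [Function.update_of_ne hii]; exact h2 i hi
      · rintro ⟨v, hv⟩
        split_ifs at hv with hvD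
        · refine ⟨hv.1, fun i hi => ?_⟩
          have := hv.2 i hi
          by_cases hii : i = i₀
          · subst hii
            rw [Function.update_self, Set.mem_singleton_iff] at this
            rwa [this]
          · rwa [Function.update_of_ne hii] at this
        · exact absurd hv (Set.notMem_empty _)
    rw [hsplit, measure_iUnion]
    · have hD' : D = Function.update D i₀ (D i₀) := (Function.update_eq_self i₀ D).symm
      have hR : ∀ a, ∏ i ∈ box n, condLaw lam a i (D i)
          = ∑' v, if v ∈ D i₀ then
            ∏ i ∈ box n, condLaw lam a i (Function.update D i₀ {v} i) else 0 := by
        intro a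
        conv_lhs => rw [hD']
        rw [hprod, condLaw_apply, ← ENNReal.tsum_mul_right]
        refine tsum_congr fun v => ?_
        rw [hprod, condLaw_singleton]
        split_ifs <;> simp
      simp only [hR]
      rw [lintegral_tsum]
      · refine tsum_congr fun v => ?_
        split_ifs
        · exact hupd v
        · simp
      · intro v
        split_ifs
        · exact (Finset.measurable_prod _ fun i _ => measurable_condLaw lam i _).aemeasurable
        · exact aemeasurable_const
    · intro v w hvw
      rw [Function.onFun, Set.disjoint_left]
      intro ω hv hw
      split_ifs at hv with h1
      · split_ifs at hw with h2
        · have e1 := hv.2 i₀ hi₀n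
          have e2 := hw.2 i₀ hi₀n
          rw [Function.update_self, Set.mem_singleton_iff] at e1 e2
          exact hvw (e1.symm.trans e2)
        · exact hw
      · exact hv
    · intro v
      split_ifs
      · exact measurableSet_cyl h hB _ _
      · exact MeasurableSet.empty

/-- Marginalization: `t` is enclosed in a box, and the unconstrained coordinates contribute mass `1`
whenever `a ∈ (0, 1)`. -/
theorem IsDriving.measure_cyl (h : IsDriving P lam α X₀ ε ξ) (hlam : 0 < lam)
    (hα : ∀ᵐ a ∂P.map α, a ∈ Set.Ioo (0 : ℝ) 1) (t : Finset Idx) {B : Set ℝ} (hB : MeasurableSet B)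
    (D : Idx → Set ℕ) :
    P (cyl α (drive X₀ ε ξ) B t D)
      = ∫⁻ a in B, ∏ i ∈ t, condLaw lam a i (D i) ∂(P.map α) := by
  classical
  obtain ⟨n, hn⟩ := exists_subset_box t
  have key := h.measure_cyl_box hlam hα n hB (fun i => if i ∈ t then D i else Set.univ)
  have e1 : cyl α (drive X₀ ε ξ) B (box n) (fun i => if i ∈ t then D i else Set.univ)
      = cyl α (drive X₀ ε ξ) B t D := by
    ext ω
    refine and_congr_right fun _ => ⟨fun H i hi => ?_, fun H i hi => ?_⟩
    · have := H i (hn hi)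
      simpa only [if_pos hi] using this
    · simp only
      split_ifs with hit
      · exact H i hit
      · exact Set.mem_univ _
  rw [e1] at key
  rw [key]
  refine lintegral_congr_ae ?_
  filter_upwards [ae_restrict_of_ae hα] with a ha
  rw [← Finset.prod_subset hn]
  · exact Finset.prod_congr rfl fun i hi => by rw [if_pos hi]
  · intro i _ hi
    rw [if_neg hi, condLaw_univ hlam ha]

/-- Integrating a function of the parameter over a cylinder. -/
theorem IsDriving.setLIntegral_cyl (h : IsDriving P lam α X₀ ε ξ) (hlam : 0 < lam)
    (hα : ∀ᵐ a ∂P.map α, a ∈ Set.Ioo (0 : ℝ) 1) (t : Finset Idx) {B : Set ℝ} (hB : MeasurableSet B)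
    (D : Idx → Set ℕ) {φ : ℝ → ℝ≥0∞} (hφ : Measurable φ) :
    ∫⁻ ω in cyl α (drive X₀ ε ξ) B t D, φ (α ω) ∂P
      = ∫⁻ a in B, φ a * ∏ i ∈ t, condLaw lam a i (D i) ∂(P.map α) := by
  have hm : Measurable fun a => ∏ i ∈ t, condLaw lam a i (D i) :=
    Finset.measurable_prod _ fun i _ => measurable_condLaw lam i _
  have hmeas : (P.restrict (cyl α (drive X₀ ε ξ) B t D)).map α
      = ((P.map α).restrict B).withDensity fun a => ∏ i ∈ t, condLaw lam a i (D i) := by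
    ext E hE
    rw [Measure.map_apply h.measurable_param hE,
      Measure.restrict_apply (h.measurable_param hE), withDensity_apply _ hE,
      Measure.restrict_restrict hE, ← h.measure_cyl hlam hα t (hE.inter hB) D]
    congr 1
    ext ω
    simp only [cyl, Set.mem_inter_iff, Set.mem_preimage, Set.mem_ofPred_eq, and_assoc]
  rw [← lintegral_map hφ h.measurable_param, hmeas, lintegral_withDensity_eq_lintegral_mul _ hm hφ]
  refine lintegral_congr fun a => ?_
  rw [Pi.mul_apply, mul_comm]

theorem IsDriving.sigmaOn_le (h : IsDriving P lam α X₀ ε ξ) (S : Set (Option Idx)) :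
    sigmaOn α (drive X₀ ε ξ) S ≤ mΩ := by
  refine iSup₂_le fun j _ => ?_
  cases j with
  | none => exact h.measurable_param.comap_le
  | some i => exact (h.measurable_drive i).comap_le

/-- Conditional independence of the variable `i₀` from all the others. Restriction to the event
`{v}` and the density `w (α ω)` define two finite measures that agree on the π-system of cylinders
avoiding `i₀`, hence on the σ-algebra it generates. -/
theorem IsDriving.lintegral_indicator_eq [IsProbabilityMeasure P]
    (h : IsDriving P lam α X₀ ε ξ) (hlam : 0 < lam)
    (hα : ∀ᵐ a ∂P.map α, a ∈ Set.Ioo (0 : ℝ) 1) (i₀ : Idx) (v : ℕ) {F : Ω → ℝ≥0∞}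
    (hF : Measurable[sigmaOn α (drive X₀ ε ξ) {j | j ≠ some i₀}] F) :
    ∫⁻ ω in drive X₀ ε ξ i₀ ⁻¹' {v}, F ω ∂P
      = ∫⁻ ω, ENNReal.ofReal (weight lam (α ω) i₀ v) * F ω ∂P := by
  classical
  set V := drive X₀ ε ξ with hV
  have hle := h.sigmaOn_le {j | j ≠ some i₀}
  set w : ℝ → ℝ≥0∞ := fun a => ENNReal.ofReal (weight lam a i₀ v) with hw
  have hwm : Measurable w := (measurable_weight lam i₀ v).ennreal_ofReal
  have hwα : Measurable fun ω => w (α ω) := hwm.comp h.measurable_param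
  have hVm : MeasurableSet (V i₀ ⁻¹' {v}) := h.measurable_drive i₀ (MeasurableSet.of_discrete)
  -- the two set functions agree on cylinders
  have hcyl : ∀ (t : Finset Idx) (B : Set ℝ) (D : Idx → Set ℕ), i₀ ∉ t → MeasurableSet B →
      P (V i₀ ⁻¹' {v} ∩ cyl α V B t D) = ∫⁻ ω in cyl α V B t D, w (α ω) ∂P := by
    intro t B D ht hB
    rw [h.setLIntegral_cyl hlam hα t hB D hwm]
    have : V i₀ ⁻¹' {v} ∩ cyl α V B t D = cyl α V B (insert i₀ t) (Function.update D i₀ {v}) := by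
      ext ω
      simp only [cyl, Set.mem_inter_iff, Set.mem_preimage, Set.mem_ofPred_eq, Finset.mem_insert,
        forall_eq_or_imp, Function.update_self]
      constructor
      · rintro ⟨h1, h2, h3⟩
        refine ⟨h2, h1, fun i hi => ?_⟩
        rw [Function.update_of_ne (ne_of_mem_of_not_mem hi ht)]; exact h3 i hi
      · rintro ⟨h2, h1, h3⟩
        refine ⟨h1, h2, fun i hi => ?_⟩
        have := h3 i hi
        rwa [Function.update_of_ne (ne_of_mem_of_not_mem hi ht)] at this
    rw [this, h.measure_cyl hlam hα _ hB]
    refine lintegral_congr fun a => ?_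
    rw [Finset.prod_insert ht, Function.update_self, condLaw_singleton]
    congr 1
    refine Finset.prod_congr rfl fun i hi => ?_
    rw [Function.update_of_ne (ne_of_mem_of_not_mem hi ht)]
  -- The comparison is made after trimming, since equality is claimed only on the σ-algebra of the
  -- other variables.
  have hmeas : (P.restrict (V i₀ ⁻¹' {v})).trim hle
      = (P.withDensity fun ω => w (α ω)).trim hle := by
    refine @ext_of_generate_finite Ω (sigmaOn α V {j | j ≠ some i₀}) _ _
      (piiUnionInter (fun j => {s | MeasurableSet[coordSigma α V j] s}) {j | j ≠ some i₀})
      (generateFrom_piiUnionInter_measurableSet _ _).symm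
      (isPiSystem_piiUnionInter _ (fun j => @MeasurableSpace.isPiSystem_measurableSet Ω (coordSigma α V j)) _)
      inferInstance ?_ ?_
    · rintro s hs
      have hsm : MeasurableSet[sigmaOn α V {j | j ≠ some i₀}] s :=
        measurableSet_iSup_of_mem_piiUnionInter _ _ _ hs
      obtain ⟨t, ht, f, hf, rfl⟩ := hs
      rw [trim_measurableSet_eq hle hsm, trim_measurableSet_eq hle hsm,
        Measure.restrict_apply (hle _ hsm), withDensity_apply _ (hle _ hsm)]
      -- A cylinder always carries a constraint on the parameter, so an absent one is encoded by
      -- `univ`.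
      have hB : ∃ B, MeasurableSet B ∧ (none ∈ t → f none = α ⁻¹' B) ∧ (none ∉ t → B = Set.univ) := by
        by_cases hn : none ∈ t
        · obtain ⟨B, hB, hB'⟩ := hf none hn
          exact ⟨B, hB, fun _ => hB'.symm, fun h => absurd hn h⟩
        · exact ⟨Set.univ, MeasurableSet.univ, fun h => absurd h hn, fun _ => rfl⟩
      obtain ⟨B, hBm, hB1, hB2⟩ := hB
      have hD : ∀ i, ∃ E : Set ℕ, some i ∈ t → f (some i) = V i ⁻¹' E := by
        intro i
        by_cases hn : some i ∈ t
        · obtain ⟨E, _, hE⟩ := hf (some i) hn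
          exact ⟨E, fun _ => hE.symm⟩
        · exact ⟨∅, fun h => absurd h hn⟩
      choose D hD using hD
      have hs : ⋂ x ∈ t, f x = cyl α V B t.eraseNone D := by
        ext ω
        simp only [Set.mem_iInter, cyl, Set.mem_ofPred_eq, Finset.mem_eraseNone]
        constructor
        · intro H
          refine ⟨?_, fun i hi => ?_⟩
          · by_cases hn : none ∈ t
            · have := H none hn
              rwa [hB1 hn] at this
            · rw [hB2 hn]; exact Set.mem_univ _
          · have := H _ hi
            rwa [hD i hi] at this
        · rintro ⟨h1, h2⟩ j hj
          cases j with
          | none => rw [hB1 hj]; exact h1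
          | some i => rw [hD i hj]; exact h2 i hj
      rw [hs, Set.inter_comm]
      refine hcyl _ B D ?_ hBm
      rw [Finset.mem_eraseNone]
      exact fun hi => ht hi rfl
    · rw [trim_measurableSet_eq hle MeasurableSet.univ, trim_measurableSet_eq hle MeasurableSet.univ,
        Measure.restrict_apply MeasurableSet.univ, withDensity_apply _ MeasurableSet.univ]
      have := hcyl ∅ Set.univ (fun _ => ∅) (by simp) MeasurableSet.univ
      have hu : cyl α V Set.univ ∅ (fun _ => ∅) = Set.univ := by ext ω; simp [cyl]
      rw [hu] at this
      rw [Set.univ_inter, ← this, Set.inter_univ]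
  have hF' : Measurable F := hF.mono hle le_rfl
  calc ∫⁻ ω in V i₀ ⁻¹' {v}, F ω ∂P = ∫⁻ ω, F ω ∂((P.restrict (V i₀ ⁻¹' {v})).trim hle) :=
        (lintegral_trim hle hF).symm
    _ = ∫⁻ ω, F ω ∂((P.withDensity fun ω => w (α ω)).trim hle) := by rw [hmeas]
    _ = ∫⁻ ω, F ω ∂(P.withDensity fun ω => w (α ω)) := lintegral_trim hle hF
    _ = _ := by
        rw [lintegral_withDensity_eq_lintegral_mul _ hwα hF']
        rfl

/-- Integrating out one driving variable. -/
theorem IsDriving.lintegral_integrate_out [IsProbabilityMeasure P]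
    (h : IsDriving P lam α X₀ ε ξ) (hlam : 0 < lam)
    (hα : ∀ᵐ a ∂P.map α, a ∈ Set.Ioo (0 : ℝ) 1) (i₀ : Idx) {G : ℕ → Ω → ℝ≥0∞}
    (hG : ∀ v, Measurable[sigmaOn α (drive X₀ ε ξ) {j | j ≠ some i₀}] (G v)) :
    ∫⁻ ω, G (drive X₀ ε ξ i₀ ω) ω ∂P
      = ∫⁻ ω, ∑' v, ENNReal.ofReal (weight lam (α ω) i₀ v) * G v ω ∂P := by
  have hle := h.sigmaOn_le {j | j ≠ some i₀}
  have hV := h.measurable_drive i₀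
  have hG' : ∀ v, Measurable (G v) := fun v => (hG v).mono hle le_rfl
  have hwα : ∀ v, Measurable fun ω => ENNReal.ofReal (weight lam (α ω) i₀ v) := fun v =>
    ((measurable_weight lam i₀ v).comp h.measurable_param).ennreal_ofReal
  rw [lintegral_tsum (f := fun v ω => ENNReal.ofReal (weight lam (α ω) i₀ v) * G v ω)
    fun v => ((hwα v).mul (hG' v)).aemeasurable]
  -- Partition the space according to the value of the variable `i₀`.
  rw [← setLIntegral_univ, ← Set.preimage_univ (f := drive X₀ ε ξ i₀), ← Set.iUnion_of_singleton,
    Set.preimage_iUnion, lintegral_iUnion (fun v => hV (MeasurableSet.of_discrete))]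
  · refine tsum_congr fun v => ?_
    rw [← h.lintegral_indicator_eq hlam hα i₀ v (hG v)]
    refine setLIntegral_congr_fun (hV (MeasurableSet.of_discrete)) fun ω hω => ?_
    have : drive X₀ ε ξ i₀ ω = v := hω
    simp only [this]
  · intro v w hvw
    exact Disjoint.preimage _ (by simpa using hvw)

end Law

end

noncomputable section

/-! ### The one-step transition and the conditional moments of the process -/

/-- Integral of `g` against the law of `Bin(x, a) + Poisson(lam)`. -/
def stepInt (lam a : ℝ) : ℕ → (ℕ → ℝ≥0∞) → ℝ≥0∞
  | 0, g => ∑' e, ENNReal.ofReal (poissonWeight lam e) * g e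
  | x + 1, g => ENNReal.ofReal (1 - a) * stepInt lam a x g
      + ENNReal.ofReal a * stepInt lam a x fun y => g (y + 1)

theorem measurable_stepInt (lam : ℝ) (x : ℕ) : ∀ {g : ℝ → ℕ → ℝ≥0∞},
    (∀ y, Measurable fun a => g a y) → Measurable fun a => stepInt lam a x (g a) := by
  induction x with
  | zero =>
    intro g hg
    exact Measurable.tsum fun e => (hg e).const_mul _
  | succ x ih =>
    intro g hg
    exact ((by fun_prop : Measurable fun a : ℝ => ENNReal.ofReal (1 - a)).mul (ih hg)).add
      (ENNReal.measurable_ofReal.mul (ih (g := fun a y => g a (y + 1)) fun y => hg (y + 1)))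

section PoissonMoments

variable {r : ℝ}

/-- The index shift from which both Poisson moments follow. -/
theorem poissonWeight_succ_mul (r : ℝ) (n : ℕ) :
    poissonWeight r (n + 1) * ((n + 1 : ℕ) : ℝ) = r * poissonWeight r n := by
  have h1 : ((n + 1 : ℕ) : ℝ) ≠ 0 := by positivity
  have h2 : (n.factorial : ℝ) ≠ 0 := by positivity
  unfold poissonWeight
  rw [Nat.factorial_succ, Nat.cast_mul, pow_succ]
  field_simp

theorem hasSum_poissonWeight_mul (r : ℝ) : HasSum (fun n => poissonWeight r n * n) r := by
  have h := (hasSum_poissonWeight r).mul_left r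
  rw [mul_one] at h
  rw [← hasSum_nat_add_iff' 1]
  simpa [poissonWeight_succ_mul] using h.congr_fun fun n => poissonWeight_succ_mul r n

theorem hasSum_poissonWeight_mul_sq (r : ℝ) :
    HasSum (fun n => poissonWeight r n * (n : ℝ) ^ 2) (r ^ 2 + r) := by
  have h := ((hasSum_poissonWeight_mul r).mul_left r).add ((hasSum_poissonWeight r).mul_left r)
  rw [← hasSum_nat_add_iff' 1]
  simp only [Finset.sum_range_one, Nat.cast_zero, ne_eq, OfNat.ofNat_ne_zero, not_false_eq_true,
    zero_pow, mul_zero, sub_zero]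
  rw [show r ^ 2 + r = r * r + r * 1 by ring]
  refine h.congr_fun fun n => ?_
  rw [pow_two, ← mul_assoc, poissonWeight_succ_mul]
  push_cast; ring

theorem tsum_poissonWeight_mul_add (hr : 0 ≤ r) {b : ℝ} (hb : 0 ≤ b) :
    ∑' e, ENNReal.ofReal (poissonWeight r e) * ENNReal.ofReal (e + b) = ENNReal.ofReal (r + b) := by
  have h := (hasSum_poissonWeight_mul r).add ((hasSum_poissonWeight r).mul_right b)
  rw [one_mul] at h
  rw [← h.tsum_eq, ENNReal.ofReal_tsum_of_nonneg _ h.summable]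
  · refine tsum_congr fun e => ?_
    rw [← ENNReal.ofReal_mul (poissonWeight_nonneg hr e)]
    congr 1; ring
  · intro e
    have := poissonWeight_nonneg hr e
    positivity

theorem tsum_poissonWeight_mul_sub_sq (hr : 0 ≤ r) (c : ℝ) :
    ∑' e, ENNReal.ofReal (poissonWeight r e) * ENNReal.ofReal ((e - c) ^ 2)
      = ENNReal.ofReal ((r - c) ^ 2 + r) := by
  have h := ((hasSum_poissonWeight_mul_sq r).add
    ((hasSum_poissonWeight_mul r).mul_left (-2 * c))).add ((hasSum_poissonWeight r).mul_left (c ^ 2))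
  have e1 : (r - c) ^ 2 + r = r ^ 2 + r + -2 * c * r + c ^ 2 * 1 := by ring
  rw [e1, ← h.tsum_eq, ENNReal.ofReal_tsum_of_nonneg _ h.summable]
  · refine tsum_congr fun e => ?_
    rw [← ENNReal.ofReal_mul (poissonWeight_nonneg hr e)]
    congr 1; ring
  · intro e
    have := mul_nonneg (poissonWeight_nonneg hr e) (sq_nonneg (e - c))
    linarith

end PoissonMoments

/-- The offset `b` makes the induction close: a surviving individual replaces `b` by `b + 1`. -/
theorem stepInt_add {lam a : ℝ} (hlam : 0 < lam) (ha : a ∈ Set.Ioo (0 : ℝ) 1) (x : ℕ) {b : ℝ}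
    (hb : 0 ≤ b) :
    stepInt lam a x (fun y => ENNReal.ofReal (y + b)) = ENNReal.ofReal (a * x + lam + b) := by
  have h1 : 0 ≤ 1 - a := by linarith [ha.2]
  have h0 := ha.1.le
  induction x generalizing b with
  | zero => simpa [stepInt] using tsum_poissonWeight_mul_add hlam.le hb
  | succ x ih =>
    have e : (fun y : ℕ => ENNReal.ofReal (((y + 1 : ℕ) : ℝ) + b))
        = fun y : ℕ => ENNReal.ofReal (y + (1 + b)) := by
      funext y; congr 1; push_cast; ring
    rw [stepInt, ih hb, e, ih (by linarith), ← ENNReal.ofReal_mul h1, ← ENNReal.ofReal_mul h0,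
      ← ENNReal.ofReal_add (by positivity) (by positivity)]
    congr 1; push_cast; ring

/-- Squared bias plus variance, the latter being binomial plus Poisson. A surviving individual
replaces the centre `c` by `c - 1`. -/
theorem stepInt_sub_sq {lam a : ℝ} (hlam : 0 < lam) (ha : a ∈ Set.Ioo (0 : ℝ) 1) (x : ℕ) (c : ℝ) :
    stepInt lam a x (fun y => ENNReal.ofReal ((y - c) ^ 2))
      = ENNReal.ofReal ((a * x + lam - c) ^ 2 + a * (1 - a) * x + lam) := by
  have h1 : 0 ≤ 1 - a := by linarith [ha.2]
  have h0 := ha.1.le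
  induction x generalizing c with
  | zero => simpa [stepInt] using tsum_poissonWeight_mul_sub_sq hlam.le c
  | succ x ih =>
    have e : (fun y : ℕ => ENNReal.ofReal ((((y + 1 : ℕ) : ℝ) - c) ^ 2))
        = fun y : ℕ => ENNReal.ofReal ((y - (c - 1)) ^ 2) := by
      funext y; congr 1; push_cast; ring
    rw [stepInt, ih c, e, ih (c - 1), ← ENNReal.ofReal_mul h1, ← ENNReal.ofReal_mul h0,
      ← ENNReal.ofReal_add (by positivity) (by positivity)]
    congr 1; push_cast; ring

theorem measurable_comp_nat {Ω E : Type*} {m : MeasurableSpace Ω} [MeasurableSpace E]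
    {f : ℕ → Ω → E} (hf : ∀ n, Measurable (f n)) {N : Ω → ℕ} (hN : Measurable N) :
    Measurable fun ω => f (N ω) ω := by
  have h : Measurable fun p : ℕ × Ω => f p.1 p.2 := measurable_from_prod_countable_right hf
  exact h.comp (hN.prodMk measurable_id)

/-- The indices of the variables that determine the parameter and the process up to time `k`. -/
def past (k : ℕ) : Set (Option Idx) :=
  {j | ∀ i, j = some i → i = .init ∨ (∃ p < k, i = .imm p) ∨ ∃ p < k, ∃ l, i = .off p l}

theorem none_mem_past (k : ℕ) : none ∈ past k := by intro i h; cases h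

theorem init_mem_past (k : ℕ) : some Idx.init ∈ past k := by
  intro i h; cases h; exact Or.inl rfl

theorem imm_mem_past {p k : ℕ} (h : p < k) : some (Idx.imm p) ∈ past k := by
  intro i hi; cases hi; exact Or.inr (Or.inl ⟨p, h, rfl⟩)

theorem off_mem_past {p k : ℕ} (h : p < k) (l : ℕ) : some (Idx.off p l) ∈ past k := by
  intro i hi; cases hi; exact Or.inr (Or.inr ⟨p, h, l, rfl⟩)

theorem past_mono {k m : ℕ} (h : k ≤ m) : past k ⊆ past m := by
  intro j hj i hi
  rcases hj i hi with h1 | ⟨p, hp, h1⟩ | ⟨p, hp, l, h1⟩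
  · exact Or.inl h1
  · exact Or.inr (Or.inl ⟨p, by omega, h1⟩)
  · exact Or.inr (Or.inr ⟨p, by omega, l, h1⟩)

theorem past_subset_ne_imm (k : ℕ) : past k ⊆ {j | j ≠ some (Idx.imm k)} := by
  rintro j hj rfl
  rcases hj _ rfl with h1 | ⟨p, hp, h1⟩ | ⟨p, hp, l, h1⟩
  · cases h1
  · cases h1; omega
  · cases h1

theorem past_subset_ne_off (k x : ℕ) : past k ⊆ {j | j ≠ some (Idx.off k x)} := by
  rintro j hj rfl
  rcases hj _ rfl with h1 | ⟨p, hp, h1⟩ | ⟨p, hp, l, h1⟩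
  · cases h1
  · cases h1
  · cases h1; omega

section Moments

variable {Ω : Type*} {α : Ω → ℝ} {X₀ : Ω → ℕ} {ε : ℕ → Ω → ℕ} {ξ : ℕ → ℕ → Ω → ℕ}

theorem measurable_inar_past (k : ℕ) :
    Measurable[sigmaOn α (drive X₀ ε ξ) (past k)] (inar X₀ ε ξ k) := by
  induction k with
  | zero => exact measurable_coord_sigmaOn (i := .init) (init_mem_past 0)
  | succ k ih =>
    have hX := ih.mono (sigmaOn_mono (past_mono (Nat.le_succ k))) le_rfl
    have hsum : ∀ x, Measurable[sigmaOn α (drive X₀ ε ξ) (past (k + 1))]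
        fun ω => ∑ l ∈ Finset.range x, ξ k l ω := fun x =>
      Finset.measurable_sum _ fun l _ =>
        measurable_coord_sigmaOn (i := .off k l) (off_mem_past (Nat.lt_succ_self k) l)
    have hε : Measurable[sigmaOn α (drive X₀ ε ξ) (past (k + 1))] (ε k) :=
      measurable_coord_sigmaOn (i := .imm k) (imm_mem_past (Nat.lt_succ_self k))
    exact (measurable_comp_nat hsum hX).add hε

variable [mΩ : MeasurableSpace Ω] {P : Measure Ω} {lam : ℝ}

theorem IsDriving.measurable_inar (h : IsDriving P lam α X₀ ε ξ) (k : ℕ) :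
    Measurable (inar X₀ ε ξ k) :=
  (measurable_inar_past (α := α) k).mono (h.sigmaOn_le _) le_rfl

theorem IsDriving.ae_mem_Ioo (h : IsDriving P lam α X₀ ε ξ)
    (hα : ∀ᵐ a ∂P.map α, a ∈ Set.Ioo (0 : ℝ) 1) : ∀ᵐ ω ∂P, α ω ∈ Set.Ioo (0 : ℝ) 1 :=
  ae_of_ae_map h.measurable_param.aemeasurable hα

variable [IsProbabilityMeasure P]

/-- For a deterministic population size `x`, the offspring variables are integrated out one by one
and the immigration last. `F` and `g` stay general in the induction: the weights `1 - α` and `α` are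
absorbed into `F`, and a success shifts `g`. -/
theorem IsDriving.lintegral_sum_offspring (h : IsDriving P lam α X₀ ε ξ) (hlam : 0 < lam)
    (hα : ∀ᵐ a ∂P.map α, a ∈ Set.Ioo (0 : ℝ) 1) (k x : ℕ) :
    ∀ {F : Ω → ℝ≥0∞}, Measurable[sigmaOn α (drive X₀ ε ξ) (past k)] F →
    ∀ {g : ℝ → ℕ → ℝ≥0∞}, (∀ y, Measurable fun a => g a y) →
    ∫⁻ ω, F ω * g (α ω) ((∑ l ∈ Finset.range x, ξ k l ω) + ε k ω) ∂P
      = ∫⁻ ω, F ω * stepInt lam (α ω) x (g (α ω)) ∂P := by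
  induction x with
  | zero =>
    intro F hF g hg
    have := h.lintegral_integrate_out hlam hα (.imm k) (G := fun v ω => F ω * g (α ω) v) ?_
    · simp only [Finset.range_zero, Finset.sum_empty, zero_add]
      refine Eq.trans this (lintegral_congr fun ω => ?_)
      rw [stepInt, ← ENNReal.tsum_mul_left]
      refine tsum_congr fun v => ?_
      simp only [weight]
      ring
    · intro v
      have hsub := past_subset_ne_imm k
      exact (hF.mono (sigmaOn_mono hsub) le_rfl).mul
        ((hg v).comp (measurable_param_sigmaOn (hsub (none_mem_past k))))
  | succ x ih =>
    intro F hF g hg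
    have hsub := past_subset_ne_off k x
    have hα' : Measurable[sigmaOn α (drive X₀ ε ξ) {j | j ≠ some (Idx.off k x)}] α :=
      measurable_param_sigmaOn (hsub (none_mem_past k))
    have hαp : Measurable[sigmaOn α (drive X₀ ε ξ) (past k)] α :=
      measurable_param_sigmaOn (none_mem_past k)
    have hstep := h.lintegral_integrate_out hlam hα (.off k x)
      (G := fun v ω => F ω * g (α ω) ((∑ l ∈ Finset.range x, ξ k l ω) + ε k ω + v)) ?_
    · have e : ∀ ω, (∑ l ∈ Finset.range (x + 1), ξ k l ω) + ε k ω
          = (∑ l ∈ Finset.range x, ξ k l ω) + ε k ω + drive X₀ ε ξ (.off k x) ω := by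
        intro ω
        rw [Finset.sum_range_succ]
        simp only [drive]
        ring
      simp only [e]
      rw [hstep]
      have hF0 : Measurable[sigmaOn α (drive X₀ ε ξ) (past k)]
          fun ω => F ω * ENNReal.ofReal (1 - α ω) :=
        hF.mul ((by fun_prop : Measurable fun a : ℝ => ENNReal.ofReal (1 - a)).comp hαp)
      have hF1 : Measurable[sigmaOn α (drive X₀ ε ξ) (past k)]
          fun ω => F ω * ENNReal.ofReal (α ω) :=
        hF.mul (ENNReal.measurable_ofReal.comp hαp)
      have i0 := ih hF0 hg
      have i1 := ih hF1 (g := fun a y => g a (y + 1)) fun y => hg (y + 1)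
      have hle := h.sigmaOn_le (past k)
      have hS : Measurable fun ω => (∑ l ∈ Finset.range x, ξ k l ω) + ε k ω :=
        (Finset.measurable_sum _ fun l _ => h.measurable_offspring k l).add
          (h.measurable_immigration k)
      have hm0 : Measurable fun ω => (F ω * ENNReal.ofReal (1 - α ω)) *
          g (α ω) ((∑ l ∈ Finset.range x, ξ k l ω) + ε k ω) :=
        (hF0.mono hle le_rfl).mul
          (measurable_comp_nat (fun y => (hg y).comp h.measurable_param) hS)
      have hm0' : Measurable fun ω => (F ω * ENNReal.ofReal (1 - α ω)) *
          stepInt lam (α ω) x (g (α ω)) :=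
        (hF0.mono hle le_rfl).mul ((measurable_stepInt lam x hg).comp h.measurable_param)
      calc _ = ∫⁻ ω, ((F ω * ENNReal.ofReal (1 - α ω)) *
              g (α ω) ((∑ l ∈ Finset.range x, ξ k l ω) + ε k ω) +
            (F ω * ENNReal.ofReal (α ω)) *
              g (α ω) ((∑ l ∈ Finset.range x, ξ k l ω) + ε k ω + 1)) ∂P := by
            refine lintegral_congr fun ω => ?_
            have := tsum_ofReal_bernoulliWeight_mul (α ω)
              fun v => F ω * g (α ω) ((∑ l ∈ Finset.range x, ξ k l ω) + ε k ω + v)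
            refine this.trans ?_
            rw [add_zero]
            ring
        _ = ∫⁻ ω, ((F ω * ENNReal.ofReal (1 - α ω)) * stepInt lam (α ω) x (g (α ω)) +
            (F ω * ENNReal.ofReal (α ω)) * stepInt lam (α ω) x fun y => g (α ω) (y + 1)) ∂P := by
            rw [lintegral_add_left hm0, i0, i1, ← lintegral_add_left hm0']
        _ = _ := by
            refine lintegral_congr fun ω => ?_
            rw [stepInt]
            ring
    · intro v
      have hmono := sigmaOn_mono (α := α) (V := drive X₀ ε ξ) hsub
      refine (hF.mono hmono le_rfl).mul ?_
      refine measurable_comp_nat (f := fun y ω => g (α ω) y) (fun y => (hg y).comp hα') ?_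
      refine Measurable.add_const (Measurable.add ?_ ?_) v
      · refine Finset.measurable_sum _ fun l hl => measurable_coord_sigmaOn (i := .off k l) ?_
        have := (Finset.mem_range.1 hl).ne
        simpa using this
      · exact measurable_coord_sigmaOn (i := .imm k) (by simp)

/-- The Markov property of the process given the thinning parameter. -/
theorem IsDriving.lintegral_succ (h : IsDriving P lam α X₀ ε ξ) (hlam : 0 < lam)
    (hα : ∀ᵐ a ∂P.map α, a ∈ Set.Ioo (0 : ℝ) 1) (k : ℕ)
    {F : Ω → ℝ≥0∞} (hF : Measurable[sigmaOn α (drive X₀ ε ξ) (past k)] F)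
    {g : ℝ → ℕ → ℝ≥0∞} (hg : ∀ y, Measurable fun a => g a y) :
    ∫⁻ ω, F ω * g (α ω) (inar X₀ ε ξ (k + 1) ω) ∂P
      = ∫⁻ ω, F ω * stepInt lam (α ω) (inar X₀ ε ξ k ω) (g (α ω)) ∂P := by
  classical
  have hle := h.sigmaOn_le (past k)
  have hXp : Measurable[sigmaOn α (drive X₀ ε ξ) (past k)] (inar X₀ ε ξ k) := measurable_inar_past k
  have hind : ∀ x : ℕ, Measurable[sigmaOn α (drive X₀ ε ξ) (past k)]
      fun ω => F ω * (if inar X₀ ε ξ k ω = x then 1 else 0) := by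
    intro x
    exact hF.mul ((Measurable.of_discrete (f := fun y : ℕ => if y = x then (1 : ℝ≥0∞) else 0)).comp hXp)
  -- The random number of summands becomes deterministic on each event `X_k = x`, whose indicator
  -- depends on the past only and is absorbed into `F`.
  have hsplit : ∀ H : Ω → ℕ → ℝ≥0∞, (∀ x, Measurable fun ω => H ω x) →
      ∫⁻ ω, F ω * H ω (inar X₀ ε ξ k ω) ∂P
        = ∑' x, ∫⁻ ω, (F ω * (if inar X₀ ε ξ k ω = x then 1 else 0)) * H ω x ∂P := by
    intro H hH
    rw [← lintegral_tsum (f := fun x ω => (F ω * (if inar X₀ ε ξ k ω = x then 1 else 0)) * H ω x)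
      fun x => (((hind x).mono hle le_rfl).mul (hH x)).aemeasurable]
    refine lintegral_congr fun ω => ?_
    rw [tsum_eq_single (inar X₀ ε ξ k ω)]
    · simp
    · intro x hx
      simp [hx.symm]
  have h1 := hsplit (fun ω x => g (α ω) ((∑ l ∈ Finset.range x, ξ k l ω) + ε k ω)) fun x => by
    refine measurable_comp_nat (fun y => (hg y).comp h.measurable_param) ?_
    exact (Finset.measurable_sum _ fun l _ => h.measurable_offspring k l).add
      (h.measurable_immigration k)
  have h2 := hsplit (fun ω x => stepInt lam (α ω) x (g (α ω))) fun x =>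
    (measurable_stepInt lam x hg).comp h.measurable_param
  rw [h2]
  refine Eq.trans h1 (tsum_congr fun x => ?_)
  exact h.lintegral_sum_offspring hlam hα k x (hind x) hg

theorem IsDriving.lintegral_zero (h : IsDriving P lam α X₀ ε ξ) (hlam : 0 < lam)
    (hα : ∀ᵐ a ∂P.map α, a ∈ Set.Ioo (0 : ℝ) 1)
    {g : ℝ → ℕ → ℝ≥0∞} (hg : ∀ y, Measurable fun a => g a y) :
    ∫⁻ ω, g (α ω) (inar X₀ ε ξ 0 ω) ∂P
      = ∫⁻ ω, ∑' v, ENNReal.ofReal (poissonWeight (lam / (1 - α ω)) v) * g (α ω) v ∂P :=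
  h.lintegral_integrate_out hlam hα .init (G := fun v ω => g (α ω) v) fun v =>
    (hg v).comp (measurable_param_sigmaOn (by simp))

/-- The conditional mean of `X_k` given `α` is constant in `k`, because `m = lam / (1 - a)` solves
`m = a m + lam`. The weight `f` tests the conditional expectation, and the lower integral requires
no integrability. -/
theorem IsDriving.lintegral_mul_inar (h : IsDriving P lam α X₀ ε ξ) (hlam : 0 < lam)
    (hα : ∀ᵐ a ∂P.map α, a ∈ Set.Ioo (0 : ℝ) 1) (k : ℕ) :
    ∀ {f : ℝ → ℝ≥0∞}, Measurable f →
    ∫⁻ ω, f (α ω) * ENNReal.ofReal (inar X₀ ε ξ k ω) ∂P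
      = ∫⁻ ω, f (α ω) * ENNReal.ofReal (lam / (1 - α ω)) ∂P := by
  induction k with
  | zero =>
    intro f hf
    rw [h.lintegral_zero hlam hα (g := fun a y => f a * ENNReal.ofReal y) fun y => hf.mul_const _]
    refine lintegral_congr_ae ?_
    filter_upwards [h.ae_mem_Ioo hα] with ω hω
    have h1 : 0 ≤ lam / (1 - α ω) := div_nonneg hlam.le (by linarith [hω.2])
    have := tsum_poissonWeight_mul_add h1 le_rfl
    simp only [add_zero] at this
    rw [← this, ← ENNReal.tsum_mul_left]
    refine tsum_congr fun v => by ring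
  | succ k ih =>
    intro f hf
    have hαp : Measurable[sigmaOn α (drive X₀ ε ξ) (past k)] α :=
      measurable_param_sigmaOn (none_mem_past k)
    have h1 := h.lintegral_succ hlam hα k (hf.comp hαp)
      (g := fun _ y => ENNReal.ofReal y) fun y => measurable_const
    simp only [Function.comp_apply] at h1
    rw [h1]
    have hXm := h.measurable_inar k
    have hαm := h.measurable_param
    calc _ = ∫⁻ ω, (f (α ω) * ENNReal.ofReal (α ω) * ENNReal.ofReal (inar X₀ ε ξ k ω) +
            f (α ω) * ENNReal.ofReal lam) ∂P := by
          refine lintegral_congr_ae ?_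
          filter_upwards [h.ae_mem_Ioo hα] with ω hω
          have := stepInt_add hlam hω (inar X₀ ε ξ k ω) le_rfl
          simp only [add_zero] at this
          rw [this, ENNReal.ofReal_add (mul_nonneg hω.1.le (Nat.cast_nonneg _)) hlam.le,
            ENNReal.ofReal_mul hω.1.le]
          ring
      _ = ∫⁻ ω, (f (α ω) * ENNReal.ofReal (α ω) * ENNReal.ofReal (lam / (1 - α ω)) +
            f (α ω) * ENNReal.ofReal lam) ∂P := by
          rw [lintegral_add_left (by fun_prop),
            ih (f := fun a => f a * ENNReal.ofReal a) (by fun_prop), lintegral_add_left (by fun_prop)]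
      _ = _ := by
          refine lintegral_congr_ae ?_
          filter_upwards [h.ae_mem_Ioo hα] with ω hω
          have h2 : 0 < 1 - α ω := by linarith [hω.2]
          rw [mul_assoc, ← ENNReal.ofReal_mul hω.1.le, ← mul_add,
            ← ENNReal.ofReal_add (mul_nonneg hω.1.le (by positivity)) hlam.le]
          congr 2
          field_simp
          ring

/-- Since `(α X + lam - c) ^ 2 = α ^ 2 (X - (c - lam) / α) ^ 2`, one step back moves the centre to
`(c - lam) / α`; hence `c` is an arbitrary function of the parameter. The variance `m = lam / (1 -
a)` is preserved by `v ↦ a ^ 2 v + a (1 - a) m + lam`. -/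
theorem IsDriving.lintegral_mul_inar_sub_sq (h : IsDriving P lam α X₀ ε ξ) (hlam : 0 < lam)
    (hα : ∀ᵐ a ∂P.map α, a ∈ Set.Ioo (0 : ℝ) 1) (k : ℕ) :
    ∀ {f : ℝ → ℝ≥0∞}, Measurable f → ∀ {c : ℝ → ℝ}, Measurable c →
    ∫⁻ ω, f (α ω) * ENNReal.ofReal ((inar X₀ ε ξ k ω - c (α ω)) ^ 2) ∂P
      = ∫⁻ ω, f (α ω) *
        ENNReal.ofReal ((lam / (1 - α ω) - c (α ω)) ^ 2 + lam / (1 - α ω)) ∂P := by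
  induction k with
  | zero =>
    intro f hf c hc
    rw [h.lintegral_zero hlam hα (g := fun a y => f a * ENNReal.ofReal ((y - c a) ^ 2))
      fun y => by fun_prop]
    refine lintegral_congr_ae ?_
    filter_upwards [h.ae_mem_Ioo hα] with ω hω
    have h1 : 0 ≤ lam / (1 - α ω) := div_nonneg hlam.le (by linarith [hω.2])
    rw [← tsum_poissonWeight_mul_sub_sq h1 (c (α ω)), ← ENNReal.tsum_mul_left]
    refine tsum_congr fun v => by ring
  | succ k ih =>
    intro f hf c hc
    have hαp : Measurable[sigmaOn α (drive X₀ ε ξ) (past k)] α :=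
      measurable_param_sigmaOn (none_mem_past k)
    have h1 := h.lintegral_succ hlam hα k (hf.comp hαp)
      (g := fun a y => ENNReal.ofReal ((y - c a) ^ 2)) fun y => by fun_prop
    simp only [Function.comp_apply] at h1
    rw [h1]
    have hXm := h.measurable_inar k
    have hαm := h.measurable_param
    calc _ = ∫⁻ ω, (f (α ω) * ENNReal.ofReal (α ω ^ 2) *
              ENNReal.ofReal ((inar X₀ ε ξ k ω - (c (α ω) - lam) / α ω) ^ 2) +
            (f (α ω) * ENNReal.ofReal (α ω * (1 - α ω)) * ENNReal.ofReal (inar X₀ ε ξ k ω) +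
              f (α ω) * ENNReal.ofReal lam)) ∂P := by
          refine lintegral_congr_ae ?_
          filter_upwards [h.ae_mem_Ioo hα] with ω hω
          have h2 : 0 < 1 - α ω := by linarith [hω.2]
          have h3 := hω.1
          rw [stepInt_sub_sq hlam hω, mul_assoc (f (α ω)), mul_assoc (f (α ω)), ← ENNReal.ofReal_mul (by positivity),
            ← ENNReal.ofReal_mul (by positivity), ← mul_add, ← mul_add,
            ← ENNReal.ofReal_add (by positivity) hlam.le,
            ← ENNReal.ofReal_add (by positivity) (by positivity)]
          congr 2
          field_simp
          ring
      _ = ∫⁻ ω, (f (α ω) * ENNReal.ofReal (α ω ^ 2) *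
              ENNReal.ofReal ((lam / (1 - α ω) - (c (α ω) - lam) / α ω) ^ 2 + lam / (1 - α ω)) +
            (f (α ω) * ENNReal.ofReal (α ω * (1 - α ω)) * ENNReal.ofReal (lam / (1 - α ω)) +
              f (α ω) * ENNReal.ofReal lam)) ∂P := by
          rw [lintegral_add_left (by fun_prop), lintegral_add_left (by fun_prop),
            ih (f := fun a => f a * ENNReal.ofReal (a ^ 2)) (by fun_prop)
              (c := fun a => (c a - lam) / a) (by fun_prop),
            h.lintegral_mul_inar hlam hα k (f := fun a => f a * ENNReal.ofReal (a * (1 - a)))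
              (by fun_prop), lintegral_add_left (by fun_prop), lintegral_add_left (by fun_prop)]
      _ = _ := by
          refine lintegral_congr_ae ?_
          filter_upwards [h.ae_mem_Ioo hα] with ω hω
          have h2 : 0 < 1 - α ω := by linarith [hω.2]
          have h3 := hω.1
          rw [mul_assoc, mul_assoc, ← ENNReal.ofReal_mul (by positivity),
            ← ENNReal.ofReal_mul (by positivity), ← mul_add, ← mul_add,
            ← ENNReal.ofReal_add (by positivity) hlam.le,
            ← ENNReal.ofReal_add (by positivity) (by positivity)]
          congr 2
          field_simp
          ring

/-- Each further step of lag replaces the later value by `α X + lam`, which multiplies the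
conditional covariance by `α`. -/
theorem IsDriving.lintegral_mul_inar_mul_inar (h : IsDriving P lam α X₀ ε ξ) (hlam : 0 < lam)
    (hα : ∀ᵐ a ∂P.map α, a ∈ Set.Ioo (0 : ℝ) 1) (j d : ℕ) :
    ∀ {f : ℝ → ℝ≥0∞}, Measurable f →
    ∫⁻ ω, f (α ω) * ENNReal.ofReal (inar X₀ ε ξ j ω * inar X₀ ε ξ (j + d) ω) ∂P
      = ∫⁻ ω, f (α ω) *
        ENNReal.ofReal ((lam / (1 - α ω)) ^ 2 + α ω ^ d * (lam / (1 - α ω))) ∂P := by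
  induction d with
  | zero =>
    intro f hf
    have := h.lintegral_mul_inar_sub_sq hlam hα j hf (c := fun _ => 0) measurable_const
    simpa only [sub_zero, add_zero, pow_zero, one_mul, pow_two] using this
  | succ d ih =>
    intro f hf
    have hαp : Measurable[sigmaOn α (drive X₀ ε ξ) (past (j + d))] α :=
      measurable_param_sigmaOn (none_mem_past _)
    have hjp : Measurable[sigmaOn α (drive X₀ ε ξ) (past (j + d))] (inar X₀ ε ξ j) :=
      (measurable_inar_past j).mono (sigmaOn_mono (past_mono (Nat.le_add_right j d))) le_rfl
    have hF : Measurable[sigmaOn α (drive X₀ ε ξ) (past (j + d))]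
        fun ω => f (α ω) * ENNReal.ofReal (inar X₀ ε ξ j ω) :=
      (hf.comp hαp).mul ((Measurable.of_discrete (f := fun y : ℕ => ENNReal.ofReal y)).comp hjp)
    have h1 := h.lintegral_succ hlam hα (j + d) hF
      (g := fun _ y => ENNReal.ofReal y) fun y => measurable_const
    have hXm := h.measurable_inar
    have hαm := h.measurable_param
    have hj := hXm j
    have hd := hXm (j + d)
    calc _ = ∫⁻ ω, f (α ω) * ENNReal.ofReal (inar X₀ ε ξ j ω) *
            ENNReal.ofReal (inar X₀ ε ξ (j + d + 1) ω) ∂P := by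
          refine lintegral_congr fun ω => ?_
          rw [mul_assoc, ← ENNReal.ofReal_mul (Nat.cast_nonneg _)]
          rfl
      _ = _ := h1
      _ = ∫⁻ ω, (f (α ω) * ENNReal.ofReal (α ω) *
              ENNReal.ofReal (inar X₀ ε ξ j ω * inar X₀ ε ξ (j + d) ω) +
            f (α ω) * ENNReal.ofReal lam * ENNReal.ofReal (inar X₀ ε ξ j ω)) ∂P := by
          refine lintegral_congr_ae ?_
          filter_upwards [h.ae_mem_Ioo hα] with ω hω
          have := stepInt_add hlam hω (inar X₀ ε ξ (j + d) ω) le_rfl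
          simp only [add_zero] at this
          rw [this, ENNReal.ofReal_add (mul_nonneg hω.1.le (Nat.cast_nonneg _)) hlam.le,
            ENNReal.ofReal_mul hω.1.le, ENNReal.ofReal_mul (Nat.cast_nonneg _)]
          ring
      _ = ∫⁻ ω, (f (α ω) * ENNReal.ofReal (α ω) *
              ENNReal.ofReal ((lam / (1 - α ω)) ^ 2 + α ω ^ d * (lam / (1 - α ω))) +
            f (α ω) * ENNReal.ofReal lam * ENNReal.ofReal (lam / (1 - α ω))) ∂P := by
          rw [lintegral_add_left (by fun_prop),
            ih (f := fun a => f a * ENNReal.ofReal a) (by fun_prop),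
            h.lintegral_mul_inar hlam hα j (f := fun a => f a * ENNReal.ofReal lam) (by fun_prop),
            lintegral_add_left (by fun_prop)]
      _ = _ := by
          refine lintegral_congr_ae ?_
          filter_upwards [h.ae_mem_Ioo hα] with ω hω
          have h2 : 0 < 1 - α ω := by linarith [hω.2]
          have h3 := hω.1
          rw [mul_assoc, mul_assoc, ← ENNReal.ofReal_mul h3.le, ← ENNReal.ofReal_mul hlam.le,
            ← mul_add, ← ENNReal.ofReal_add (by positivity) (by positivity)]
          congr 2
          rw [pow_succ]
          field_simp
          ring

end Moments

end

noncomputable section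

/-! ### Deviations from the conditional mean -/

theorem integrable_and_integral_eq_of_lintegral_eq {Ω : Type*} [MeasurableSpace Ω] {P : Measure Ω}
    {F G : Ω → ℝ} (hF : AEStronglyMeasurable F P) (hG : Integrable G P) (hF0 : 0 ≤ᵐ[P] F)
    (hG0 : 0 ≤ᵐ[P] G) (h : ∫⁻ ω, ENNReal.ofReal (F ω) ∂P = ∫⁻ ω, ENNReal.ofReal (G ω) ∂P) :
    Integrable F P ∧ ∫ ω, F ω ∂P = ∫ ω, G ω ∂P := by
  constructor
  · refine ⟨hF, ?_⟩
    rw [hasFiniteIntegral_iff_ofReal hF0, h, ← hasFiniteIntegral_iff_ofReal hG0]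
    exact hG.2
  · rw [integral_eq_lintegral_of_nonneg_ae hF0 hF,
      integral_eq_lintegral_of_nonneg_ae hG0 hG.aestronglyMeasurable, h]

/-- With truncated subtraction the exponent is `|k - j|`. On either side of `j` it is injective in
`k`, so each half is at most the full geometric series. -/
theorem sum_pow_dist_le {a : ℝ} (ha : a ∈ Set.Ioo (0 : ℝ) 1) (s : Finset ℕ) (j : ℕ) :
    (1 - a) * ∑ k ∈ s, a ^ ((k - j) + (j - k)) ≤ 2 := by
  have h1 : 0 < 1 - a := by linarith [ha.2]
  have hs := summable_geometric_of_lt_one ha.1.le ha.2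
  have hinj : ∀ (t : Finset ℕ) (f : ℕ → ℕ), Set.InjOn f t →
      ∑ k ∈ t, a ^ f k ≤ (1 - a)⁻¹ := by
    intro t f hf
    classical
    rw [← Finset.sum_image (f := fun d => a ^ d) hf, ← tsum_geometric_of_lt_one ha.1.le ha.2]
    exact hs.sum_le_tsum _ fun d _ => pow_nonneg ha.1.le d
  have key : ∑ k ∈ s, a ^ ((k - j) + (j - k)) ≤ (1 - a)⁻¹ + (1 - a)⁻¹ := by
    rw [← Finset.sum_filter_add_sum_filter_not s (fun k => j ≤ k)]
    refine add_le_add (hinj _ _ ?_) (hinj _ _ ?_)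
    · intro x hx y hy h
      simp only [Finset.coe_filter, Set.mem_ofPred_eq] at hx hy h
      omega
    · intro x hx y hy h
      simp only [Finset.coe_filter, Set.mem_ofPred_eq] at hx hy h
      omega
  calc _ ≤ (1 - a) * ((1 - a)⁻¹ + (1 - a)⁻¹) := by gcongr
    _ = 2 := by field_simp; norm_num

section Deviation

variable {Ω : Type*} [mΩ : MeasurableSpace Ω] {P : Measure Ω} {lam : ℝ}
  {α : Ω → ℝ} {X₀ : Ω → ℕ} {ε : ℕ → Ω → ℕ} {ξ : ℕ → ℕ → Ω → ℕ}

/-- The deviation of the process from its conditional mean. -/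
def dev (lam : ℝ) (α : Ω → ℝ) (X₀ : Ω → ℕ) (ε : ℕ → Ω → ℕ) (ξ : ℕ → ℕ → Ω → ℕ) (k : ℕ) (ω : Ω) : ℝ :=
  inar X₀ ε ξ k ω - lam / (1 - α ω)

theorem IsDriving.measurable_inar_real (h : IsDriving P lam α X₀ ε ξ) (k : ℕ) :
    Measurable fun ω => (inar X₀ ε ξ k ω : ℝ) :=
  (Measurable.of_discrete (f := fun y : ℕ => (y : ℝ))).comp (h.measurable_inar k)

theorem IsDriving.measurable_dev (h : IsDriving P lam α X₀ ε ξ) (k : ℕ) :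
    Measurable (dev lam α X₀ ε ξ k) := by
  have := h.measurable_inar_real k
  have := h.measurable_param
  unfold dev; fun_prop

/-- Square integrable functions that are conditionally centred given the parameter. -/
structure CondCentred (P : Measure Ω) (α : Ω → ℝ) (U : Ω → ℝ) : Prop where
  memLp : MemLp U 2 P
  integral_mul : ∀ g : ℝ → ℝ, Measurable g → (∀ a, |g a| ≤ 1) → ∫ ω, g (α ω) * U ω ∂P = 0

theorem CondCentred.const_mul {U : Ω → ℝ} (hU : CondCentred P α U) (c : ℝ) :
    CondCentred P α fun ω => c * U ω := by
  refine ⟨hU.memLp.const_mul c, fun g hg hg1 => ?_⟩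
  have e : ∀ ω, g (α ω) * (c * U ω) = c * (g (α ω) * U ω) := fun ω => by ring
  simp only [e]
  rw [integral_const_mul, hU.integral_mul g hg hg1, mul_zero]

variable [IsProbabilityMeasure P]

theorem IsDriving.integrable_inar (h : IsDriving P lam α X₀ ε ξ) (hlam : 0 < lam)
    (hα : ∀ᵐ a ∂P.map α, a ∈ Set.Ioo (0 : ℝ) 1)
    (k : ℕ) {f : ℝ → ℝ} (hf : Measurable f)
    (hf0 : ∀ a ∈ Set.Ioo (0 : ℝ) 1, 0 ≤ f a)
    (hfW : Integrable (fun ω => f (α ω) * (lam / (1 - α ω))) P) :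
    Integrable (fun ω => f (α ω) * (inar X₀ ε ξ k ω : ℝ)) P ∧
      ∫ ω, f (α ω) * (inar X₀ ε ξ k ω : ℝ) ∂P = ∫ ω, f (α ω) * (lam / (1 - α ω)) ∂P := by
  have hαm := h.measurable_param
  have hX := h.measurable_inar_real k
  refine integrable_and_integral_eq_of_lintegral_eq (Measurable.aestronglyMeasurable (by fun_prop))
    hfW ?_ ?_ ?_
  · filter_upwards [h.ae_mem_Ioo hα] with ω hω
    exact mul_nonneg (hf0 _ hω) (Nat.cast_nonneg _)
  · filter_upwards [h.ae_mem_Ioo hα] with ω hω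
    exact mul_nonneg (hf0 _ hω) (div_nonneg hlam.le (by linarith [hω.2]))
  · have := h.lintegral_mul_inar hlam hα k (f := fun a => ENNReal.ofReal (f a)) (by fun_prop)
    refine Eq.trans (lintegral_congr_ae ?_) (this.trans (lintegral_congr_ae ?_))
    · filter_upwards [h.ae_mem_Ioo hα] with ω hω
      rw [ENNReal.ofReal_mul (hf0 _ hω)]
    · filter_upwards [h.ae_mem_Ioo hα] with ω hω
      rw [ENNReal.ofReal_mul (hf0 _ hω)]

theorem IsDriving.integrable_dev_sq (h : IsDriving P lam α X₀ ε ξ) (hlam : 0 < lam)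
    (hα : ∀ᵐ a ∂P.map α, a ∈ Set.Ioo (0 : ℝ) 1)
    (hW : Integrable (fun ω => lam / (1 - α ω)) P) (k : ℕ) :
    Integrable (fun ω => dev lam α X₀ ε ξ k ω ^ 2) P := by
  have hαm := h.measurable_param
  refine (integrable_and_integral_eq_of_lintegral_eq
    ((h.measurable_dev k).pow_const 2).aestronglyMeasurable hW (ae_of_all _ fun ω => sq_nonneg _)
    ?_ ?_).1
  · filter_upwards [h.ae_mem_Ioo hα] with ω hω
    exact div_nonneg hlam.le (by linarith [hω.2])
  · have := h.lintegral_mul_inar_sub_sq hlam hα k (f := fun _ => 1) measurable_const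
      (c := fun a => lam / (1 - a)) (by fun_prop)
    simpa [dev] using this

theorem IsDriving.memLp_dev (h : IsDriving P lam α X₀ ε ξ) (hlam : 0 < lam)
    (hα : ∀ᵐ a ∂P.map α, a ∈ Set.Ioo (0 : ℝ) 1)
    (hW : Integrable (fun ω => lam / (1 - α ω)) P) (k : ℕ) :
    MemLp (dev lam α X₀ ε ξ k) 2 P :=
  (memLp_two_iff_integrable_sq (h.measurable_dev k).aestronglyMeasurable).2
    (h.integrable_dev_sq hlam hα hW k)

theorem IsDriving.integral_mul_dev (h : IsDriving P lam α X₀ ε ξ) (hlam : 0 < lam)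
    (hα : ∀ᵐ a ∂P.map α, a ∈ Set.Ioo (0 : ℝ) 1)
    (hW : Integrable (fun ω => lam / (1 - α ω)) P) (k : ℕ) {g : ℝ → ℝ} (hg : Measurable g)
    (hg1 : ∀ a, |g a| ≤ 1) :
    ∫ ω, g (α ω) * dev lam α X₀ ε ξ k ω ∂P = 0 := by
  have hαm := h.measurable_param
  -- The moment identities are stated for nonnegative weights, so the signed `g` is written as `(g +
  -- 1) - 1`.
  have key : ∀ f : ℝ → ℝ, Measurable f → (∀ a, 0 ≤ f a) → (∀ a, f a ≤ 2) →
      Integrable (fun ω => f (α ω) * dev lam α X₀ ε ξ k ω) P ∧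
        ∫ ω, f (α ω) * dev lam α X₀ ε ξ k ω ∂P = 0 := by
    intro f hf hf0 hf2
    have hfW : Integrable (fun ω => f (α ω) * (lam / (1 - α ω))) P :=
      hW.bdd_mul (c := 2) (hf.comp hαm).aestronglyMeasurable (ae_of_all _ fun ω => by
        rw [Real.norm_of_nonneg (hf0 _)]; exact hf2 _)
    obtain ⟨h1, h2⟩ := h.integrable_inar hlam hα k hf (fun a _ => hf0 a) hfW
    have e : ∀ ω, f (α ω) * dev lam α X₀ ε ξ k ω
        = f (α ω) * (inar X₀ ε ξ k ω : ℝ) - f (α ω) * (lam / (1 - α ω)) := by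
      intro ω; rw [dev]; ring
    simp only [e]
    exact ⟨h1.sub hfW, by rw [integral_sub h1 hfW, h2, sub_self]⟩
  obtain ⟨i1, e1⟩ := key (fun a => g a + 1) (by fun_prop)
    (fun a => by linarith [(abs_le.1 (hg1 a)).1]) (fun a => by linarith [(abs_le.1 (hg1 a)).2])
  obtain ⟨i2, e2⟩ := key (fun _ => 1) (by fun_prop) (fun a => by norm_num) (fun a => by norm_num)
  have e : ∀ ω, g (α ω) * dev lam α X₀ ε ξ k ω
      = (g (α ω) + 1) * dev lam α X₀ ε ξ k ω - 1 * dev lam α X₀ ε ξ k ω := by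
    intro ω; ring
  simp only [e]
  rw [integral_sub i1 i2, e1, e2, sub_self]

theorem IsDriving.condCentred_dev (h : IsDriving P lam α X₀ ε ξ) (hlam : 0 < lam)
    (hα : ∀ᵐ a ∂P.map α, a ∈ Set.Ioo (0 : ℝ) 1)
    (hW : Integrable (fun ω => lam / (1 - α ω)) P) (k : ℕ) :
    CondCentred P α (dev lam α X₀ ε ξ k) :=
  ⟨h.memLp_dev hlam hα hW k, fun _ hg hg1 => h.integral_mul_dev hlam hα hW k hg hg1⟩

theorem CondCentred.integrable_mul {U : Ω → ℝ} (hU : CondCentred P α U) (hα : Measurable α)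
    {g : ℝ → ℝ} (hg : Measurable g) (hg1 : ∀ a, |g a| ≤ 1) :
    Integrable (fun ω => g (α ω) * U ω) P :=
  (hU.memLp.integrable (by norm_num)).bdd_mul (c := 1) (hg.comp hα).aestronglyMeasurable
    (ae_of_all _ fun ω => hg1 _)

theorem CondCentred.sum {ι : Type*} {s : Finset ι} {U : ι → Ω → ℝ} (hα : Measurable α)
    (hU : ∀ i ∈ s, CondCentred P α (U i)) : CondCentred P α fun ω => ∑ i ∈ s, U i ω := by
  refine ⟨memLp_finsetSum s fun i hi => (hU i hi).memLp, fun g hg hg1 => ?_⟩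
  simp only [Finset.mul_sum]
  rw [integral_finsetSum s fun i hi => (hU i hi).integrable_mul hα hg hg1]
  exact Finset.sum_eq_zero fun i hi => (hU i hi).integral_mul g hg hg1

/-- A conditionally centred perturbation changes a characteristic function by `O(s ^ 2)`. -/
theorem CondCentred.norm_integral_cexp_sub_le {U : Ω → ℝ} (hU : CondCentred P α U)
    (hα : Measurable α) {V : ℝ → ℝ} (hV : Measurable V) (s : ℝ) :
    ‖∫ ω, Complex.exp (Complex.I * (s * U ω + V (α ω) : ℝ)) ∂P
      - ∫ ω, Complex.exp (Complex.I * (V (α ω) : ℝ)) ∂P‖ ≤ 3 * s ^ 2 * ∫ ω, U ω ^ 2 ∂P := by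
  have hUm := hU.memLp.aestronglyMeasurable.aemeasurable
  have hbd : ∀ f : Ω → ℝ, AEMeasurable f P →
      Integrable (fun ω => Complex.exp (Complex.I * (f ω : ℝ))) P := by
    intro f hf
    refine Integrable.of_bound (C := 1) (AEMeasurable.aestronglyMeasurable (by fun_prop))
      (ae_of_all _ fun ω => ?_)
    rw [mul_comm, Complex.norm_exp_ofReal_mul_I]
  have h1 := hbd (fun ω => s * U ω + V (α ω)) (by fun_prop)
  have h2 := hbd (fun ω => V (α ω)) (by fun_prop)
  have hsq : Integrable (fun ω => U ω ^ 2) P := hU.memLp.integrable_sq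
  -- the linear term vanishes
  have hcos := hU.integrable_mul hα (g := fun a => Real.cos (V a)) (by fun_prop)
    (fun a => Real.abs_cos_le_one _)
  have hsin := hU.integrable_mul hα (g := fun a => Real.sin (V a)) (by fun_prop)
    (fun a => Real.abs_sin_le_one _)
  have hcos0 := hU.integral_mul (fun a => Real.cos (V a)) (by fun_prop)
    (fun a => Real.abs_cos_le_one _)
  have hsin0 := hU.integral_mul (fun a => Real.sin (V a)) (by fun_prop)
    (fun a => Real.abs_sin_le_one _)
  have hlin : ∀ ω, Complex.exp (Complex.I * (V (α ω) : ℝ)) * (U ω : ℂ)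
      = ((Real.cos (V (α ω)) * U ω : ℝ) : ℂ) + Complex.I * ((Real.sin (V (α ω)) * U ω : ℝ) : ℂ) := by
    intro ω
    rw [mul_comm Complex.I, Complex.exp_mul_I]
    push_cast; ring
  have hlinI : Integrable (fun ω => Complex.exp (Complex.I * (V (α ω) : ℝ)) * (U ω : ℂ)) P := by
    simp only [hlin]
    exact hcos.ofReal.add (hsin.ofReal.const_mul _)
  have hlin0 : ∫ ω, Complex.exp (Complex.I * (V (α ω) : ℝ)) * (U ω : ℂ) ∂P = 0 := by
    simp only [hlin]
    rw [integral_add hcos.ofReal (hsin.ofReal.const_mul _), integral_const_mul,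
      integral_complex_ofReal, integral_complex_ofReal, hcos0, hsin0]
    simp
  -- Expansion of `e^{isU}` to first order; the linear term is tested against `e^{iV}`, a bounded
  -- function of the parameter, and drops out by conditional centring.
  have e : ∀ ω, Complex.exp (Complex.I * (V (α ω) : ℝ)) * expTail (Complex.I * (s * U ω : ℝ))
      = (Complex.exp (Complex.I * (s * U ω + V (α ω) : ℝ)) - Complex.exp (Complex.I * (V (α ω) : ℝ)))
        - Complex.I * s * (Complex.exp (Complex.I * (V (α ω) : ℝ)) * (U ω : ℂ)) := by
    intro ω
    have : Complex.I * (s * U ω + V (α ω) : ℝ)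
        = Complex.I * (V (α ω) : ℝ) + Complex.I * (s * U ω : ℝ) := by push_cast; ring
    rw [this, Complex.exp_add, expTail]
    push_cast; ring
  have hmain : ∫ ω, Complex.exp (Complex.I * (s * U ω + V (α ω) : ℝ)) ∂P
      - ∫ ω, Complex.exp (Complex.I * (V (α ω) : ℝ)) ∂P
      = ∫ ω, Complex.exp (Complex.I * (V (α ω) : ℝ)) * expTail (Complex.I * (s * U ω : ℝ)) ∂P := by
    simp only [e]
    have e1 := integral_sub (h1.sub h2) (hlinI.const_mul (Complex.I * s))
    rw [integral_const_mul, hlin0, mul_zero, sub_zero] at e1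
    exact ((integral_sub h1 h2).symm.trans e1.symm)
  rw [hmain, ← integral_const_mul]
  refine norm_integral_le_of_norm_le (hsq.const_mul _) (ae_of_all _ fun ω => ?_)
  rw [norm_mul, mul_comm Complex.I (V (α ω) : ℂ), Complex.norm_exp_ofReal_mul_I, one_mul]
  refine (norm_expTail_I_mul_le_sq _).trans (le_of_eq ?_)
  ring

/-- The product `X_j X_{j+d}` need not be integrable, since `W ^ 2` need not be. The weight `(1 - α)
^ 2` makes every conditional moment in the expansion bounded. -/
theorem IsDriving.integral_sq_mul_dev_mul_dev_add (h : IsDriving P lam α X₀ ε ξ) (hlam : 0 < lam)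
    (hα : ∀ᵐ a ∂P.map α, a ∈ Set.Ioo (0 : ℝ) 1)
    (j d : ℕ) :
    Integrable (fun ω => (1 - α ω) ^ 2 * (dev lam α X₀ ε ξ j ω * dev lam α X₀ ε ξ (j + d) ω)) P ∧
    ∫ ω, (1 - α ω) ^ 2 * (dev lam α X₀ ε ξ j ω * dev lam α X₀ ε ξ (j + d) ω) ∂P
      = ∫ ω, lam * ((1 - α ω) * α ω ^ d) ∂P := by
  have hαm := h.measurable_param
  have hX := h.measurable_inar_real
  have hXj := hX j
  have hXd := hX (j + d)
  have hae := h.ae_mem_Ioo hα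
  have hd : Integrable (fun ω => lam * ((1 - α ω) * α ω ^ d)) P := by
    refine Integrable.of_bound (C := lam) (Measurable.aestronglyMeasurable (by fun_prop)) ?_
    filter_upwards [hae] with ω hω
    have h1 : 0 ≤ 1 - α ω := by linarith [hω.2]
    have h2 := hω.1.le
    rw [Real.norm_of_nonneg (by positivity)]
    have h3 : (1 - α ω) * α ω ^ d ≤ 1 := mul_le_one₀ (by linarith) (by positivity)
      (pow_le_one₀ h2 hω.2.le)
    nlinarith
  have hG : Integrable (fun ω => lam ^ 2 + lam * ((1 - α ω) * α ω ^ d)) P :=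
    (integrable_const _).add hd
  obtain ⟨i1, e1⟩ := integrable_and_integral_eq_of_lintegral_eq
    (F := fun ω => (1 - α ω) ^ 2 * (inar X₀ ε ξ j ω * inar X₀ ε ξ (j + d) ω : ℝ))
    (Measurable.aestronglyMeasurable (by fun_prop)) hG
    (ae_of_all _ fun ω => by positivity)
    (by
      filter_upwards [hae] with ω hω
      have h1 : 0 ≤ 1 - α ω := by linarith [hω.2]
      have h2 := hω.1.le
      positivity)
    (by
      have := h.lintegral_mul_inar_mul_inar hlam hα j d
        (f := fun a => ENNReal.ofReal ((1 - a) ^ 2)) (by fun_prop)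
      refine Eq.trans (lintegral_congr fun ω => ?_) (this.trans (lintegral_congr_ae ?_))
      · rw [ENNReal.ofReal_mul (sq_nonneg _)]
      · filter_upwards [hae] with ω hω
        have h1 : 0 < 1 - α ω := by linarith [hω.2]
        rw [← ENNReal.ofReal_mul (sq_nonneg _)]
        congr 1
        field_simp)
  have hlin : ∀ k, Integrable (fun ω => lam * (1 - α ω) * (inar X₀ ε ξ k ω : ℝ)) P ∧
      ∫ ω, lam * (1 - α ω) * (inar X₀ ε ξ k ω : ℝ) ∂P = ∫ _, lam ^ 2 ∂P := by
    intro k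
    have hc : (fun ω => lam * (1 - α ω) * (lam / (1 - α ω))) =ᵐ[P] fun _ => lam ^ 2 := by
      filter_upwards [hae] with ω hω
      have h1 : 0 < 1 - α ω := by linarith [hω.2]
      field_simp
    have := h.integrable_inar hlam hα k (f := fun a => lam * (1 - a)) (by fun_prop)
      (fun a ha => mul_nonneg hlam.le (by linarith [ha.2]))
      ((integrable_congr hc).2 (integrable_const _))
    exact ⟨this.1, this.2.trans (integral_congr_ae hc)⟩
  obtain ⟨i2, e2⟩ := hlin j
  obtain ⟨i3, e3⟩ := hlin (j + d)
  have i4 : Integrable (fun _ : Ω => lam ^ 2) P := integrable_const _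
  have e : (fun ω => (1 - α ω) ^ 2 * (dev lam α X₀ ε ξ j ω * dev lam α X₀ ε ξ (j + d) ω)) =ᵐ[P]
      fun ω => (1 - α ω) ^ 2 * (inar X₀ ε ξ j ω * inar X₀ ε ξ (j + d) ω : ℝ)
        - lam * (1 - α ω) * (inar X₀ ε ξ j ω : ℝ) - lam * (1 - α ω) * (inar X₀ ε ξ (j + d) ω : ℝ)
        + lam ^ 2 := by
    filter_upwards [hae] with ω hω
    have h1 : 0 < 1 - α ω := by linarith [hω.2]
    simp only [dev]
    field_simp
    ring
  refine ⟨(integrable_congr e).2 (((i1.sub i2).sub i3).add i4), ?_⟩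
  have a1 := integral_add ((i1.sub i2).sub i3) i4
  have a2 := integral_sub (i1.sub i2) i3
  have a3 := integral_sub i1 i2
  have a4 := integral_add i4 hd
  simp only [Pi.sub_apply] at a1 a2
  rw [integral_congr_ae e, a1, a2, a3, e1, e2, e3, a4]
  ring

theorem IsDriving.integral_sq_mul_dev_mul_dev (h : IsDriving P lam α X₀ ε ξ) (hlam : 0 < lam)
    (hα : ∀ᵐ a ∂P.map α, a ∈ Set.Ioo (0 : ℝ) 1)
    (j k : ℕ) :
    Integrable (fun ω => (1 - α ω) ^ 2 * (dev lam α X₀ ε ξ j ω * dev lam α X₀ ε ξ k ω)) P ∧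
    ∫ ω, (1 - α ω) ^ 2 * (dev lam α X₀ ε ξ j ω * dev lam α X₀ ε ξ k ω) ∂P
      = ∫ ω, lam * ((1 - α ω) * α ω ^ ((k - j) + (j - k))) ∂P := by
  rcases le_total j k with hjk | hjk
  · obtain ⟨d, rfl⟩ := Nat.exists_eq_add_of_le hjk
    have e : (j + d - j) + (j - (j + d)) = d := by omega
    rw [e]
    exact h.integral_sq_mul_dev_mul_dev_add hlam hα j d
  · obtain ⟨d, rfl⟩ := Nat.exists_eq_add_of_le hjk
    have e : (k - (k + d)) + (k + d - k) = d := by omega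
    rw [e]
    simp only [mul_comm (dev lam α X₀ ε ξ (k + d) _)]
    exact h.integral_sq_mul_dev_mul_dev_add hlam hα k d

/-- In the expanded square every row has weighted covariances `lam (1 - α) ∑ α ^ |k - j| ≤ 2 lam`,
so the bound is linear in the number of terms. This is the variance estimate behind the conditional
law of large numbers. -/
theorem IsDriving.integral_sq_mul_sum_dev_le (h : IsDriving P lam α X₀ ε ξ) (hlam : 0 < lam)
    (hα : ∀ᵐ a ∂P.map α, a ∈ Set.Ioo (0 : ℝ) 1)
    (s : Finset ℕ) :
    Integrable (fun ω => (1 - α ω) ^ 2 * (∑ k ∈ s, dev lam α X₀ ε ξ k ω) ^ 2) P ∧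
    ∫ ω, (1 - α ω) ^ 2 * (∑ k ∈ s, dev lam α X₀ ε ξ k ω) ^ 2 ∂P ≤ 2 * lam * s.card := by
  have hαm := h.measurable_param
  have hae := h.ae_mem_Ioo hα
  have e : ∀ ω, (1 - α ω) ^ 2 * (∑ k ∈ s, dev lam α X₀ ε ξ k ω) ^ 2
      = ∑ j ∈ s, ∑ k ∈ s, (1 - α ω) ^ 2 * (dev lam α X₀ ε ξ j ω * dev lam α X₀ ε ξ k ω) := by
    intro ω
    rw [pow_two (∑ k ∈ s, _), Finset.sum_mul_sum, Finset.mul_sum]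
    refine Finset.sum_congr rfl fun j _ => ?_
    rw [Finset.mul_sum]
  have hI := fun j k => (h.integral_sq_mul_dev_mul_dev hlam hα j k).1
  have hdI : ∀ j k : ℕ, Integrable (fun ω => lam * ((1 - α ω) * α ω ^ ((k - j) + (j - k)))) P := by
    intro j k
    refine Integrable.of_bound (C := lam) (Measurable.aestronglyMeasurable (by fun_prop)) ?_
    filter_upwards [hae] with ω hω
    have h1 : 0 ≤ 1 - α ω := by linarith [hω.2]
    have h2 := hω.1.le
    rw [Real.norm_of_nonneg (by positivity)]
    have h3 : (1 - α ω) * α ω ^ ((k - j) + (j - k)) ≤ 1 := mul_le_one₀ (by linarith) (by positivity)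
      (pow_le_one₀ h2 hω.2.le)
    nlinarith
  simp only [e]
  refine ⟨integrable_finsetSum _ fun j _ => integrable_finsetSum _ fun k _ => hI j k, ?_⟩
  rw [integral_finsetSum _ fun j _ => integrable_finsetSum _ fun k _ => hI j k]
  calc _ = ∑ j ∈ s, ∫ ω, lam * ((1 - α ω) * ∑ k ∈ s, α ω ^ ((k - j) + (j - k))) ∂P := by
        refine Finset.sum_congr rfl fun j _ => ?_
        simp only [Finset.mul_sum]
        rw [integral_finsetSum _ fun k _ => hI j k, integral_finsetSum _ fun k _ => hdI j k]
        exact Finset.sum_congr rfl fun k _ => (h.integral_sq_mul_dev_mul_dev hlam hα j k).2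
    _ ≤ ∑ j ∈ s, 2 * lam := by
        refine Finset.sum_le_sum fun j _ => ?_
        have hle : (fun ω => lam * ((1 - α ω) * ∑ k ∈ s, α ω ^ ((k - j) + (j - k))))
            ≤ᵐ[P] fun _ => 2 * lam := by
          filter_upwards [hae] with ω hω
          nlinarith [sum_pow_dist_le hω s j]
        refine (integral_mono_ae ?_ (integrable_const _) hle).trans (by simp)
        simp only [Finset.mul_sum]
        exact integrable_finsetSum _ fun k _ => hdI j k
    _ = _ := by rw [Finset.sum_const, nsmul_eq_mul]; ring

/-- Perturbations that vanish in the weighted mean square sense do not change the limit of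
characteristic functions. -/
theorem tendsto_integral_cexp_sub_of_weighted_sq {B : Ω → ℝ} (hB : Measurable B)
    (hB0 : ∀ᵐ ω ∂P, 0 < B ω) {V R : ℕ → Ω → ℝ} (hV : ∀ n, AEMeasurable (V n) P)
    (hR : ∀ n, AEMeasurable (R n) P) {K : ℝ}
    (hint : ∀ n, Integrable (fun ω => B ω ^ 2 * V n ω ^ 2) P)
    (hle : ∀ n : ℕ, 0 < n → ∫ ω, B ω ^ 2 * V n ω ^ 2 ∂P ≤ K / n) :
    Tendsto (fun n => ∫ ω, Complex.exp (Complex.I * (V n ω + R n ω : ℝ)) ∂P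
      - ∫ ω, Complex.exp (Complex.I * (R n ω : ℝ)) ∂P) atTop (𝓝 0) := by
  have hbd : ∀ f : Ω → ℝ, AEMeasurable f P →
      Integrable (fun ω => Complex.exp (Complex.I * (f ω : ℝ))) P := by
    intro f hf
    refine Integrable.of_bound (C := 1) (AEMeasurable.aestronglyMeasurable (by fun_prop))
      (ae_of_all _ fun ω => ?_)
    rw [mul_comm, Complex.norm_exp_ofReal_mul_I]
  -- `|e^{iV} - 1|` is at most `2` and at most `2 |V| ≤ √n B ^ 2 V ^ 2 + 1 / (√n B ^ 2)`. With the
  -- weight `√n` the first term integrates to at most `K / √n`, while the second, truncated at `2`,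
  -- vanishes by dominated convergence although `1 / B ^ 2` need not be integrable.
  let T : ℕ → Ω → ℝ := fun n ω => min 2 ((√n * B ω ^ 2)⁻¹)
  have hTm : ∀ n, Measurable (T n) := fun n => by fun_prop
  have hTb : ∀ n, ∀ ω, ‖T n ω‖ ≤ 2 := by
    intro n ω
    rw [Real.norm_of_nonneg (le_min (by norm_num) (by positivity))]
    exact min_le_left _ _
  have hTI : ∀ n, Integrable (T n) P := fun n =>
    Integrable.of_bound (hTm n).aestronglyMeasurable 2 (ae_of_all _ (hTb n))
  have hbound : ∀ n : ℕ, 0 < n → ‖∫ ω, Complex.exp (Complex.I * (V n ω + R n ω : ℝ)) ∂P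
      - ∫ ω, Complex.exp (Complex.I * (R n ω : ℝ)) ∂P‖ ≤ √n * (K / n) + ∫ ω, T n ω ∂P := by
    intro n hn
    have hsn : 0 < √(n : ℝ) := Real.sqrt_pos.2 (by exact_mod_cast hn)
    rw [← integral_sub (hbd (fun ω => V n ω + R n ω) ((hV n).add (hR n))) (hbd _ (hR n))]
    calc _ ≤ ∫ ω, (√n * (B ω ^ 2 * V n ω ^ 2) + T n ω) ∂P := by
          refine norm_integral_le_of_norm_le (((hint n).const_mul _).add (hTI n)) ?_
          filter_upwards [hB0] with ω hω
          have e1 : Complex.exp (Complex.I * (V n ω + R n ω : ℝ)) - Complex.exp (Complex.I * (R n ω : ℝ))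
              = Complex.exp (Complex.I * (R n ω : ℝ)) * (Complex.exp (Complex.I * (V n ω : ℝ)) - 1) := by
            rw [mul_sub, ← Complex.exp_add, mul_one]
            congr 2; push_cast; ring
          rw [e1, norm_mul, mul_comm Complex.I (R n ω : ℂ), Complex.norm_exp_ofReal_mul_I, one_mul]
          have b1 := norm_exp_sub_one_le_two (w := Complex.I * (V n ω : ℝ)) (by simp)
          have b2 : ‖Complex.exp (Complex.I * (V n ω : ℝ)) - 1‖ ≤ 2 * |V n ω| := by
            simpa using norm_exp_sub_one_le (w := Complex.I * (V n ω : ℝ)) (by simp)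
          have hp : 0 < √n * B ω ^ 2 := by positivity
          have hq : 0 ≤ √n * (B ω ^ 2 * V n ω ^ 2) := by positivity
          rw [← sub_le_iff_le_add']
          refine le_min (by linarith) ?_
          have : 2 * |V n ω| ≤ √n * B ω ^ 2 * V n ω ^ 2 + (√n * B ω ^ 2)⁻¹ := by
            have h1 := sq_nonneg (√n * B ω ^ 2 * |V n ω| - 1)
            have h2 : (√n * B ω ^ 2 * |V n ω| - 1) ^ 2
                = (√n * B ω ^ 2) * (√n * B ω ^ 2 * V n ω ^ 2 + (√n * B ω ^ 2)⁻¹ - 2 * |V n ω|) := by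
              rw [← sq_abs (V n ω)]
              field_simp
              ring
            rw [h2] at h1
            have := nonneg_of_mul_nonneg_right h1 hp
            linarith
          nlinarith
      _ = √n * ∫ ω, B ω ^ 2 * V n ω ^ 2 ∂P + ∫ ω, T n ω ∂P := by
          rw [integral_add ((hint n).const_mul _) (hTI n), integral_const_mul]
      _ ≤ _ := by gcongr; exact hle n hn
  refine squeeze_zero_norm' (a := fun n : ℕ => √n * (K / n) + ∫ ω, T n ω ∂P) ?_ ?_
  · filter_upwards [eventually_gt_atTop 0] with n hn using hbound n hn
  · have hs : Tendsto (fun n : ℕ => √(n : ℝ)) atTop atTop :=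
      Real.tendsto_sqrt_atTop.comp tendsto_natCast_atTop_atTop
    have t1 : Tendsto (fun n : ℕ => √n * (K / n)) atTop (𝓝 0) := by
      have := (tendsto_inv_atTop_zero.comp hs).const_mul K
      rw [mul_zero] at this
      refine this.congr' ?_
      filter_upwards [eventually_gt_atTop 0] with n hn
      have hn' : (0 : ℝ) < n := by exact_mod_cast hn
      have hsn : 0 < √(n : ℝ) := Real.sqrt_pos.2 hn'
      simp only [Function.comp_apply]
      nth_rewrite 3 [← Real.sq_sqrt hn'.le]
      field_simp
    have t2 : Tendsto (fun n : ℕ => ∫ ω, T n ω ∂P) atTop (𝓝 (∫ _, (0 : ℝ) ∂P)) := by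
      refine tendsto_integral_of_dominated_convergence (fun _ => 2)
        (fun n => (hTm n).aestronglyMeasurable) (integrable_const _)
        (fun n => ae_of_all _ (hTb n)) ?_
      filter_upwards [hB0] with ω hω
      have h1 : Tendsto (fun n : ℕ => (√(n : ℝ) * B ω ^ 2)⁻¹) atTop (𝓝 0) :=
        tendsto_inv_atTop_zero.comp (hs.atTop_mul_const (by positivity))
      have h2 := (tendsto_const_nhds (x := (2 : ℝ)) (f := (atTop : Filter ℕ))).min h1
      rwa [min_eq_right (by norm_num)] at h2
    rw [integral_zero] at t2
    simpa using t1.add t2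

end Deviation

end

/-! ### Characteristic functions and sums of independent copies -/

noncomputable section

/-- The characteristic function of a finite family of random variables. -/
theorem charFun_map_toLp {Ω ι : Type*} [Fintype ι] [MeasurableSpace Ω] {P : Measure Ω}
    {X : Ω → ι → ℝ} (hX : AEMeasurable X P) (ξ : EuclideanSpace ℝ ι) :
    charFun (P.map fun ω => WithLp.toLp 2 (X ω)) ξ
      = ∫ ω, Complex.exp (Complex.I * (∑ i, ξ i * X ω i : ℝ)) ∂P := by
  have hm : AEMeasurable (fun ω => WithLp.toLp 2 (X ω)) P :=
    (PiLp.continuous_toLp 2 (fun _ : ι => ℝ)).measurable.comp_aemeasurable hX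
  rw [charFun_apply, integral_map hm (Measurable.aestronglyMeasurable (by fun_prop))]
  refine integral_congr_ae (ae_of_all _ fun ω => ?_)
  simp only [PiLp.inner_apply, RCLike.inner_apply, conj_trivial]
  rw [mul_comm]

/-- **Cramér–Wold device**. -/
theorem tendstoInDistribution_of_tendsto_integral_cexp {ι : Type*} [Fintype ι]
    {Ω : ℕ → Type*} {Ω' : Type*} [∀ n, MeasurableSpace (Ω n)] [MeasurableSpace Ω']
    {P : (n : ℕ) → Measure (Ω n)} [∀ n, IsProbabilityMeasure (P n)]
    {Q : Measure Ω'} [IsProbabilityMeasure Q]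
    {X : (n : ℕ) → Ω n → ι → ℝ} {Z : Ω' → ι → ℝ}
    (hX : ∀ n, AEMeasurable (X n) (P n)) (hZ : AEMeasurable Z Q)
    (h : ∀ ξ : ι → ℝ,
      Tendsto (fun n => ∫ ω, Complex.exp (Complex.I * (∑ i, ξ i * X n ω i : ℝ)) ∂P n) atTop
        (𝓝 (∫ ω, Complex.exp (Complex.I * (∑ i, ξ i * Z ω i : ℝ)) ∂Q))) :
    TendstoInDistribution X atTop Z P Q := by
  have hm : Measurable (WithLp.toLp 2 : (ι → ℝ) → EuclideanSpace ℝ ι) :=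
    (PiLp.continuous_toLp 2 (fun _ : ι => ℝ)).measurable
  have key : TendstoInDistribution (fun n ω => (WithLp.toLp 2 (X n ω) : EuclideanSpace ℝ ι))
      atTop (fun ω => WithLp.toLp 2 (Z ω)) P Q := by
    refine ⟨fun n => hm.comp_aemeasurable (hX n), hm.comp_aemeasurable hZ, ?_⟩
    refine ProbabilityMeasure.tendsto_iff_tendsto_charFun.2 fun ξ => ?_
    simp only [ProbabilityMeasure.coe_mk]
    rw [charFun_map_toLp hZ]
    simp_rw [fun n => charFun_map_toLp (hX n) ξ]
    exact h ξ
  exact key.continuous_comp (PiLp.continuous_ofLp 2 (fun _ : ι => ℝ))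

/-- A continuous limit of characteristic functions is a characteristic function. -/
theorem exists_charFun_eq_of_tendsto {μ : ℕ → ProbabilityMeasure ℝ} {f : ℝ → ℂ}
    (hf : ContinuousAt f 0) (h : ∀ θ, Tendsto (fun n => charFun (μ n : Measure ℝ) θ) atTop (𝓝 (f θ))) :
    ∃ Q : ProbabilityMeasure ℝ, ∀ θ, charFun (Q : Measure ℝ) θ = f θ := by
  -- Continuity of the limit at `0` gives tightness, hence relative compactness by Prokhorov; an
  -- ultrafilter finer than `atTop` then selects a limit point.
  have h_tight : IsTightMeasureSet (𝓧 := ℝ) {(μ n : Measure ℝ) | n} :=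
    isTightMeasureSet_of_tendsto_charFun hf h
  have h_compact : IsCompact (closure {μ n | n}) :=
    isCompact_closure_of_isTightMeasureSet (by simpa using h_tight)
  let U : Ultrafilter ℕ := Ultrafilter.of atTop
  have hU : (U : Filter ℕ) ≤ atTop := Ultrafilter.of_le atTop
  obtain ⟨Q, -, hQ : Tendsto μ U (𝓝 Q)⟩ := h_compact.ultrafilter_le_nhds (U.map μ)
    (.trans (by simp) (monotone_principal subset_closure))
  refine ⟨Q, fun θ => tendsto_nhds_unique ?_ ((h θ).mono_left hU)⟩
  rw [ProbabilityMeasure.tendsto_iff_forall_integral_rclike_tendsto ℂ] at hQ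
  simp_rw [charFun_eq_integral_innerProbChar]
  exact hQ (BoundedContinuousFunction.innerProbChar θ)

/-- The law of the sum of `N` independent variables with law `κ`. -/
def convPow (κ : Measure ℝ) : ℕ → Measure ℝ
  | 0 => Measure.dirac 0
  | N + 1 => Measure.conv (convPow κ N) κ

instance isProbabilityMeasure_convPow (κ : Measure ℝ) [IsProbabilityMeasure κ] (N : ℕ) :
    IsProbabilityMeasure (convPow κ N) := by
  induction N with
  | zero => unfold convPow; infer_instance
  | succ N ih => unfold convPow; infer_instance

theorem charFun_convPow (κ : Measure ℝ) [IsProbabilityMeasure κ] (N : ℕ) (θ : ℝ) :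
    charFun (convPow κ N) θ = charFun κ θ ^ N := by
  induction N with
  | zero => simp [convPow]
  | succ N ih => rw [convPow, charFun_conv, ih, pow_succ]

theorem integral_cexp_eq_charFun {Ω : Type*} [MeasurableSpace Ω] {P : Measure Ω} {U : Ω → ℝ}
    (hU : AEMeasurable U P) (c : ℝ) :
    ∫ ω, Complex.exp (Complex.I * (c * U ω : ℝ)) ∂P = charFun (P.map U) c := by
  rw [charFun_apply_real, integral_map hU (Measurable.aestronglyMeasurable (by fun_prop))]
  simp [mul_comm]

/-- The characteristic function of a sum of independent copies. -/
theorem integral_cexp_sum_eq_pow {Ω Ω₀ E : Type*} [MeasurableSpace Ω] [MeasurableSpace Ω₀]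
    [MeasurableSpace E] {P : Measure Ω} {P₀ : Measure Ω₀}
    {X : ℕ → Ω → E} {Y : Ω₀ → E}
    (hX_indep : iIndepFun X P) (hX_copy : ∀ j, IdentDistrib (X j) Y P P₀)
    {g : E → ℝ} (hg : Measurable g) (N : ℕ) :
    ∫ ω, Complex.exp (Complex.I * (∑ j ∈ Finset.range N, g (X j ω) : ℝ)) ∂P
      = (∫ ω, Complex.exp (Complex.I * (g (Y ω) : ℝ)) ∂P₀) ^ N := by
  have hi : iIndepFun (fun j ω => g (X j ω)) P := hX_indep.comp (fun _ => g) fun _ => hg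
  have hc : ∀ j, IdentDistrib (fun ω => g (X j ω)) (fun ω => g (Y ω)) P P₀ :=
    fun j => (hX_copy j).comp hg
  have e1 := integral_cexp_eq_charFun
    (Finset.aemeasurable_fun_sum (Finset.range N) fun j _ => (hc j).aemeasurable_fst) 1
  have e2 := integral_cexp_eq_charFun (hc 0).aemeasurable_snd 1
  simp only [one_mul] at e1 e2
  rw [e1, e2, (hi.restrict _).charFun_map_fun_finsetSum_eq_prod
    (fun j _ => (hc j).aemeasurable_fst)]
  simp [fun j => (hc j).map_eq]

end

/-! ### The stable limit law and the sums of conditional means -/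

noncomputable section

variable {lam β ψ₁ : ℝ}

theorem sign_mul_of_pos {A : ℝ} (hA : 0 < A) (θ : ℝ) : Real.sign (A * θ) = Real.sign θ := by
  rcases lt_trichotomy θ 0 with h | rfl | h
  · rw [Real.sign_of_neg h, Real.sign_of_neg (mul_neg_of_pos_of_neg hA h)]
  · simp
  · rw [Real.sign_of_pos h, Real.sign_of_pos (mul_pos hA h)]

theorem omegaBeta_mul_of_pos {A : ℝ} (hA : 0 < A) (θ : ℝ) :
    omegaBeta lam β ψ₁ (A * θ) = omegaBeta lam β ψ₁ θ := by
  rw [omegaBeta, omegaBeta, sign_mul_of_pos hA]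

theorem norm_omegaBeta (θ : ℝ) : ‖omegaBeta lam β ψ₁ θ‖
    = |ψ₁ * Real.Gamma (1 - β) * lam ^ (1 + β) / (-β * (1 + β))| := by
  rw [omegaBeta, norm_mul, Complex.norm_real, Real.norm_eq_abs,
    neg_mul Complex.I, mul_comm Complex.I, ← neg_mul, ← Complex.ofReal_neg,
    Complex.norm_exp_ofReal_mul_I, mul_one]

/-- `omegaBeta` depends on `θ` through its sign only, but its modulus is constant, so the factor
`|θ| ^ (1 + β)` forces continuity at `0`. -/
theorem continuousAt_abs_rpow_mul_omegaBeta (hβ₀ : 0 < β) :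
    ContinuousAt (fun θ : ℝ => -((|θ| ^ (1 + β) : ℝ) : ℂ) * omegaBeta lam β ψ₁ θ) 0 := by
  have hp : (0 : ℝ) < 1 + β := by linarith
  have h0 : Tendsto (fun θ : ℝ => |θ| ^ (1 + β) *
      |ψ₁ * Real.Gamma (1 - β) * lam ^ (1 + β) / (-β * (1 + β))|) (𝓝 0) (𝓝 0) := by
    have hc : Continuous fun θ : ℝ => |θ| ^ (1 + β) :=
      continuous_abs.rpow_const fun _ => Or.inr hp.le
    have := (hc.tendsto 0).mul_const
      |ψ₁ * Real.Gamma (1 - β) * lam ^ (1 + β) / (-β * (1 + β))|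
    simpa [Real.zero_rpow hp.ne'] using this
  rw [ContinuousAt, abs_zero, Real.zero_rpow hp.ne', Complex.ofReal_zero, neg_zero, zero_mul]
  refine squeeze_zero_norm (fun θ => le_of_eq ?_) h0
  rw [norm_mul, norm_neg, norm_omegaBeta, Complex.norm_real, Real.norm_eq_abs,
    abs_of_nonneg (Real.rpow_nonneg (abs_nonneg _) _)]

theorem cos_pi_mul_one_add_div_two_neg (hβ₀ : 0 < β) (hβ₁ : β < 1) :
    Real.cos (Real.pi * (1 + β) / 2) < 0 := by
  have := Real.pi_pos
  refine Real.cos_neg_of_pi_div_two_lt_of_lt ?_ ?_ <;> nlinarith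

/-- The scale parameter of the limit law, raised to the power `1 + β`. -/
def scalePow (lam β ψ₁ : ℝ) : ℝ :=
  ψ₁ * Real.Gamma (1 - β) * lam ^ (1 + β) / (-β * (1 + β)) * Real.cos (Real.pi * (1 + β) / 2)

/-- The angle `π (1 + β) / 2` lies in `(π / 2, π)`, so its cosine is negative and compensates the
sign of `-β (1 + β)`. -/
theorem scalePow_pos (hlam : 0 < lam) (hβ₀ : 0 < β) (hβ₁ : β < 1) (hψ₁ : 0 < ψ₁) :
    0 < scalePow lam β ψ₁ := by
  have hΓ := Real.Gamma_pos_of_pos (sub_pos.2 hβ₁)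
  refine mul_pos_of_neg_of_neg (div_neg_of_pos_of_neg (by positivity) ?_)
    (cos_pi_mul_one_add_div_two_neg hβ₀ hβ₁)
  nlinarith

/-- Factoring the cosine out of the complex exponential leaves `1 - i sign(θ) tan(π (1 + β) / 2)`,
the standard form with skewness `1`. -/
theorem neg_abs_rpow_mul_omegaBeta_eq (hβ₀ : 0 < β) (hβ₁ : β < 1) (θ : ℝ) :
    -((|θ| ^ (1 + β) : ℝ) : ℂ) * omegaBeta lam β ψ₁ θ
      = -((scalePow lam β ψ₁ * |θ| ^ (1 + β) : ℝ) : ℂ) *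
        (1 - Complex.I * ((Real.sign θ * Real.tan (Real.pi * (1 + β) / 2) : ℝ) : ℂ)) := by
  have hcos := (cos_pi_mul_one_add_div_two_neg hβ₀ hβ₁).ne
  have hexp : ∀ x : ℝ, Complex.exp (-Complex.I * (x : ℂ))
      = ((Real.cos x : ℝ) : ℂ) - Complex.I * ((Real.sin x : ℝ) : ℂ) := by
    intro x
    rw [show -Complex.I * (x : ℂ) = (-(x : ℂ)) * Complex.I by ring, Complex.exp_mul_I,
      Complex.cos_neg, Complex.sin_neg]
    push_cast; ring
  rcases lt_trichotomy θ 0 with h | rfl | h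
  · rw [omegaBeta, scalePow, Real.sign_of_neg h, hexp, Real.tan_eq_sin_div_cos,
      show Real.pi * -1 * (1 + β) / 2 = -(Real.pi * (1 + β) / 2) by ring, Real.cos_neg, Real.sin_neg]
    generalize Real.pi * (1 + β) / 2 = x at *
    have hcos' : (Real.cos x : ℂ) ≠ 0 := by exact_mod_cast hcos
    simp only [Complex.ofReal_mul, Complex.ofReal_neg, Complex.ofReal_div, Complex.ofReal_one] at *
    field_simp
  · simp [Real.zero_rpow (by linarith : 1 + β ≠ 0)]
  · rw [omegaBeta, scalePow, Real.sign_of_pos h, hexp, Real.tan_eq_sin_div_cos, mul_one]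
    generalize Real.pi * (1 + β) / 2 = x at *
    have hcos' : (Real.cos x : ℂ) ≠ 0 := by exact_mod_cast hcos
    simp only [Complex.ofReal_mul, Complex.ofReal_neg, Complex.ofReal_div, Complex.ofReal_one] at *
    field_simp

variable {Q : Measure ℝ}

theorem isTotallySkewedRight_of_charFun (hlam : 0 < lam) (hβ₀ : 0 < β) (hβ₁ : β < 1)
    (hψ₁ : 0 < ψ₁)
    (hQ : ∀ θ : ℝ, charFun Q θ =
      Complex.exp (-((|θ| ^ (1 + β) : ℝ) : ℂ) * omegaBeta lam β ψ₁ θ)) :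
    IsTotallySkewedRight (1 + β) Q := by
  have hs := scalePow_pos hlam hβ₀ hβ₁ hψ₁
  refine ⟨scalePow lam β ψ₁ ^ (1 / (1 + β)), 0, Real.rpow_pos_of_pos hs _, fun θ => ?_⟩
  rw [hQ, neg_abs_rpow_mul_omegaBeta_eq hβ₀ hβ₁, ← Real.rpow_mul hs.le,
    one_div_mul_cancel (by linarith : 1 + β ≠ 0), Real.rpow_one]
  simp

theorem isStableLaw_of_charFun [IsProbabilityMeasure Q]
    (hlam : 0 < lam) (hβ₀ : 0 < β) (hβ₁ : β < 1) (hψ₁ : 0 < ψ₁)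
    (hQ : ∀ θ : ℝ, charFun Q θ =
      Complex.exp (-((|θ| ^ (1 + β) : ℝ) : ℂ) * omegaBeta lam β ψ₁ θ)) :
    IsStableLaw (1 + β) Q := by
  have hs := scalePow_pos hlam hβ₀ hβ₁ hψ₁
  -- The law is strictly stable, so the shift is `0`: positive scalings do not change `omegaBeta`.
  -- Non-degeneracy follows at `θ = 1`, where a Dirac mass has modulus `1` but this law has `exp
  -- (-scalePow)`.
  refine ⟨fun x hx => ?_, fun A B hA hB => ⟨0, ?_⟩⟩
  · have h1 := hQ 1
    rw [hx, charFun_dirac, neg_abs_rpow_mul_omegaBeta_eq hβ₀ hβ₁] at h1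
    have h2 := congrArg (‖·‖) h1
    simp only [Complex.norm_exp_ofReal_mul_I] at h2
    rw [Complex.norm_exp, abs_one, Real.one_rpow, mul_one] at h2
    generalize scalePow lam β ψ₁ = a, Real.sign 1 * Real.tan (Real.pi * (1 + β) / 2) = b at h2 hs
    have hre : (-(a : ℂ) * (1 - Complex.I * (b : ℂ))).re = -a := by simp
    rw [hre, eq_comm, Real.exp_eq_one_iff] at h2
    linarith
  · have hAB : 0 < A ^ (1 + β) + B ^ (1 + β) :=
      add_pos (Real.rpow_pos_of_pos hA _) (Real.rpow_pos_of_pos hB _)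
    have hC := Real.rpow_pos_of_pos hAB (1 / (1 + β))
    have hmap : ∀ c : ℝ, IsProbabilityMeasure (Q.map fun z => c * z) := fun c =>
      Measure.isProbabilityMeasure_map (by fun_prop)
    have := hmap A
    have := hmap B
    have := hmap ((A ^ (1 + β) + B ^ (1 + β)) ^ (1 / (1 + β)))
    simp only [add_zero]
    refine Measure.ext_of_charFun (funext fun θ => ?_)
    rw [charFun_conv, charFun_map_mul, charFun_map_mul, charFun_map_mul, hQ, hQ, hQ,
      ← Complex.exp_add, omegaBeta_mul_of_pos hA, omegaBeta_mul_of_pos hB, omegaBeta_mul_of_pos hC]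
    simp only [abs_mul, abs_of_pos hA, abs_of_pos hB, abs_of_pos hC,
      Real.mul_rpow hA.le (abs_nonneg _), Real.mul_rpow hB.le (abs_nonneg _),
      Real.mul_rpow hC.le (abs_nonneg _)]
    rw [← Real.rpow_mul hAB.le, one_div_mul_cancel (by linarith : 1 + β ≠ 0), Real.rpow_one]
    congr 1
    push_cast
    ring

/-- The law of the centred conditional mean `lam / (1 - α)`. -/
def centredMeanLaw (lam β : ℝ) (ψ : ℝ → ℝ) : Measure ℝ :=
  (mixingLaw ψ β).map fun a => lam / (1 - a) - ∫ a', lam / (1 - a') ∂mixingLaw ψ β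

instance isProbabilityMeasure_centredMeanLaw {ψ : ℝ → ℝ} [IsProbabilityMeasure (mixingLaw ψ β)] :
    IsProbabilityMeasure (centredMeanLaw lam β ψ) :=
  Measure.isProbabilityMeasure_map (by fun_prop)

theorem tendsto_nat_mul_charFun_sub_one {ψ : ℝ → ℝ} [IsProbabilityMeasure (mixingLaw ψ β)]
    (hlam : 0 < lam) (hβ₀ : 0 < β) (hβ₁ : β < 1)
    (hψ_meas : AEMeasurable ψ (volume.restrict (Set.Ioo (0 : ℝ) 1)))
    (hψ_nonneg : ∀ x ∈ Set.Ioo (0 : ℝ) 1, 0 ≤ ψ x)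
    (hψ_lim : Tendsto ψ (𝓝[<] (1 : ℝ)) (𝓝 ψ₁)) (θ : ℝ) :
    Tendsto (fun N : ℕ => (N : ℂ) *
      (charFun (centredMeanLaw lam β ψ) ((N : ℝ) ^ (-(1 / (1 + β))) * θ) - 1)) atTop
      (𝓝 (-((|θ| ^ (1 + β) : ℝ) : ℂ) * omegaBeta lam β ψ₁ θ)) := by
  refine ((tendsto_rpow_mul_charFun_sub_one hlam hβ₀ hβ₁ hψ_meas hψ_nonneg hψ_lim θ).comp
    (tendsto_scale hβ₀)).congr fun N => ?_
  simp only [Function.comp_apply]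
  rw [scale_rpow hβ₀, centredMeanLaw, ← integral_cexp_eq_charFun (by fun_prop),
    mul_comm _ θ, Complex.ofReal_natCast]

/-- The law of the normalized sum of `N` independent copies of the centred conditional mean. -/
def scaledSumLaw (lam β : ℝ) (ψ : ℝ → ℝ) (N : ℕ) : Measure ℝ :=
  (convPow (centredMeanLaw lam β ψ) N).map fun z => (N : ℝ) ^ (-(1 / (1 + β))) * z

instance isProbabilityMeasure_scaledSumLaw {ψ : ℝ → ℝ} [IsProbabilityMeasure (mixingLaw ψ β)]
    (N : ℕ) : IsProbabilityMeasure (scaledSumLaw lam β ψ N) :=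
  Measure.isProbabilityMeasure_map (by fun_prop)

theorem charFun_scaledSumLaw {ψ : ℝ → ℝ} [IsProbabilityMeasure (mixingLaw ψ β)] (N : ℕ) (θ : ℝ) :
    charFun (scaledSumLaw lam β ψ N) θ
      = charFun (centredMeanLaw lam β ψ) ((N : ℝ) ^ (-(1 / (1 + β))) * θ) ^ N := by
  rw [scaledSumLaw, charFun_map_mul, charFun_convPow]

theorem tendsto_charFun_scaledSumLaw {ψ : ℝ → ℝ} [IsProbabilityMeasure (mixingLaw ψ β)]
    (hlam : 0 < lam) (hβ₀ : 0 < β) (hβ₁ : β < 1)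
    (hψ_meas : AEMeasurable ψ (volume.restrict (Set.Ioo (0 : ℝ) 1)))
    (hψ_nonneg : ∀ x ∈ Set.Ioo (0 : ℝ) 1, 0 ≤ ψ x)
    (hψ_lim : Tendsto ψ (𝓝[<] (1 : ℝ)) (𝓝 ψ₁)) (θ : ℝ) :
    Tendsto (fun N => charFun (scaledSumLaw lam β ψ N) θ) atTop
      (𝓝 (Complex.exp (-((|θ| ^ (1 + β) : ℝ) : ℂ) * omegaBeta lam β ψ₁ θ))) := by
  refine (Complex.tendsto_one_add_pow_exp_of_tendsto
    (tendsto_nat_mul_charFun_sub_one hlam hβ₀ hβ₁ hψ_meas hψ_nonneg hψ_lim θ)).congr fun N => ?_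
  rw [charFun_scaledSumLaw, add_sub_cancel]

/-- The `(1 + β)`-stable limit law. -/
theorem exists_stable_limit {ψ : ℝ → ℝ} [IsProbabilityMeasure (mixingLaw ψ β)]
    (hlam : 0 < lam) (hβ₀ : 0 < β) (hβ₁ : β < 1)
    (hψ_meas : AEMeasurable ψ (volume.restrict (Set.Ioo (0 : ℝ) 1)))
    (hψ_nonneg : ∀ x ∈ Set.Ioo (0 : ℝ) 1, 0 ≤ ψ x)
    (hψ_lim : Tendsto ψ (𝓝[<] (1 : ℝ)) (𝓝 ψ₁)) :
    ∃ Q : ProbabilityMeasure ℝ, ∀ θ : ℝ, charFun (Q : Measure ℝ) θ =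
      Complex.exp (-((|θ| ^ (1 + β) : ℝ) : ℂ) * omegaBeta lam β ψ₁ θ) :=
  exists_charFun_eq_of_tendsto
    (μ := fun N => ⟨scaledSumLaw lam β ψ N, isProbabilityMeasure_scaledSumLaw N⟩)
    (Complex.continuous_exp.continuousAt.comp (continuousAt_abs_rpow_mul_omegaBeta hβ₀))
    fun θ => tendsto_charFun_scaledSumLaw hlam hβ₀ hβ₁ hψ_meas hψ_nonneg hψ_lim θ

end

/-! ### Random lines as limit processes, and the characteristic function of the aggregate -/

noncomputable section

theorem measurable_line (c : ℝ≥0 → ℝ) : Measurable fun (z : ℝ) t => c t * z :=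
  measurable_pi_lambda _ fun t => measurable_id.const_mul (c t)

theorem measurable_restrict_coordinates (I : Finset ℝ≥0) :
    Measurable fun (f : ℝ≥0 → ℝ) (t : I) => f t :=
  measurable_pi_lambda _ fun t => measurable_pi_apply (t : ℝ≥0)

/-- The law of the process `t ↦ c t * Z`, where `Z` has law `ρ`. -/
def lineLaw (ρ : Measure ℝ) [IsProbabilityMeasure ρ] (c : ℝ≥0 → ℝ) :
    ProbabilityMeasure (ℝ≥0 → ℝ) :=
  ⟨ρ.map fun z t => c t * z, Measure.isProbabilityMeasure_map (measurable_line c).aemeasurable⟩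

theorem integral_cexp_line (ρ : Measure ℝ) {ι : Type*} [Fintype ι] (ξ c : ι → ℝ) :
    ∫ z, Complex.exp (Complex.I * (∑ i, ξ i * (c i * z) : ℝ)) ∂ρ
      = charFun ρ (∑ i, ξ i * c i) := by
  have e : ∀ z : ℝ, ∑ i, ξ i * (c i * z) = (∑ i, ξ i * c i) * z := fun z => by
    rw [Finset.sum_mul]; simp only [mul_assoc]
  simp only [e]
  rw [integral_cexp_eq_charFun (U := fun z => z) (by fun_prop), Measure.map_id']

theorem integral_cexp_lineLaw (ρ : Measure ℝ) [IsProbabilityMeasure ρ] (c : ℝ≥0 → ℝ)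
    (I : Finset ℝ≥0) (ξ : I → ℝ) :
    ∫ f, Complex.exp (Complex.I * (∑ i, ξ i * f (i : ℝ≥0) : ℝ)) ∂(lineLaw ρ c : Measure (ℝ≥0 → ℝ))
      = charFun ρ (∑ i, ξ i * c i) := by
  rw [← integral_cexp_line, lineLaw, ProbabilityMeasure.coe_mk, integral_map (measurable_line c).aemeasurable]
  exact Measurable.aestronglyMeasurable (by fun_prop)

theorem fddTendsto_lineLaw {Ω : Type*} [MeasurableSpace Ω] {P : Measure Ω} [IsProbabilityMeasure P]
    {Y : ℕ → ℝ≥0 → Ω → ℝ} (hY : ∀ n t, AEMeasurable (Y n t) P)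
    {ρ : Measure ℝ} [IsProbabilityMeasure ρ] {c : ℝ≥0 → ℝ}
    (h : ∀ (I : Finset ℝ≥0) (ξ : I → ℝ),
      Tendsto (fun n => ∫ ω, Complex.exp (Complex.I * (∑ i, ξ i * Y n i ω : ℝ)) ∂P) atTop
        (𝓝 (charFun ρ (∑ i, ξ i * c i)))) :
    FddTendsto Y (fun _ => P) (fun t f => f t) (lineLaw ρ c : Measure (ℝ≥0 → ℝ)) := by
  intro I
  refine tendstoInDistribution_of_tendsto_integral_cexp
    (fun n => aemeasurable_pi_lambda _ fun i => hY n i)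
    (measurable_restrict_coordinates I).aemeasurable fun ξ => ?_
  rw [integral_cexp_lineLaw]
  exact h I ξ

theorem fddTendsto_of_lineLaw {ρ : ℕ → Measure ℝ} [∀ n, IsProbabilityMeasure (ρ n)]
    {c : ℕ → ℝ≥0 → ℝ} {Q : Measure ℝ} [IsProbabilityMeasure Q]
    (h : ∀ (I : Finset ℝ≥0) (ξ : I → ℝ),
      Tendsto (fun n => charFun (ρ n) (∑ i, ξ i * c n i)) atTop
        (𝓝 (charFun Q (∑ i, ξ i * (i : ℝ≥0))))) :
    FddTendsto (fun _ t f => f t) (fun n => (lineLaw (ρ n) (c n) : Measure (ℝ≥0 → ℝ)))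
      (fun t z => z * (t : ℝ)) Q := by
  intro I
  refine tendstoInDistribution_of_tendsto_integral_cexp 
    (fun n => (measurable_restrict_coordinates I).aemeasurable)
    (by fun_prop) fun ξ => ?_
  simp only [integral_cexp_lineLaw]
  simp_rw [fun z : ℝ => fun i : I => mul_comm z ((i : ℝ≥0) : ℝ)]
  rw [integral_cexp_line Q ξ fun i => ((i : ℝ≥0) : ℝ)]
  exact h I ξ

variable {Ω₀ : Type*} [MeasurableSpace Ω₀] {P₀ : Measure Ω₀}
  {Ω : Type*} [MeasurableSpace Ω] {P : Measure Ω}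
  {lam : ℝ} {α : Ω₀ → ℝ} {X₀ : Ω₀ → ℕ} {ε : ℕ → Ω₀ → ℕ} {ξ : ℕ → ℕ → Ω₀ → ℕ}
  {X : ℕ → ℕ → Ω → ℕ}

theorem aemeasurable_aggregate
    (hX_copy : ∀ j, IdentDistrib (fun ω k => X j k ω) (fun ω k => inar X₀ ε ξ k ω) P P₀)
    (N n : ℕ) (t : ℝ≥0) : AEMeasurable (aggregate P X N n t) P := by
  have hX : ∀ j k, AEMeasurable (fun ω => (X j k ω : ℝ)) P := fun j k =>
    (Measurable.comp_aemeasurable (g := fun x : ℕ → ℕ => (x k : ℝ)) (by fun_prop)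
      (hX_copy j).aemeasurable_fst)
  exact Finset.aemeasurable_fun_sum _ fun j _ => Finset.aemeasurable_fun_sum _ fun k _ =>
    (hX j k).sub aemeasurable_const

variable [IsProbabilityMeasure P₀]

theorem integrable_copy_and_integral_eq (h : IsDriving P₀ lam α X₀ ε ξ) (hlam : 0 < lam)
    (hα : ∀ᵐ a ∂P₀.map α, a ∈ Set.Ioo (0 : ℝ) 1)
    (hW : Integrable (fun ω => lam / (1 - α ω)) P₀)
    (hX_copy : ∀ j, IdentDistrib (fun ω k => X j k ω) (fun ω k => inar X₀ ε ξ k ω) P P₀)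
    (j k : ℕ) :
    Integrable (fun ω => (X j k ω : ℝ)) P ∧
      ∫ ω, (X j k ω : ℝ) ∂P = ∫ ω, lam / (1 - α ω) ∂P₀ := by
  have hc : IdentDistrib (fun ω => (X j k ω : ℝ)) (fun ω => (inar X₀ ε ξ k ω : ℝ)) P P₀ :=
    (hX_copy j).comp (u := fun x : ℕ → ℕ => (x k : ℝ)) (by fun_prop)
  have hi := h.integrable_inar hlam hα k (f := fun _ => 1) measurable_const (by simp)
    (by simpa using hW)
  simp only [one_mul] at hi
  exact ⟨hc.integrable_iff.2 hi.1, hc.integral_eq.trans hi.2⟩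

/-- The characteristic function of a linear combination of the aggregated process. -/
theorem integral_cexp_aggregate (h : IsDriving P₀ lam α X₀ ε ξ) (hlam : 0 < lam)
    (hα : ∀ᵐ a ∂P₀.map α, a ∈ Set.Ioo (0 : ℝ) 1)
    (hW : Integrable (fun ω => lam / (1 - α ω)) P₀)
    (hX_indep : iIndepFun (fun j ω k => X j k ω) P)
    (hX_copy : ∀ j, IdentDistrib (fun ω k => X j k ω) (fun ω k => inar X₀ ε ξ k ω) P P₀)
    {ι : Type*} [Fintype ι] (w : ι → ℝ) (t : ι → ℝ≥0) (b : ℝ) (N n : ℕ) :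
    ∫ ω, Complex.exp (Complex.I * (∑ i, w i * (b * aggregate P X N n (t i) ω) : ℝ)) ∂P
      = (∫ ω, Complex.exp (Complex.I *
          (b * ∑ i, w i * ∑ k ∈ Finset.Icc 1 ⌊(n : ℝ) * t i⌋₊, dev lam α X₀ ε ξ k ω
            + b * (∑ i, w i * ⌊(n : ℝ) * t i⌋₊) *
              (lam / (1 - α ω) - ∫ ω', lam / (1 - α ω') ∂P₀) : ℝ)) ∂P₀) ^ N := by
  set m := ∫ ω', lam / (1 - α ω') ∂P₀
  have hm := fun j k => (integrable_copy_and_integral_eq h hlam hα hW hX_copy j k).2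
  -- The linear combination as a functional of a single path; the aggregate is the sum of `g` over
  -- independent copies.
  let g : (ℕ → ℕ) → ℝ := fun x =>
    ∑ i, w i * (b * ∑ k ∈ Finset.Icc 1 ⌊(n : ℝ) * t i⌋₊, ((x k : ℝ) - m))
  have hg : Measurable g := by fun_prop
  have e1 : ∀ ω, ∑ i, w i * (b * aggregate P X N n (t i) ω)
      = ∑ j ∈ Finset.range N, g (fun k => X j k ω) := by
    intro ω
    simp only [aggregate, hm, g]
    rw [Finset.sum_comm]
    refine Finset.sum_congr rfl fun i _ => ?_
    rw [Finset.mul_sum, Finset.mul_sum]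
  simp only [e1]
  rw [integral_cexp_sum_eq_pow hX_indep hX_copy hg]
  congr 1
  refine integral_congr_ae (ae_of_all _ fun ω => ?_)
  simp only [g]
  congr 3
  -- The basic decomposition: the second term does not depend on `k` and is collected `⌊n t⌋` times.
  have e2 : ∀ k, (inar X₀ ε ξ k ω : ℝ) - m
      = dev lam α X₀ ε ξ k ω + (lam / (1 - α ω) - m) := fun k => by rw [dev]; ring
  simp only [e2, Finset.sum_add_distrib, Finset.sum_const, Nat.card_Icc, add_tsub_cancel_right,
    nsmul_eq_mul]
  rw [Finset.mul_sum, Finset.mul_sum, Finset.sum_mul, ← Finset.sum_add_distrib]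
  refine Finset.sum_congr rfl fun i _ => ?_
  ring

theorem condCentred_sum_dev (h : IsDriving P₀ lam α X₀ ε ξ) (hlam : 0 < lam)
    (hα : ∀ᵐ a ∂P₀.map α, a ∈ Set.Ioo (0 : ℝ) 1)
    (hW : Integrable (fun ω => lam / (1 - α ω)) P₀)
    {ι : Type*} [Fintype ι] (w : ι → ℝ) (s : ι → Finset ℕ) :
    CondCentred P₀ α fun ω => ∑ i, w i * ∑ k ∈ s i, dev lam α X₀ ε ξ k ω :=
  CondCentred.sum h.measurable_param fun i _ =>
    (CondCentred.sum h.measurable_param fun k _ => h.condCentred_dev hlam hα hW k).const_mul (w i)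

theorem IsDriving.integral_sq_mul_linear_le (h : IsDriving P₀ lam α X₀ ε ξ) (hlam : 0 < lam)
    (hα : ∀ᵐ a ∂P₀.map α, a ∈ Set.Ioo (0 : ℝ) 1)
    {ι : Type*} [Fintype ι] (w : ι → ℝ) (s : ι → Finset ℕ) :
    Integrable (fun ω => (1 - α ω) ^ 2 * (∑ i, w i * ∑ k ∈ s i, dev lam α X₀ ε ξ k ω) ^ 2) P₀ ∧
    ∫ ω, (1 - α ω) ^ 2 * (∑ i, w i * ∑ k ∈ s i, dev lam α X₀ ε ξ k ω) ^ 2 ∂P₀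
      ≤ (Fintype.card ι : ℝ) * ∑ i, w i ^ 2 * (2 * lam * (s i).card) := by
  have hαm := h.measurable_param
  have hd := h.measurable_dev
  have hI := fun i => h.integral_sq_mul_sum_dev_le hlam hα (s i)
  have hJ : Integrable (fun ω => (Fintype.card ι : ℝ) * ∑ i, w i ^ 2 *
      ((1 - α ω) ^ 2 * (∑ k ∈ s i, dev lam α X₀ ε ξ k ω) ^ 2)) P₀ :=
    (integrable_finsetSum _ fun i _ => (hI i).1.const_mul _).const_mul _
  have hle : ∀ ω, (1 - α ω) ^ 2 * (∑ i, w i * ∑ k ∈ s i, dev lam α X₀ ε ξ k ω) ^ 2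
      ≤ (Fintype.card ι : ℝ) * ∑ i, w i ^ 2 *
        ((1 - α ω) ^ 2 * (∑ k ∈ s i, dev lam α X₀ ε ξ k ω) ^ 2) := by
    intro ω
    have := mul_le_mul_of_nonneg_left (sq_sum_le_card_mul_sum_sq (s := Finset.univ)
      (f := fun i => w i * ∑ k ∈ s i, dev lam α X₀ ε ξ k ω)) (sq_nonneg (1 - α ω))
    refine this.trans_eq ?_
    rw [Finset.card_univ, mul_left_comm, Finset.mul_sum]
    congr 1
    exact Finset.sum_congr rfl fun i _ => by ring
  have hint : Integrable
      (fun ω => (1 - α ω) ^ 2 * (∑ i, w i * ∑ k ∈ s i, dev lam α X₀ ε ξ k ω) ^ 2) P₀ := by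
    refine hJ.mono' (Measurable.aestronglyMeasurable (by fun_prop)) (ae_of_all _ fun ω => ?_)
    rw [Real.norm_of_nonneg (by positivity)]
    exact hle ω
  refine ⟨hint, (integral_mono hint hJ hle).trans ?_⟩
  rw [integral_const_mul, integral_finsetSum _ fun i _ => (hI i).1.const_mul _]
  refine mul_le_mul_of_nonneg_left (Finset.sum_le_sum fun i _ => ?_) (Nat.cast_nonneg _)
  rw [integral_const_mul]
  exact mul_le_mul_of_nonneg_left (hI i).2 (sq_nonneg _)

theorem tendsto_inv_mul_floor (t : ℝ≥0) :
    Tendsto (fun n : ℕ => (n : ℝ)⁻¹ * ⌊(n : ℝ) * t⌋₊) atTop (𝓝 t) := by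
  refine ((tendsto_nat_floor_mul_div_atTop t.2).comp tendsto_natCast_atTop_atTop).congr fun n => ?_
  simp only [Function.comp_apply]
  rw [mul_comm (n : ℝ), div_eq_inv_mul]
  rfl

/-- The exponent `1 - 2 / (1 + β)` is negative since `β < 1`: square integrable terms are negligible
on the stable scale. -/
theorem tendsto_nat_mul_scale_sq {β : ℝ} (hβ₀ : 0 < β) (hβ₁ : β < 1) :
    Tendsto (fun N : ℕ => (N : ℝ) * ((N : ℝ) ^ (-(1 / (1 + β)))) ^ 2) atTop (𝓝 0) := by
  have hp : 0 < 2 / (1 + β) - 1 := by rw [sub_pos, one_lt_div] <;> linarith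
  refine ((tendsto_rpow_neg_atTop hp).comp tendsto_natCast_atTop_atTop).congr' ?_
  filter_upwards [eventually_gt_atTop 0] with N hN
  have hN' : (0 : ℝ) < N := by exact_mod_cast hN
  simp only [Function.comp_apply]
  rw [← Real.rpow_natCast, ← Real.rpow_mul hN'.le]
  nth_rewrite 2 [← Real.rpow_one (N : ℝ)]
  rw [← Real.rpow_add hN']
  congr 1
  push_cast
  ring

end

/-! ### The two inner limits -/

noncomputable section

variable {Ω₀ : Type*} [MeasurableSpace Ω₀] {P₀ : Measure Ω₀}
  {Ω : Type*} [MeasurableSpace Ω] {P : Measure Ω}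
  {lam β ψ₁ : ℝ} {ψ : ℝ → ℝ}
  {α : Ω₀ → ℝ} {X₀ : Ω₀ → ℕ} {ε : ℕ → Ω₀ → ℕ} {ξ : ℕ → ℕ → Ω₀ → ℕ}
  {X : ℕ → ℕ → Ω → ℕ}

theorem charFun_centredMeanLaw (hαm : Measurable α) (hα : P₀.map α = mixingLaw ψ β) (c : ℝ) :
    charFun (centredMeanLaw lam β ψ) c = ∫ ω, Complex.exp (Complex.I *
      (c * (lam / (1 - α ω) - ∫ ω', lam / (1 - α ω') ∂P₀) : ℝ)) ∂P₀ := by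
  have hm : ∫ ω', lam / (1 - α ω') ∂P₀ = ∫ a, lam / (1 - a) ∂mixingLaw ψ β := by
    rw [← hα, integral_map hαm.aemeasurable (Measurable.aestronglyMeasurable (by fun_prop))]
  rw [integral_cexp_eq_charFun (by fun_prop), hm, centredMeanLaw, ← hα,
    Measure.map_map (by fun_prop) hαm]
  rfl

theorem ae_map_mem_Ioo (hα : P₀.map α = mixingLaw ψ β) :
    ∀ᵐ a ∂P₀.map α, a ∈ Set.Ioo (0 : ℝ) 1 :=
  hα ▸ ae_mem_Ioo_mixingLaw

variable [IsProbabilityMeasure P₀]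

theorem IsDriving.isProbabilityMeasure_mixingLaw (h : IsDriving P₀ lam α X₀ ε ξ)
    (hα : P₀.map α = mixingLaw ψ β) :
    IsProbabilityMeasure (mixingLaw ψ β) :=
  hα ▸ Measure.isProbabilityMeasure_map h.measurable_param.aemeasurable

theorem IsDriving.integrable_conditional_mean (h : IsDriving P₀ lam α X₀ ε ξ)
    (hα : P₀.map α = mixingLaw ψ β)
    (hβ₀ : 0 < β)
    (hψ_meas : AEMeasurable ψ (volume.restrict (Set.Ioo (0 : ℝ) 1)))
    (hψ_nonneg : ∀ x ∈ Set.Ioo (0 : ℝ) 1, 0 ≤ ψ x)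
    (hψ_lim : Tendsto ψ (𝓝[<] (1 : ℝ)) (𝓝 ψ₁)) :
    Integrable (fun ω => lam / (1 - α ω)) P₀ := by
  have := h.isProbabilityMeasure_mixingLaw hα
  have hi := integrable_inv_one_sub (lam := lam) hβ₀ hψ_meas hψ_nonneg hψ_lim
  rw [← hα] at hi
  exact hi.comp_measurable h.measurable_param

/-- For fixed `n`, the normalized aggregates converge to the stable law as `N → ∞`. -/
theorem tendsto_integral_cexp_aggregate_copies (h : IsDriving P₀ lam α X₀ ε ξ)
    (hα : P₀.map α = mixingLaw ψ β)
    (hlam : 0 < lam) (hβ₀ : 0 < β) (hβ₁ : β < 1)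
    (hψ_meas : AEMeasurable ψ (volume.restrict (Set.Ioo (0 : ℝ) 1)))
    (hψ_nonneg : ∀ x ∈ Set.Ioo (0 : ℝ) 1, 0 ≤ ψ x)
    (hψ_lim : Tendsto ψ (𝓝[<] (1 : ℝ)) (𝓝 ψ₁))
    (hX_indep : iIndepFun (fun j ω k => X j k ω) P)
    (hX_copy : ∀ j, IdentDistrib (fun ω k => X j k ω) (fun ω k => inar X₀ ε ξ k ω) P P₀)
    {ι : Type*} [Fintype ι] (w : ι → ℝ) (t : ι → ℝ≥0)
    (n : ℕ) :
    Tendsto (fun N : ℕ => ∫ ω, Complex.exp (Complex.I * (∑ i, w i *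
        ((n : ℝ)⁻¹ * (N : ℝ) ^ (-(1 / (1 + β))) * aggregate P X N n (t i) ω) : ℝ)) ∂P) atTop
      (𝓝 (Complex.exp (-((|∑ i, w i * ((n : ℝ)⁻¹ * ⌊(n : ℝ) * t i⌋₊)| ^ (1 + β) : ℝ) : ℂ)
        * omegaBeta lam β ψ₁ (∑ i, w i * ((n : ℝ)⁻¹ * ⌊(n : ℝ) * t i⌋₊))))) := by
  have := h.isProbabilityMeasure_mixingLaw hα
  have hαI := ae_map_mem_Ioo hα
  have hW := h.integrable_conditional_mean hα hβ₀ hψ_meas hψ_nonneg hψ_lim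
  set C := ∑ i, w i * ((n : ℝ)⁻¹ * ⌊(n : ℝ) * t i⌋₊) with hC
  set m := ∫ ω', lam / (1 - α ω') ∂P₀ with hm
  -- For fixed `n` the deviations form one square integrable, conditionally centred variable; `V`
  -- carries the heavy-tailed part.
  let U : Ω₀ → ℝ := fun ω =>
    (n : ℝ)⁻¹ * ∑ i, w i * ∑ k ∈ Finset.Icc 1 ⌊(n : ℝ) * t i⌋₊, dev lam α X₀ ε ξ k ω
  have hU : CondCentred P₀ α U := (condCentred_sum_dev h hlam hαI hW w _).const_mul _
  let s : ℕ → ℝ := fun N => (N : ℝ) ^ (-(1 / (1 + β)))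
  let V : ℕ → ℝ → ℝ := fun N a => s N * C * (lam / (1 - a) - m)
  have hV : ∀ N, Measurable (V N) := fun N => by fun_prop
  let A : ℕ → ℂ := fun N =>
    ∫ ω, Complex.exp (Complex.I * (s N * U ω + V N (α ω) : ℝ)) ∂P₀
  have hA : ∀ N : ℕ, ∫ ω, Complex.exp (Complex.I * (∑ i, w i *
      ((n : ℝ)⁻¹ * (N : ℝ) ^ (-(1 / (1 + β))) * aggregate P X N n (t i) ω) : ℝ)) ∂P
      = (1 + (A N - 1)) ^ N := by
    intro N
    rw [integral_cexp_aggregate h hlam hαI hW hX_indep hX_copy, add_sub_cancel]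
    congr 1
    refine integral_congr_ae (ae_of_all _ fun ω => ?_)
    simp only [U, V, s]
    congr 3
    have : ∑ i, w i * (⌊(n : ℝ) * t i⌋₊ : ℝ) * (n : ℝ)⁻¹ = C :=
      Finset.sum_congr rfl fun i _ => by ring
    rw [← this, ← Finset.sum_mul]
    ring
  simp only [hA]
  refine Complex.tendsto_one_add_pow_exp_of_tendsto ?_
  have hB : ∀ N, ∫ ω, Complex.exp (Complex.I * (V N (α ω) : ℝ)) ∂P₀
      = charFun (centredMeanLaw lam β ψ) (s N * C) := fun N =>
    (charFun_centredMeanLaw h.measurable_param hα _).symm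
  have hlim := tendsto_nat_mul_charFun_sub_one hlam hβ₀ hβ₁ hψ_meas hψ_nonneg hψ_lim C
  -- Dropping `U` costs `3 s ^ 2 𝔼 U ^ 2` per copy, and `N s ^ 2 → 0`.
  have herr : Tendsto (fun N : ℕ => (N : ℂ) *
      (A N - charFun (centredMeanLaw lam β ψ) (s N * C))) atTop (𝓝 0) := by
    have h0 : Tendsto (fun N : ℕ => 3 * ((N : ℝ) * s N ^ 2) * ∫ ω, U ω ^ 2 ∂P₀) atTop (𝓝 0) := by
      simpa using ((show Tendsto (fun N : ℕ => (N : ℝ) * s N ^ 2) atTop (𝓝 0) from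
        tendsto_nat_mul_scale_sq hβ₀ hβ₁).const_mul 3).mul_const (∫ ω, U ω ^ 2 ∂P₀)
    refine squeeze_zero_norm (fun N => ?_) h0
    rw [norm_mul, Complex.norm_natCast, ← hB]
    have := mul_le_mul_of_nonneg_left
      (hU.norm_integral_cexp_sub_le h.measurable_param (hV N) (s N)) (Nat.cast_nonneg (α := ℝ) N)
    refine this.trans_eq (by ring)
  have := herr.add hlim
  rw [zero_add] at this
  refine this.congr fun N => ?_
  simp only [s]
  ring

/-- For fixed `N`, the normalized aggregates converge to a line with random slope as `n → ∞`. -/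
theorem tendsto_integral_cexp_aggregate_time (h : IsDriving P₀ lam α X₀ ε ξ)
    (hα : P₀.map α = mixingLaw ψ β)
    (hlam : 0 < lam) (hβ₀ : 0 < β)
    (hψ_meas : AEMeasurable ψ (volume.restrict (Set.Ioo (0 : ℝ) 1)))
    (hψ_nonneg : ∀ x ∈ Set.Ioo (0 : ℝ) 1, 0 ≤ ψ x)
    (hψ_lim : Tendsto ψ (𝓝[<] (1 : ℝ)) (𝓝 ψ₁))
    (hX_indep : iIndepFun (fun j ω k => X j k ω) P)
    (hX_copy : ∀ j, IdentDistrib (fun ω k => X j k ω) (fun ω k => inar X₀ ε ξ k ω) P P₀)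
    {ι : Type*} [Fintype ι] (w : ι → ℝ) (t : ι → ℝ≥0)
    (N : ℕ) :
    Tendsto (fun n : ℕ => ∫ ω, Complex.exp (Complex.I * (∑ i, w i *
        ((n : ℝ)⁻¹ * (N : ℝ) ^ (-(1 / (1 + β))) * aggregate P X N n (t i) ω) : ℝ)) ∂P) atTop
      (𝓝 (charFun (scaledSumLaw lam β ψ N) (∑ i, w i * t i))) := by
  have := h.isProbabilityMeasure_mixingLaw hα
  have hαm := h.measurable_param
  have hαI := ae_map_mem_Ioo hα
  have hW := h.integrable_conditional_mean hα hβ₀ hψ_meas hψ_nonneg hψ_lim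
  have hd := h.measurable_dev
  set m := ∫ ω', lam / (1 - α ω') ∂P₀ with hm
  set s : ℝ := (N : ℝ) ^ (-(1 / (1 + β))) with hs
  let V : ℕ → Ω₀ → ℝ := fun n ω =>
    (n : ℝ)⁻¹ * s * ∑ i, w i * ∑ k ∈ Finset.Icc 1 ⌊(n : ℝ) * t i⌋₊, dev lam α X₀ ε ξ k ω
  let C : ℕ → ℝ := fun n => (n : ℝ)⁻¹ * s * (∑ i, w i * ⌊(n : ℝ) * t i⌋₊)
  let R : ℕ → Ω₀ → ℝ := fun n ω => C n * (lam / (1 - α ω) - m)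
  have hlin := fun n : ℕ => h.integral_sq_mul_linear_le hlam hαI w
    fun i => Finset.Icc 1 ⌊(n : ℝ) * t i⌋₊
  have hsq : ∀ n ω, (1 - α ω) ^ 2 * V n ω ^ 2 = ((n : ℝ)⁻¹ * s) ^ 2 * ((1 - α ω) ^ 2 *
      (∑ i, w i * ∑ k ∈ Finset.Icc 1 ⌊(n : ℝ) * t i⌋₊, dev lam α X₀ ε ξ k ω) ^ 2) := by
    intro n ω
    simp only [V]
    ring
  have herr := tendsto_integral_cexp_sub_of_weighted_sq (P := P₀) (B := fun ω => 1 - α ω)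
    (by fun_prop)
    (by filter_upwards [h.ae_mem_Ioo hαI] with ω hω using sub_pos.2 hω.2)
    (V := V) (R := R) (fun n => by fun_prop) (fun n => by fun_prop)
    -- `Fintype.card ι` comes from Cauchy–Schwarz over the times, and `t i` from `⌊n t⌋ ≤ n t`;
    -- dividing by `n ^ 2` leaves `K / n`.
    (K := s ^ 2 * ((Fintype.card ι : ℝ) * ∑ i, w i ^ 2 * (2 * lam * t i)))
    (fun n => by simp only [hsq]; exact (hlin n).1.const_mul _)
    (fun n hn => by
      have hn' : (0 : ℝ) < n := by exact_mod_cast hn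
      simp only [hsq]
      rw [integral_const_mul]
      refine (mul_le_mul_of_nonneg_left (hlin n).2 (sq_nonneg _)).trans ?_
      have hfl : ∀ i, ((Finset.Icc 1 ⌊(n : ℝ) * t i⌋₊).card : ℝ) ≤ n * t i := fun i => by
        rw [Nat.card_Icc, add_tsub_cancel_right]
        exact Nat.floor_le (by positivity)
      have : ∑ i, w i ^ 2 * (2 * lam * ((Finset.Icc 1 ⌊(n : ℝ) * t i⌋₊).card : ℝ))
          ≤ (n : ℝ) * ∑ i, w i ^ 2 * (2 * lam * t i) := by
        rw [Finset.mul_sum]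
        refine Finset.sum_le_sum fun i _ => ?_
        have := mul_le_mul_of_nonneg_left (hfl i)
          (mul_nonneg (sq_nonneg (w i)) (mul_nonneg zero_le_two hlam.le))
        linarith
      calc ((n : ℝ)⁻¹ * s) ^ 2 * ((Fintype.card ι : ℝ) *
            ∑ i, w i ^ 2 * (2 * lam * ((Finset.Icc 1 ⌊(n : ℝ) * t i⌋₊).card : ℝ)))
          ≤ ((n : ℝ)⁻¹ * s) ^ 2 * ((Fintype.card ι : ℝ) *
            ((n : ℝ) * ∑ i, w i ^ 2 * (2 * lam * t i))) := by gcongr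
        _ = _ := by
          generalize ∑ i, w i ^ 2 * (2 * lam * (t i : ℝ)) = S
          field_simp)
  have hCt : Tendsto C atTop (𝓝 (s * ∑ i, w i * t i)) := by
    have : Tendsto (fun n : ℕ => s * ∑ i, w i * ((n : ℝ)⁻¹ * ⌊(n : ℝ) * t i⌋₊)) atTop
        (𝓝 (s * ∑ i, w i * t i)) :=
      (tendsto_finsetSum _ fun i _ => (tendsto_inv_mul_floor (t i)).const_mul (w i)).const_mul s
    refine this.congr fun n => ?_
    simp only [C, Finset.mul_sum]
    exact Finset.sum_congr rfl fun i _ => by ring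
  have hmain : Tendsto (fun n => ∫ ω, Complex.exp (Complex.I * (R n ω : ℝ)) ∂P₀) atTop
      (𝓝 (charFun (centredMeanLaw lam β ψ) (s * ∑ i, w i * t i))) := by
    refine ((continuous_charFun.tendsto _).comp hCt).congr fun n => ?_
    exact charFun_centredMeanLaw hαm hα _
  -- The number of copies is fixed here, so the limit passes through the `N`-th power.
  have hsum := (herr.add hmain).pow N
  rw [zero_add, ← charFun_scaledSumLaw] at hsum
  refine hsum.congr fun n => ?_
  rw [integral_cexp_aggregate h hlam hαI hW hX_indep hX_copy, sub_add_cancel]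

end

end RandomizedINAR

/-! ### Assembly of the iterated limits -/

theorem mainTheorem6
    {Ω₀ : Type*} [MeasurableSpace Ω₀] (P₀ : Measure Ω₀) [IsProbabilityMeasure P₀]
    {Ω : Type*} [MeasurableSpace Ω] (P : Measure Ω) [IsProbabilityMeasure P]
    (lam β ψ₁ : ℝ) (hlam : 0 < lam) (hβ₀ : 0 < β) (hβ₁ : β < 1) (hψ₁ : 0 < ψ₁)
    (ψ : ℝ → ℝ) (hψ_meas : AEMeasurable ψ (volume.restrict (Set.Ioo (0 : ℝ) 1)))
    (hψ_nonneg : ∀ x ∈ Set.Ioo (0 : ℝ) 1, 0 ≤ ψ x)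
    (hψ_lim : Tendsto ψ (𝓝[<] (1 : ℝ)) (𝓝 ψ₁))
    -- the randomized INAR(1) process `inar X₀ ε ξ` with random thinning parameter `α`
    (α : Ω₀ → ℝ) (X₀ : Ω₀ → ℕ) (ε : ℕ → Ω₀ → ℕ) (ξ : ℕ → ℕ → Ω₀ → ℕ)
    (hdriving : RandomizedINAR.IsDriving P₀ lam α X₀ ε ξ)
    (hα : P₀.map α = RandomizedINAR.mixingLaw ψ β)
    -- independent copies `X 0, X 1, …` of this process
    (X : ℕ → ℕ → Ω → ℕ)
    (hX_indep : iIndepFun (fun j ω k => X j k ω) P)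
    (hX_copy : ∀ j, IdentDistrib (fun ω k => X j k ω)
      (fun ω k => RandomizedINAR.inar X₀ ε ξ k ω) P P₀) :
    (∀ j k, Integrable (fun ω => (X j k ω : ℝ)) P) ∧
    ∃ Q : ProbabilityMeasure ℝ,
      (∀ θ : ℝ, charFun (Q : Measure ℝ) θ =
        Complex.exp (-((|θ| ^ (1 + β) : ℝ) : ℂ) * RandomizedINAR.omegaBeta lam β ψ₁ θ)) ∧
      RandomizedINAR.IsStableLaw (1 + β) (Q : Measure ℝ) ∧
      RandomizedINAR.IsTotallySkewedRight (1 + β) (Q : Measure ℝ) ∧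
      -- first `N → ∞`, then `n → ∞`
      RandomizedINAR.IteratedFddLimit
        (fun n N t ω => (n : ℝ)⁻¹ * (N : ℝ) ^ (-(1 / (1 + β))) *
          RandomizedINAR.aggregate P X N n t ω)
        P (fun t z => z * (t : ℝ)) (Q : Measure ℝ) ∧
      -- first `n → ∞`, then `N → ∞`
      RandomizedINAR.IteratedFddLimit
        (fun N n t ω => (n : ℝ)⁻¹ * (N : ℝ) ^ (-(1 / (1 + β))) *
          RandomizedINAR.aggregate P X N n t ω)
        P (fun t z => z * (t : ℝ)) (Q : Measure ℝ) := by
  have := hdriving.isProbabilityMeasure_mixingLaw hα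
  have hαI := RandomizedINAR.ae_map_mem_Ioo hα
  have hW := hdriving.integrable_conditional_mean hα hβ₀ hψ_meas hψ_nonneg hψ_lim
  have hY : ∀ (N n : ℕ) (t : ℝ≥0), AEMeasurable (fun ω => (n : ℝ)⁻¹ *
      (N : ℝ) ^ (-(1 / (1 + β))) * RandomizedINAR.aggregate P X N n t ω) P := fun N n t =>
    (RandomizedINAR.aemeasurable_aggregate hX_copy N n t).const_mul _
  obtain ⟨Q, hQ⟩ :=
    RandomizedINAR.exists_stable_limit hlam hβ₀ hβ₁ hψ_meas hψ_nonneg hψ_lim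
  refine ⟨fun j k =>
      (RandomizedINAR.integrable_copy_and_integral_eq hdriving hlam hαI hW hX_copy j k).1,
    Q, hQ, RandomizedINAR.isStableLaw_of_charFun hlam hβ₀ hβ₁ hψ₁ hQ,
    RandomizedINAR.isTotallySkewedRight_of_charFun hlam hβ₀ hβ₁ hψ₁ hQ,
    -- For fixed `n` the stable slope is already present, but time is still a step function.
    ⟨fun n => RandomizedINAR.lineLaw Q fun t => (n : ℝ)⁻¹ * ⌊(n : ℝ) * t⌋₊, ?_, ?_⟩,
    -- For fixed `N` the paths are already lines, with the normalized sum of `N` centred conditional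
    -- means as slope.
    ⟨fun N => RandomizedINAR.lineLaw (RandomizedINAR.scaledSumLaw lam β ψ N) fun t => t, ?_, ?_⟩⟩
  · refine fun n _ => RandomizedINAR.fddTendsto_lineLaw (fun N t => hY N n t) fun I w => ?_
    rw [hQ]
    exact RandomizedINAR.tendsto_integral_cexp_aggregate_copies hdriving hα hlam hβ₀ hβ₁ hψ_meas
      hψ_nonneg hψ_lim hX_indep hX_copy w (fun i : I => (i : ℝ≥0)) n
  · exact RandomizedINAR.fddTendsto_of_lineLaw fun I w =>
      (continuous_charFun.tendsto _).comp (tendsto_finsetSum _ fun i _ =>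
        (RandomizedINAR.tendsto_inv_mul_floor (i : ℝ≥0)).const_mul (w i))
  · exact fun N _ => RandomizedINAR.fddTendsto_lineLaw (fun n t => hY N n t) fun I w =>
      RandomizedINAR.tendsto_integral_cexp_aggregate_time hdriving hα hlam hβ₀ hψ_meas
        hψ_nonneg hψ_lim hX_indep hX_copy w (fun i : I => (i : ℝ≥0)) N
  · refine RandomizedINAR.fddTendsto_of_lineLaw fun I w => ?_
    rw [hQ]
    exact RandomizedINAR.tendsto_charFun_scaledSumLaw hlam hβ₀ hβ₁ hψ_meas hψ_nonneg hψ_lim _
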